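/- All graphs are finite and simple. A graph is planar if it is $\{K_5,K_{3,3}\}$-minor free. For a graph $G$ on $n\ge 2$ vertices let $\lambda_1(G)\ge\lambda_2(G)\ge\dots\ge\lambda_n(G)$ be the eigenvalues of its adjacency matrix, counted with multiplicity. For $s\ge 3$ let $F_s$ be the graph obtained from $K_{2,s}$, with colour classes $\{v_1,v_2\}$ and $\{u_1,\dots,u_s\}$, by subdividing each of the edges $v_1u_1$ and $v_1u_2$ once and attaching one pendant edge to each of $u_3,\dots,u_s$. Let $\mathcal F_1=\{F_s : s\ge 3\}$. Let $H_1,\dots,H_{13}$ be the following graphs, where $ij$ denotes the edge $\{i,j\}$: - $H_{1}$, on $\{0,\dots,7\}$: $01,\ 12,\ 23,\ 34,\ 40,\ 05,\ 16,\ 37,\ 57,\ 67$; - $H_{2}$, on $\{0,\dots,9\}$: $01,\ 12,\ 23,\ 30,\ 14,\ 34,\ 15,\ 35,\ 06,\ 07,\ 46,\ 57,\ 18,\ 39$; - $H_{3}$, on $\{0,\dots,8\}$: $01,\ 12,\ 23,\ 30,\ 04,\ 05,\ 06,\ 27,\ 28,\ 47,\ 57,\ 58,\ 68$; - $H_{4}$,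 on $\{0,\dots,8\}$: $01,\ 12,\ 23,\ 30,\ 04,\ 05,\ 06,\ 17,\ 28,\ 47,\ 48,\ 58$; - $H_{5}$, on $\{0,\dots,9\}$: $01,\ 12,\ 23,\ 30,\ 04,\ 05,\ 06,\ 17,\ 18,\ 19,\ 47,\ 58,\ 69$; - $H_{6}$, on $\{0,\dots,8\}$: $01,\ 12,\ 23,\ 30,\ 04,\ 05,\ 06,\ 17,\ 38,\ 47,\ 48$; - $H_{7}$, on $\{0,\dots,8\}$: $01,\ 12,\ 23,\ 30,\ 04,\ 05,\ 16,\ 27,\ 28,\ 47,\ 57,\ 58,\ 56$; - $H_{8}$, on $\{0,\dots,8\}$: $01,\ 12,\ 23,\ 30,\ 04,\ 05,\ 16,\ 27,\ 38,\ 46,\ 47,\ 48$; - $H_{9}$, on $\{0,\dots,8\}$: $01,\ 12,\ 23,\ 30,\ 04,\ 05,\ 16,\ 17,\ 28,\ 46,\ 48$; - $H_{10}$, on $\{0,\dots,7\}$: $01,\ 12,\ 23,\ 30,\ 04,\ 15,\ 26,\ 37,\ 45,\ 56,\ 67,\ 74$; - $H_{11}$, on $\{0,\dots,9\}$: $01,\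 12,\ 23,\ 30,\ 14,\ 34,\ 05,\ 25,\ 06,\ 07,\ 18,\ 39,\ 46$; - $H_{12}$, on $\{0,\dots,9\}$: $01,\ 12,\ 23,\ 30,\ 14,\ 34,\ 05,\ 25,\ 06,\ 17,\ 28,\ 39,\ 46,\ 48$; - $H_{13}$, on $\{0,\dots,9\}$: $01,\ 12,\ 23,\ 30,\ 14,\ 34,\ 05,\ 25,\ 06,\ 17,\ 28,\ 39$. **Theorem 3.1.** Let $G$ be a connected triangle-free planar graph with at least two vertices. Then $\lambda_2(G)\le 1$ if and only if $G$ is isomorphic to an induced subgraph of a graph belonging to $\mathcal F_1\cup\{H_1,H_2,\dots,H_{13}\}$. -/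

import Mathlib

namespace TriangleFreePlanar

/-- `H` is a minor of `G`: there are pairwise disjoint vertex sets of `G`, one for each vertex
of `H`, each inducing a (nonempty) connected subgraph, such that adjacent vertices of `H` have
sets joined by an edge of `G`. -/
def IsMinor {W V : Type*} (H : SimpleGraph W) (G : SimpleGraph V) : Prop :=
  ∃ B : W → Set V,
    (∀ x, (G.induce (B x)).Connected) ∧
    (∀ x y, x ≠ y → Disjoint (B x) (B y)) ∧
    (∀ x y, H.Adj x y → ∃ a ∈ B x, ∃ b ∈ B y, G.Adj a b)

/-- Planarity of a finite graph, as freeness from the minors `K₅` and `K₃,₃`. -/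
def IsPlanar {V : Type*} (G : SimpleGraph V) : Prop :=
  ¬ IsMinor (⊤ : SimpleGraph (Fin 5)) G ∧
    ¬ IsMinor (completeBipartiteGraph (Fin 3) (Fin 3)) G

/-- The second largest eigenvalue, with multiplicity, of the adjacency matrix of a graph on
at least two vertices. The list `eigenvalues₀` is in nonincreasing order, with index from `0`. -/
noncomputable def lambda2 {V : Type*} [Fintype V] [DecidableEq V] (G : SimpleGraph V)
    [DecidableRel G.Adj] (hV : 1 < Fintype.card V) : ℝ :=
  (G.isHermitian_adjMatrix ℝ).eigenvalues₀ ⟨1, hV⟩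

/-- The vertices of the graph `F1 s`. The vertices `v1`, `v2` and `u i` are those of `K₂,ₛ`.
For the first two indices `i` the vertex `w i` is the one that subdivides the edge `v1 u i`; for
the other indices it is the end of the pendant edge attached to `u i`. -/
inductive F1Vertex (s : ℕ) : Type
  | v1 : F1Vertex s
  | v2 : F1Vertex s
  | u (i : Fin s) : F1Vertex s
  | w (i : Fin s) : F1Vertex s

/-- The edges of `F1 s`, each in one direction. -/
def F1Edge (s : ℕ) : F1Vertex s → F1Vertex s → Prop
  | .v2, .u _ => True
  | .v1, .u i => 2 ≤ i.val
  | .v1, .w i => i.val < 2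
  | .u i, .w j => i = j
  | _, _ => False

/-- The graph obtained from `K₂,ₛ`, with classes `{v1, v2}` and `{u i}`, by subdividing the
edges from `v1` to the first two `u i` and attaching a pendant edge to every other `u i`. -/
def F1 (s : ℕ) : SimpleGraph (F1Vertex s) :=
  SimpleGraph.fromRel (F1Edge s)

/-- The graph on `{0, …, n - 1}` with a given list of edges. -/
def ofEdges (n : ℕ) (l : List (Fin n × Fin n)) : SimpleGraph (Fin n) :=
  SimpleGraph.fromRel (fun a b => (a, b) ∈ l)

def H1 : SimpleGraph (Fin 8) :=
  ofEdges 8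
   [(0, 1), (1, 2), (2, 3), (3, 4), (4, 0), (0, 5), (1, 6), (3, 7), (5, 7), (6, 7)]

def H2 : SimpleGraph (Fin 10) :=
  ofEdges 10
   [(0, 1), (1, 2), (2, 3), (3, 0), (1, 4), (3, 4), (1, 5), (3, 5), (0, 6), (0, 7), (4, 6),
    (5, 7), (1, 8), (3, 9)]

def H3 : SimpleGraph (Fin 9) :=
  ofEdges 9
   [(0, 1), (1, 2), (2, 3), (3, 0), (0, 4), (0, 5), (0, 6), (2, 7), (2, 8), (4, 7), (5, 7),
    (5, 8), (6, 8)]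

def H4 : SimpleGraph (Fin 9) :=
  ofEdges 9
   [(0, 1), (1, 2), (2, 3), (3, 0), (0, 4), (0, 5), (0, 6), (1, 7), (2, 8), (4, 7), (4, 8),
    (5, 8)]

def H5 : SimpleGraph (Fin 10) :=
  ofEdges 10
   [(0, 1), (1, 2), (2, 3), (3, 0), (0, 4), (0, 5), (0, 6), (1, 7), (1, 8), (1, 9), (4, 7),
    (5, 8), (6, 9)]

def H6 : SimpleGraph (Fin 9) :=
  ofEdges 9
   [(0, 1), (1, 2), (2, 3), (3, 0), (0, 4), (0, 5), (0, 6), (1, 7), (3, 8), (4, 7), (4, 8)]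

def H7 : SimpleGraph (Fin 9) :=
  ofEdges 9
   [(0, 1), (1, 2), (2, 3), (3, 0), (0, 4), (0, 5), (1, 6), (2, 7), (2, 8), (4, 7), (5, 7),
    (5, 8), (5, 6)]

def H8 : SimpleGraph (Fin 9) :=
  ofEdges 9
   [(0, 1), (1, 2), (2, 3), (3, 0), (0, 4), (0, 5), (1, 6), (2, 7), (3, 8), (4, 6), (4, 7),
    (4, 8)]

def H9 : SimpleGraph (Fin 9) :=
  ofEdges 9
   [(0, 1), (1, 2), (2, 3), (3, 0), (0, 4), (0, 5), (1, 6), (1, 7), (2, 8), (4, 6), (4, 8)]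

def H10 : SimpleGraph (Fin 8) :=
  ofEdges 8
   [(0, 1), (1, 2), (2, 3), (3, 0), (0, 4), (1, 5), (2, 6), (3, 7), (4, 5), (5, 6), (6, 7),
    (7, 4)]

def H11 : SimpleGraph (Fin 10) :=
  ofEdges 10
   [(0, 1), (1, 2), (2, 3), (3, 0), (1, 4), (3, 4), (0, 5), (2, 5), (0, 6), (0, 7), (1, 8),
    (3, 9), (4, 6)]

def H12 : SimpleGraph (Fin 10) :=
  ofEdges 10
   [(0, 1), (1, 2), (2, 3), (3, 0), (1, 4), (3, 4), (0, 5), (2, 5), (0, 6), (1, 7), (2, 8),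
    (3, 9), (4, 6), (4, 8)]

def H13 : SimpleGraph (Fin 10) :=
  ofEdges 10
   [(0, 1), (1, 2), (2, 3), (3, 0), (1, 4), (3, 4), (0, 5), (2, 5), (0, 6), (1, 7), (2, 8),
    (3, 9)]

end TriangleFreePlanar

namespace TriangleFreePlanar

open Matrix

/-! ### The second eigenvalue as a condition on a quadratic form -/

section Spectral

variable {n : Type*} [Fintype n] [DecidableEq n] {A : Matrix n n ℝ}

/-! The spectral condition is used only through quadratic forms. By the Courant–Fischer principle,
the second eigenvalue is at most 1 exactly when the form of `A - 1` is nonpositive on the kernel of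
some linear form (`eigenvalues₀_one_le_one_iff`, `HasSmallLambda2`). So stated, the condition passes
to induced subgraphs by extending vectors by zero, is refuted by a plane on which the form is
positive definite, and is proved by writing a multiple of `1 - A`, plus the square of a linear form,
as a sum of squares. The "if" direction therefore needs only the graphs of the list:
`hasSmallLambda2_F1` gives one argument for all `s`, and each of the thirteen other graphs has an
integer certificate.

For "only if" the maximum degree decides. Suppose that `c` has degree at least six. Two small
forbidden graphs show that each vertex either has at most one neighbour in common with `c` or misses
at most two neighbours of `c`. Since `K₃,₃` is excluded, at most one vertex `z` other than `c` is of
the second kind (`eq_of_isOpposite`). The vertices of the first kind hang on neighbours of `c`, at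
most one on each, or are adjacent to `z` only, and at most two places deviate from the regular
pattern (`card_specialVertices_le_two`). This is the shape of an induced subgraph of `F1 s` with `c`
as `v1` and `z` as `v2` (`isIndContained_F1_of_structure`).

If all degrees are below six, the graphs are found by exhaustive generation. A connected graph grows
from a single vertex by adding one vertex at a time, each adjacent to an earlier one, and in a
triangle-free graph the neighbours of the new vertex are independent. The lists `level1`, …,
`level12` are closed under this growth: every extension of a listed graph contains an obstruction (a
graph with second eigenvalue above 1, a nonplanar graph, or the star with six leaves) or is
isomorphic to a graph of the next list. Every listed graph comes with an embedding into `F1 7` or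
one of the thirteen other graphs, and nothing survives on thirteen vertices. Soundness of a growth
step is `ContainsEntry.succ`; the closure itself is a finite computation. -/

lemma sum_dotProduct_eigenvectorBasis (hA : A.IsHermitian) (v : n → ℝ) :
    ∑ i, ((hA.eigenvectorBasis i).ofLp ⬝ᵥ v) • (hA.eigenvectorBasis i).ofLp = v := by
  have h := hA.eigenvectorBasis.sum_repr' (WithLp.toLp 2 v)
  have h2 := congrArg WithLp.ofLp h
  rw [WithLp.ofLp_sum] at h2
  simpa [EuclideanSpace.inner_eq_star_dotProduct, dotProduct_comm] using h2

lemma eigenvectorBasis_dotProduct (hA : A.IsHermitian) (i j : n) :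
    (hA.eigenvectorBasis i).ofLp ⬝ᵥ (hA.eigenvectorBasis j).ofLp = if i = j then 1 else 0 := by
  have h := orthonormal_iff_ite.1 hA.eigenvectorBasis.orthonormal i j
  rw [EuclideanSpace.inner_eq_star_dotProduct, dotProduct_comm] at h
  simpa using h

lemma dotProduct_self_eq_sum (hA : A.IsHermitian) (v : n → ℝ) :
    v ⬝ᵥ v = ∑ i, ((hA.eigenvectorBasis i).ofLp ⬝ᵥ v) ^ 2 := by
  conv_lhs => rw [← sum_dotProduct_eigenvectorBasis hA v, sum_dotProduct]
  refine Finset.sum_congr rfl fun i _ => ?_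
  rw [sum_dotProduct_eigenvectorBasis hA v, smul_dotProduct, smul_eq_mul, sq]

lemma dotProduct_mulVec_eq_sum (hA : A.IsHermitian) (v : n → ℝ) :
    v ⬝ᵥ A *ᵥ v = ∑ i, hA.eigenvalues i * ((hA.eigenvectorBasis i).ofLp ⬝ᵥ v) ^ 2 := by
  have h : A *ᵥ v = ∑ i, ((hA.eigenvectorBasis i).ofLp ⬝ᵥ v) •
      (hA.eigenvalues i • (hA.eigenvectorBasis i).ofLp) := by
    conv_lhs => rw [← sum_dotProduct_eigenvectorBasis hA v, mulVec_sum]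
    refine Finset.sum_congr rfl fun i _ => ?_
    rw [mulVec_smul, hA.mulVec_eigenvectorBasis]
  rw [h, dotProduct_sum]
  refine Finset.sum_congr rfl fun i _ => ?_
  rw [dotProduct_smul, dotProduct_smul, dotProduct_comm v, smul_eq_mul, smul_eq_mul]
  ring

/-- The second largest eigenvalue is at most `1` if and only if the quadratic form of `A - 1` is
nonpositive on some hyperplane. -/
theorem eigenvalues₀_one_le_one_iff (hA : A.IsHermitian) (hn : 1 < Fintype.card n) :
    hA.eigenvalues₀ ⟨1, hn⟩ ≤ 1 ↔
      ∃ l : n → ℝ, ∀ v : n → ℝ, l ⬝ᵥ v = 0 → v ⬝ᵥ A *ᵥ v ≤ v ⬝ᵥ v := by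
  set e : Fin (Fintype.card n) ≃ n := Fintype.equivOfCardEq (Fintype.card_fin _) with he
  have hev : ∀ i, hA.eigenvalues (e i) = hA.eigenvalues₀ i := by
    intro i
    simp [Matrix.IsHermitian.eigenvalues, he]
  set z : Fin (Fintype.card n) := ⟨0, by omega⟩ with hz
  set o : Fin (Fintype.card n) := ⟨1, hn⟩ with ho
  have hzo : z ≠ o := by simp [hz, ho]
  constructor
  · intro h
    -- On the orthogonal complement of the top eigenvector only the remaining eigenvalues
    -- contribute, and all of these are at most the second.
    refine ⟨(hA.eigenvectorBasis (e z)).ofLp, fun v hv => ?_⟩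
    rw [dotProduct_mulVec_eq_sum hA, dotProduct_self_eq_sum hA]
    refine Finset.sum_le_sum fun i _ => ?_
    obtain ⟨k, rfl⟩ := e.surjective i
    by_cases hk : k = z
    · subst hk
      rw [hv]
      simp
    · have h1 : hA.eigenvalues₀ k ≤ hA.eigenvalues₀ o := by
        apply hA.eigenvalues₀_antitone
        rw [Fin.le_def]
        have : k.val ≠ 0 := fun h0 => hk (Fin.ext h0)
        simp only [ho]
        omega
      rw [hev]
      nlinarith [sq_nonneg ((hA.eigenvectorBasis (e k)).ofLp ⬝ᵥ v)]
  · rintro ⟨l, hl⟩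
    by_contra! h
    have hz1 : 1 < hA.eigenvalues₀ z :=
      lt_of_lt_of_le h (hA.eigenvalues₀_antitone (by rw [Fin.le_def]; simp [hz]))
    -- If both top eigenvalues exceed 1, the form is positive definite on the plane of their
    -- eigenvectors, so that the kernel of `l` meets this plane only in zero.
    have key : ∀ a b : ℝ, l ⬝ᵥ (a • (hA.eigenvectorBasis (e z)).ofLp +
        b • (hA.eigenvectorBasis (e o)).ofLp) = 0 → a = 0 ∧ b = 0 := by
      intro a b hab
      have h1 := hl _ hab
      simp only [mulVec_add, mulVec_smul, hA.mulVec_eigenvectorBasis, hev, add_dotProduct,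
        dotProduct_add, smul_dotProduct, dotProduct_smul, eigenvectorBasis_dotProduct,
        EmbeddingLike.apply_eq_iff_eq, hzo, hzo.symm, if_true, if_false, smul_eq_mul] at h1
      have h2 : a ^ 2 * (hA.eigenvalues₀ z - 1) + b ^ 2 * (hA.eigenvalues₀ o - 1) ≤ 0 := by
        linarith
      have h3 : 0 ≤ a ^ 2 * (hA.eigenvalues₀ z - 1) := mul_nonneg (sq_nonneg _) (by linarith)
      have h4 : 0 ≤ b ^ 2 * (hA.eigenvalues₀ o - 1) := mul_nonneg (sq_nonneg _) (by linarith)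
      constructor
      · by_contra ha
        have : 0 < a ^ 2 * (hA.eigenvalues₀ z - 1) := mul_pos (by positivity) (by linarith)
        linarith
      · by_contra hb
        have : 0 < b ^ 2 * (hA.eigenvalues₀ o - 1) := mul_pos (by positivity) (by linarith)
        linarith
    -- A linear form on a plane has a nontrivial kernel: this combination lies in it, so by `key`
    -- its coefficients vanish. Then `l` is zero on both eigenvectors, and the first of them already
    -- contradicts `key`.
    have h1 := key (l ⬝ᵥ (hA.eigenvectorBasis (e o)).ofLp)
      (-(l ⬝ᵥ (hA.eigenvectorBasis (e z)).ofLp)) (by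
        simp only [dotProduct_add, dotProduct_smul, smul_eq_mul]; ring)
    have h2 := key 1 0 (by
      simp only [dotProduct_add, dotProduct_smul, smul_eq_mul]
      linarith [h1.2])
    exact one_ne_zero h2.1

end Spectral

/-! ### Heredity and refutation of the spectral condition -/

section Graph

variable {V W : Type*} [Fintype V] [Fintype W]

/-- The quadratic form of `A - 1`, where `A` is the adjacency matrix, is nonpositive on some
hyperplane. -/
def HasSmallLambda2 (G : SimpleGraph V) [DecidableRel G.Adj] : Prop :=
  ∃ l : V → ℝ, ∀ v : V → ℝ, l ⬝ᵥ v = 0 → v ⬝ᵥ G.adjMatrix ℝ *ᵥ v ≤ v ⬝ᵥ v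

theorem lambda2_le_one_iff [DecidableEq V] (G : SimpleGraph V) [DecidableRel G.Adj]
    (hV : 1 < Fintype.card V) :
    lambda2 G hV ≤ 1 ↔ HasSmallLambda2 G :=
  eigenvalues₀_one_le_one_iff _ hV

lemma sum_extend_zero (f : W ↪ V) (w : W → ℝ) (g : V → ℝ) :
    ∑ x, g x * Function.extend f w 0 x = ∑ i, g (f i) * w i := by
  classical
  rw [← Finset.sum_subset (Finset.subset_univ (Finset.univ.map f))]
  · rw [Finset.sum_map]
    exact Finset.sum_congr rfl fun i _ => by rw [f.injective.extend_apply]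
  · intro x _ hx
    rw [Function.extend_apply', Pi.zero_apply, mul_zero]
    rintro ⟨i, rfl⟩
    exact hx (by simp)

lemma dotProduct_adjMatrix_extend (G : SimpleGraph V) [DecidableRel G.Adj] (H : SimpleGraph W)
    [DecidableRel H.Adj] (f : H ↪g G) (v w : W → ℝ) :
    Function.extend f v 0 ⬝ᵥ G.adjMatrix ℝ *ᵥ Function.extend f w 0 =
      v ⬝ᵥ H.adjMatrix ℝ *ᵥ w := by
  have h1 : ∀ x : V, (G.adjMatrix ℝ *ᵥ Function.extend f w 0) x =
      ∑ j, G.adjMatrix ℝ x (f j) * w j := fun x =>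
    sum_extend_zero f.toEmbedding w (fun y => G.adjMatrix ℝ x y)
  rw [dotProduct_comm]
  simp only [dotProduct]
  rw [show (∑ i, (G.adjMatrix ℝ *ᵥ Function.extend f w 0) i * Function.extend f v 0 i) = _ from
    sum_extend_zero f.toEmbedding v _]
  refine Finset.sum_congr rfl fun i _ => ?_
  rw [mul_comm, h1]
  congr 1
  refine Finset.sum_congr rfl fun j _ => ?_
  simp [SimpleGraph.adjMatrix_apply]

lemma dotProduct_extend (f : W ↪ V) (v w : W → ℝ) :
    Function.extend f v 0 ⬝ᵥ Function.extend f w 0 = v ⬝ᵥ w := by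
  rw [show Function.extend f v 0 ⬝ᵥ Function.extend f w 0 = _ from
    sum_extend_zero f w (Function.extend f v 0)]
  exact Finset.sum_congr rfl fun i _ => by rw [f.injective.extend_apply]

/-- Extension by zero preserves both forms when the subgraph is induced, and it carries the kernel
of the restricted linear form into the kernel of `l`. This takes the place of eigenvalue
interlacing. -/
theorem HasSmallLambda2.of_embedding {G : SimpleGraph V} [DecidableRel G.Adj] {H : SimpleGraph W}
    [DecidableRel H.Adj] (hG : HasSmallLambda2 G) (f : H ↪g G) : HasSmallLambda2 H := by
  obtain ⟨l, hl⟩ := hG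
  refine ⟨fun i => l (f i), fun v hv => ?_⟩
  have := hl (Function.extend f v 0) ((sum_extend_zero f.toEmbedding v l).trans hv)
  rwa [dotProduct_adjMatrix_extend, show Function.extend f v 0 ⬝ᵥ Function.extend f v 0 = _ from
    dotProduct_extend f.toEmbedding v v] at this

/-- Two vectors spanning a plane on which the form of `A - 1` is positive definite witness that
the second largest eigenvalue exceeds `1`. -/
theorem not_hasSmallLambda2 (G : SimpleGraph V) [DecidableRel G.Adj] (p q : V → ℝ)
    (hp : p ⬝ᵥ p < p ⬝ᵥ G.adjMatrix ℝ *ᵥ p)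
    (hpq : (p ⬝ᵥ G.adjMatrix ℝ *ᵥ q - p ⬝ᵥ q) ^ 2 <
      (p ⬝ᵥ G.adjMatrix ℝ *ᵥ p - p ⬝ᵥ p) * (q ⬝ᵥ G.adjMatrix ℝ *ᵥ q - q ⬝ᵥ q)) :
    ¬ HasSmallLambda2 G := by
  rintro ⟨l, hl⟩
  have hsym : q ⬝ᵥ G.adjMatrix ℝ *ᵥ p = p ⬝ᵥ G.adjMatrix ℝ *ᵥ q := by
    rw [dotProduct_mulVec, ← mulVec_transpose, SimpleGraph.transpose_adjMatrix, dotProduct_comm]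
  -- This is the vector of the plane on which `l` vanishes by construction.
  have h := hl ((l ⬝ᵥ q) • p - (l ⬝ᵥ p) • q) (by
    simp only [dotProduct_sub, dotProduct_smul, smul_eq_mul]; ring)
  simp only [mulVec_sub, mulVec_smul, sub_dotProduct, dotProduct_sub, smul_dotProduct,
    dotProduct_smul, smul_eq_mul, hsym, dotProduct_comm q p] at h
  set P := p ⬝ᵥ G.adjMatrix ℝ *ᵥ p - p ⬝ᵥ p with hP
  set Q := q ⬝ᵥ G.adjMatrix ℝ *ᵥ q - q ⬝ᵥ q with hQ
  set R := p ⬝ᵥ G.adjMatrix ℝ *ᵥ q - p ⬝ᵥ q with hR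
  set a := l ⬝ᵥ q
  set b := l ⬝ᵥ p
  have h1 : a ^ 2 * P - 2 * a * b * R + b ^ 2 * Q ≤ 0 := by
    rw [hP, hQ, hR]; linarith
  have hPpos : 0 < P := by rw [hP]; linarith
  -- Completing the square after multiplication by `P`. The discriminant condition then forces `b =
  -- 0`, so `p` itself lies in the kernel of `l` and contradicts `hp`.
  have h2 : (a * P - b * R) ^ 2 + b ^ 2 * (P * Q - R ^ 2) ≤ 0 := by
    have : (a * P - b * R) ^ 2 + b ^ 2 * (P * Q - R ^ 2) =
      P * (a ^ 2 * P - 2 * a * b * R + b ^ 2 * Q) := by ring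
    rw [this]
    exact mul_nonpos_of_nonneg_of_nonpos hPpos.le h1
  have hb : b = 0 := by
    by_contra hb
    have : 0 < b ^ 2 * (P * Q - R ^ 2) := mul_pos (by positivity) (by linarith)
    nlinarith [sq_nonneg (a * P - b * R)]
  have := hl p hb
  linarith

end Graph

/-! ### Induced copies of graphs given by bit masks -/

/-- Adjacency of `i` and `j` in the graph on the natural numbers whose rows are bit masks. -/
def rowAdj (r : List ℕ) (i j : ℕ) : Bool := (r.getD i 0).testBit j

/-- The first `n` values of `f` induce a copy of the graph on `{0, …, n - 1}` with adjacency
`adj`. -/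
structure IsCopy {V : Type*} (G : SimpleGraph V) (n : ℕ) (adj : ℕ → ℕ → Bool) (f : ℕ → V) :
    Prop where
  inj : ∀ i < n, ∀ j < n, f i = f j → i = j
  adj_iff : ∀ i < n, ∀ j < n, (G.Adj (f i) (f j) ↔ adj i j = true)

namespace IsCopy

variable {V : Type*} {G : SimpleGraph V} {n : ℕ} {adj : ℕ → ℕ → Bool} {f : ℕ → V}

theorem comp {m : ℕ} {adj' : ℕ → ℕ → Bool} {t : ℕ → ℕ} (hf : IsCopy G n adj f)
    (hlt : ∀ i < m, t i < n) (hinj : ∀ i < m, ∀ j < m, t i = t j → i = j)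
    (hadj : ∀ i < m, ∀ j < m, adj' i j = adj (t i) (t j)) : IsCopy G m adj' (f ∘ t) where
  inj i hi j hj h := hinj i hi j hj (hf.inj _ (hlt i hi) _ (hlt j hj) h)
  adj_iff i hi j hj := by
    rw [hadj i hi j hj]
    exact hf.adj_iff _ (hlt i hi) _ (hlt j hj)

/-- Symmetry and irreflexivity cut the verification of an explicit copy down to pairs with `i < j`.
-/
theorem of_lt (hsymm : ∀ i < n, ∀ j < n, adj i j = adj j i) (hirr : ∀ i < n, adj i i = false)
    (h : ∀ j < n, ∀ i < j, f i ≠ f j ∧ (G.Adj (f i) (f j) ↔ adj i j = true)) :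
    IsCopy G n adj f where
  inj i hi j hj hij := by
    rcases lt_trichotomy i j with hlt | rfl | hlt
    · exact absurd hij (h j hj i hlt).1
    · rfl
    · exact absurd hij.symm (h i hi j hlt).1
  adj_iff i hi j hj := by
    rcases lt_trichotomy i j with hlt | rfl | hlt
    · exact (h j hj i hlt).2
    · simp [hirr i hi]
    · rw [hsymm i hi j hj, G.adj_comm]
      exact (h i hi j hlt).2

theorem injective (hf : IsCopy G n adj f) : Function.Injective fun i : Fin n => f i :=
  fun i j h => Fin.ext (hf.inj i i.2 j j.2 h)

/-- The copy as an embedding of an induced subgraph. -/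
def embedding (hf : IsCopy G n adj f) : (G.comap fun i : Fin n => f i) ↪g G :=
  SimpleGraph.Embedding.comap ⟨_, hf.injective⟩ G

/-- With integer vectors the positive definiteness of `A - 1` on a plane is a decidable statement
about the masks alone. It is transferred to the induced subgraph and from there to `G` by heredity.
-/
theorem not_hasSmallLambda2 [Fintype V] [DecidableRel G.Adj] (hf : IsCopy G n adj f)
    (p q : Fin n → ℤ)
    (h : let b : (Fin n → ℤ) → (Fin n → ℤ) → ℤ := fun x y =>
        ∑ i : Fin n, ∑ j : Fin n, x i * ((if adj i j then 1 else 0) - if i = j then 1 else 0) * y j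
      0 < b p p ∧ b p q ^ 2 < b p p * b q q) :
    ¬ HasSmallLambda2 G := by
  intro hG
  set H := G.comap fun i : Fin n => f i with hH
  have hb : ∀ x y : Fin n → ℤ, ((∑ i : Fin n, ∑ j : Fin n, x i * ((if adj i j then 1 else 0) -
      if i = j then 1 else 0) * y j : ℤ) : ℝ) =
      (fun i => (x i : ℝ)) ⬝ᵥ H.adjMatrix ℝ *ᵥ (fun i => (y i : ℝ)) -
        (fun i => (x i : ℝ)) ⬝ᵥ (fun i => (y i : ℝ)) := by
    intro x y
    have hA : ∀ i j, H.adjMatrix ℝ i j = if adj i j then 1 else 0 := by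
      intro i j
      rw [SimpleGraph.adjMatrix_apply]
      congr 1
      rw [hH, SimpleGraph.comap_adj]
      exact propext (hf.adj_iff i i.2 j j.2)
    simp only [dotProduct, mulVec, hA, ← Finset.sum_sub_distrib]
    push_cast
    refine Finset.sum_congr rfl fun i _ => ?_
    simp only [mul_sub, sub_mul, Finset.sum_sub_distrib, Finset.mul_sum, mul_assoc]
    congr 1
    simp
  obtain ⟨h1, h2⟩ := h
  refine TriangleFreePlanar.not_hasSmallLambda2 H (fun i => (p i : ℝ)) (fun i => (q i : ℝ)) ?_ ?_
    (hG.of_embedding hf.embedding)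
  · have : (0 : ℝ) < ((_ : ℤ) : ℝ) := Int.cast_pos.2 h1
    rw [hb] at this
    linarith
  · rw [← hb, ← hb, ← hb]
    exact_mod_cast h2

/-- Each entry of the list but the last is adjacent to a later one. -/
def IsTreeList (adj : ℕ → ℕ → Bool) : List ℕ → Bool
  | [] => false
  | [_] => true
  | a :: b :: l => (b :: l).any (adj a) && IsTreeList adj (b :: l)

/-- The tail of the list spans a connected set by induction, and the head is joined to it by an
edge. Thus the order of the list is itself a certificate of connectedness. -/
theorem connected_of_isTreeList (hf : IsCopy G n adj f) :
    ∀ l : List ℕ, (∀ a ∈ l, a < n) → IsTreeList adj l = true →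
      (G.induce (f '' {a | a ∈ l})).Connected
  | [], _, h => by simp [IsTreeList] at h
  | [a], _, _ => by
    have : f '' {x | x ∈ [a]} = {f a} := by simp
    rw [this]
    have : Nonempty ({f a} : Set V) := ⟨⟨f a, rfl⟩⟩
    exact ⟨SimpleGraph.Preconnected.of_subsingleton⟩
  | a :: b :: l, hl, h => by
    simp only [IsTreeList, Bool.and_eq_true, List.any_eq_true] at h
    obtain ⟨⟨x, hx, hax⟩, h2⟩ := h
    have ih := connected_of_isTreeList hf (b :: l) (fun y hy => hl y (List.mem_cons_of_mem _ hy)) h2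
    have hadj : G.Adj (f a) (f x) :=
      (hf.adj_iff a (hl a (by simp)) x (hl x (List.mem_cons_of_mem _ hx))).2 hax
    have h3 := SimpleGraph.induce_union_connected
      (SimpleGraph.induce_pair_connected_of_adj hadj).preconnected ih.preconnected
      ⟨f x, by simp, ⟨x, hx, rfl⟩⟩
    have hs : f '' {x | x ∈ a :: b :: l} = {f a, f x} ∪ f '' {x | x ∈ b :: l} := by
      ext y
      constructor
      · rintro ⟨z, hz, rfl⟩
        rcases List.mem_cons.1 hz with rfl | hz
        · exact Or.inl (Or.inl rfl)
        · exact Or.inr ⟨z, hz, rfl⟩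
      · rintro ((rfl | rfl) | ⟨z, hz, rfl⟩)
        · exact ⟨a, by simp, rfl⟩
        · exact ⟨x, List.mem_cons_of_mem _ hx, rfl⟩
        · exact ⟨z, List.mem_cons_of_mem _ hz, rfl⟩
    rw [hs]
    exact h3

/-- The lists serve as branch sets. All conditions on them concern the masks only, so that for
concrete data they are decidable. -/
theorem isMinor {W : Type*} {H : SimpleGraph W} (hf : IsCopy G n adj f) (B : W → List ℕ)
    (h : (∀ x, (∀ a ∈ B x, a < n) ∧ IsTreeList adj (B x) = true) ∧
      (∀ x y, x ≠ y → ∀ a ∈ B x, a ∉ B y) ∧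
      (∀ x y, H.Adj x y → ∃ a ∈ B x, ∃ b ∈ B y, adj a b = true)) : IsMinor H G := by
  obtain ⟨h1, h2, h3⟩ := h
  refine ⟨fun x => f '' {a | a ∈ B x}, fun x => hf.connected_of_isTreeList _ (h1 x).1 (h1 x).2,
    fun x y hxy => ?_, fun x y hxy => ?_⟩
  · rw [Set.disjoint_left]
    rintro _ ⟨a, ha, rfl⟩ ⟨b, hb, hab⟩
    have := hf.inj b ((h1 y).1 b hb) a ((h1 x).1 a ha) hab
    subst this
    exact h2 x y hxy b ha hb
  · obtain ⟨a, ha, b, hb, hab⟩ := h3 x y hxy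
    exact ⟨f a, ⟨a, ha, rfl⟩, f b, ⟨b, hb, rfl⟩,
      (hf.adj_iff a ((h1 x).1 a ha) b ((h1 y).1 b hb)).2 hab⟩

/-- A copy with as many vertices as `G` numbers all of `V`; following the inverse numbering by the
copy in `T` gives the embedding. -/
theorem isIndContained [Fintype V] {W : Type*} {T : SimpleGraph W} {t : ℕ → W}
    (hf : IsCopy G n adj f) (ht : IsCopy T n adj t) (hcard : Fintype.card V = n) :
    G.IsIndContained T := by
  have hbij : Function.Bijective fun i : Fin n => f i :=
    (Fintype.bijective_iff_injective_and_card _).2 ⟨hf.injective, by simp [hcard]⟩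
  let e := Equiv.ofBijective _ hbij
  have he : ∀ x, f (e.symm x) = x := fun x => e.apply_symm_apply x
  refine ⟨⟨⟨fun x => t (e.symm x), fun x y hxy => e.symm.injective (ht.injective hxy)⟩, ?_⟩⟩
  intro x y
  have h1 := ht.adj_iff _ (e.symm x).2 _ (e.symm y).2
  have h2 := hf.adj_iff _ (e.symm x).2 _ (e.symm y).2
  rw [he, he] at h2
  exact h1.trans h2.symm

end IsCopy

/-! ### One-vertex extensions and their certificates -/

/-- The `i`-th hexadecimal digit of `c`. -/
def hexDigit (c i : ℕ) : ℕ := (c >>> (4 * i)) &&& 15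

/-- The digits of `c` map the graph `adj'` on `{0, …, m - 1}` isomorphically to an induced subgraph
of the graph `adj` on `{0, …, n - 1}`. -/
def digitsEmbed (m : ℕ) (adj' : ℕ → ℕ → Bool) (n : ℕ) (adj : ℕ → ℕ → Bool) (c : ℕ) : Bool :=
  (List.range m).all fun i => Nat.blt (hexDigit c i) n &&
    (List.range m).all fun j => (!Nat.beq (hexDigit c i) (hexDigit c j) || Nat.beq i j) &&
      (adj' i j == adj (hexDigit c i) (hexDigit c j))

lemma digitsEmbed_eq_true {m n c : ℕ} {adj' adj : ℕ → ℕ → Bool}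
    (h : digitsEmbed m adj' n adj c = true) :
    (∀ i < m, hexDigit c i < n) ∧
    (∀ i < m, ∀ j < m, hexDigit c i = hexDigit c j → i = j) ∧
    (∀ i < m, ∀ j < m, adj' i j = adj (hexDigit c i) (hexDigit c j)) := by
  simp only [digitsEmbed, List.all_eq_true, List.mem_range, Bool.and_eq_true, Bool.or_eq_true,
    Bool.not_eq_true', beq_iff_eq, Nat.blt_eq, Nat.beq_eq] at h
  refine ⟨fun i hi => (h i hi).1, fun i hi j hj hij => ?_, fun i hi j hj => ((h i hi).2 j hj).2⟩
  rcases ((h i hi).2 j hj).1 with h1 | h1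
  · rw [hij] at h1
    simp at h1
  · exact h1

/-- The graph with rows `r` on `{0, …, n - 1}` together with a vertex `n` whose neighbours are the
bits of `S`. -/
def extAdj (r : List ℕ) (n S i j : ℕ) : Bool :=
  bif Nat.beq i n then !Nat.beq j n && S.testBit j
  else bif Nat.beq j n then S.testBit i else rowAdj r i j

/-- The set of the digits of `c` at the places `i < m` with `p i`, as a bit mask. -/
def digitMask (m c : ℕ) (p : ℕ → Bool) : ℕ :=
  (List.range m).foldl (fun S i => bif p i then S ||| 1 <<< hexDigit c i else S) 0

/-- The possible neighbours of the new vertex that matter for `obstructs`. -/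
def relevantMask (o : List ℕ) (k c : ℕ) : ℕ := digitMask o.length c fun i => !Nat.beq i k

/-- The neighbours of the new vertex that are prescribed for `obstructs`. -/
def neighbourMask (o : List ℕ) (k c : ℕ) : ℕ := digitMask o.length c fun i => rowAdj o i k

/-- The extensions by a vertex `n` with the prescribed neighbours contain the obstruction `o`,
placed by the digits of `c` so that its vertex `k` is the new vertex. -/
def obstructs (r : List ℕ) (n : ℕ) (o : List ℕ) (k c : ℕ) : Bool :=
  Nat.beq (hexDigit c k) n && (List.range o.length).all fun i => Nat.beq i k ||
    (((relevantMask o k c).testBit (hexDigit c i) &&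
        ((neighbourMask o k c).testBit (hexDigit c i) == rowAdj o i k)) &&
      (Nat.blt (hexDigit c i) n && (List.range o.length).all fun j => Nat.beq j k ||
      ((!Nat.beq (hexDigit c i) (hexDigit c j) || Nat.beq i j) &&
        (rowAdj o i j == rowAdj r (hexDigit c i) (hexDigit c j)))))

/-- The new vertex has the prescribed neighbours. -/
def obstructsNew (o : List ℕ) (k c S : ℕ) : Bool :=
  Nat.beq (S &&& relevantMask o k c) (neighbourMask o k c)

/-- The rows describe a symmetric irreflexive relation. -/
def rowsValid (o : List ℕ) : Bool :=
  (List.range o.length).all fun i => !rowAdj o i i &&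
    (List.range o.length).all fun j => rowAdj o i j == rowAdj o j i

lemma rowsValid_eq_true {o : List ℕ} (h : rowsValid o = true) :
    (∀ i < o.length, rowAdj o i i = false) ∧
    ∀ i < o.length, ∀ j < o.length, rowAdj o i j = rowAdj o j i := by
  simp only [rowsValid, List.all_eq_true, List.mem_range, Bool.and_eq_true, Bool.not_eq_true',
    beq_iff_eq] at h
  exact ⟨fun i hi => (h i hi).1, fun i hi j hj => (h i hi).2 j hj⟩

/-- The test for an obstruction is split: `obstructs` does not depend on the new neighbourhood `S`
and is evaluated once for each certificate, while `obstructsNew` is one comparison of masks for each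
`S`. Together they say that `o` embeds in the extension. -/
lemma digitsEmbed_of_obstructs {r o : List ℕ} {n k c S : ℕ} (ho : rowsValid o = true)
    (h1 : obstructs r n o k c = true) (h2 : obstructsNew o k c S = true) :
    digitsEmbed o.length (rowAdj o) (n + 1) (extAdj r n S) c = true := by
  obtain ⟨hirr, hsymm⟩ := rowsValid_eq_true ho
  simp only [obstructs, List.all_eq_true, List.mem_range, Bool.and_eq_true, Bool.or_eq_true,
    Bool.not_eq_true', beq_iff_eq, Nat.blt_eq, Nat.beq_eq] at h1
  obtain ⟨hk, h1⟩ := h1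
  -- `obstructs` tests the bits of both masks at every place that is used here, so nothing has to be
  -- known about how `digitMask` computes them.
  replace h2 : ∀ i < o.length, i = k ∨ rowAdj o i k = S.testBit (hexDigit c i) := by
    intro i hi
    refine (h1 i hi).imp_right fun h => ?_
    rw [obstructsNew, Nat.beq_eq] at h2
    rw [← h.1.2, ← h2, Nat.testBit_and, h.1.1, Bool.and_true]
  replace h1 := fun i hi => (h1 i hi).imp_right And.right
  simp only [digitsEmbed, List.all_eq_true, List.mem_range, Bool.and_eq_true, Bool.or_eq_true,
    Bool.not_eq_true', beq_iff_eq, Nat.blt_eq, Nat.beq_eq]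
  intro i hi
  have hlt : ∀ i < o.length, i ≠ k → hexDigit c i < n := fun i hi hik =>
    ((h1 i hi).resolve_left hik).1
  have hbeq : ∀ a b : ℕ, a ≠ b → Nat.beq a b = false := fun a b hab => by
    rw [Bool.eq_false_iff, ne_eq, Nat.beq_eq]; exact hab
  refine ⟨?_, fun j hj => ?_⟩
  · by_cases hik : i = k
    · rw [hik, hk]; omega
    · exact Nat.lt_succ_of_lt (hlt i hi hik)
  · by_cases hik : i = k
    · subst hik
      by_cases hji : j = i
      · subst hji
        simp [extAdj, hirr j hi, hk]
      · have h3 := hlt j hj hji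
        have h4 := (h2 j hj).resolve_left hji
        refine ⟨Or.inl (hbeq _ _ (by omega)), ?_⟩
        rw [hsymm i hi j hj, h4]
        simp [extAdj, hk, hbeq _ _ h3.ne]
    · have h3 := hlt i hi hik
      by_cases hjk : j = k
      · subst hjk
        have h4 := (h2 i hi).resolve_left hik
        refine ⟨Or.inl (hbeq _ _ (by omega)), ?_⟩
        rw [h4]
        simp [extAdj, hk, hbeq _ _ h3.ne]
      · have h4 := hlt j hj hjk
        have h5 := (((h1 i hi).resolve_left hik).2 j hj).resolve_left hjk
        refine ⟨h5.1, ?_⟩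
        rw [h5.2]
        simp [extAdj, hbeq _ _ h3.ne, hbeq _ _ h4.ne]

/-- `leaf` holds for every set of bits that is independent in the graph with rows `r` and extends
`S` by elements of `{i, …, i + k - 1}`. -/
def forallIndep (r : List ℕ) (leaf : ℕ → Bool) : ℕ → ℕ → ℕ → Bool
  | 0, _, S => leaf S
  | k + 1, i, S => forallIndep r leaf k (i + 1) S &&
      ((!Nat.beq (r.getD i 0 &&& S) 0) || forallIndep r leaf k (i + 1) (S ||| 1 <<< i))

/-- Follow the branch of the search tree that takes or omits each `i` according to `s`. It ends in
the leaf whose mask is `s` restricted to the range searched. -/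
lemma exists_leaf_of_forallIndep {r : List ℕ} {leaf : ℕ → Bool} {s : ℕ → Prop}
    (hs : ∀ i j, s i → s j → rowAdj r i j = false) :
    ∀ k i S, forallIndep r leaf k i S = true → (∀ j, S.testBit j = true ↔ j < i ∧ s j) →
      ∃ S', leaf S' = true ∧ ∀ j, S'.testBit j = true ↔ j < i + k ∧ s j := by
  intro k
  induction k with
  | zero => exact fun i S h hS => ⟨S, h, by simpa using hS⟩
  | succ k ih =>
    intro i S h hS
    simp only [forallIndep, Bool.and_eq_true, Bool.or_eq_true, Bool.not_eq_true'] at h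
    by_cases hi : s i
    · have h2 : forallIndep r leaf k (i + 1) (S ||| 1 <<< i) = true := by
        refine h.2.resolve_left fun h0 => ?_
        have h0' : r.getD i 0 &&& S ≠ 0 := by
          intro h1
          rw [h1] at h0
          simp at h0
        obtain ⟨j, hj⟩ := Nat.exists_testBit_of_ne_zero h0'
        rw [Nat.testBit_and, Bool.and_eq_true] at hj
        have h3 := hs i j hi ((hS j).1 hj.2).2
        rw [rowAdj, hj.1] at h3
        exact Bool.noConfusion h3
      obtain ⟨S', h3, h4⟩ := ih (i + 1) _ h2 (fun j => by
        rw [Nat.testBit_or, Bool.or_eq_true, hS, Nat.one_shiftLeft, Nat.testBit_two_pow,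
          decide_eq_true_eq]
        constructor
        · rintro (⟨h5, h6⟩ | rfl)
          · exact ⟨by omega, h6⟩
          · exact ⟨by omega, hi⟩
        · rintro ⟨h5, h6⟩
          rcases Nat.lt_succ_iff_lt_or_eq.1 h5 with h7 | h7
          · exact Or.inl ⟨h7, h6⟩
          · exact Or.inr h7.symm)
      exact ⟨S', h3, fun j => by rw [h4 j, add_right_comm, add_assoc]⟩
    · obtain ⟨S', h3, h4⟩ := ih (i + 1) S h.1 (fun j => by
        rw [hS]
        constructor
        · rintro ⟨h5, h6⟩
          exact ⟨by omega, h6⟩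
        · rintro ⟨h5, h6⟩
          refine ⟨?_, h6⟩
          rcases Nat.lt_succ_iff_lt_or_eq.1 h5 with h7 | h7
          · exact h7
          · exact absurd (h7 ▸ h6) hi)
      exact ⟨S', h3, fun j => by rw [h4 j, add_right_comm, add_assoc]⟩

/-- A graph on `{0, …, n - 1}` with certificates. The digits of `place` embed it in the graph
number `target` of a list. A member `(o, k, c)` of `bad` places the obstruction number `o` in
one-vertex extensions, with its vertex `k` the new one. A member `(S, t, c)` of `good` states that
the extension with neighbours `S` is the graph number `t` of the next list. -/
structure Entry where
  rows : List ℕ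
  target : ℕ
  place : ℕ
  bad : List (ℕ × ℕ × ℕ)
  good : List (ℕ × ℕ × ℕ)

/-- The certificates of an entry on `n` vertices are correct and complete. -/
def Entry.check (obs targets : List (List ℕ)) (n : ℕ) (next : List Entry) (e : Entry) : Bool :=
  (digitsEmbed n (rowAdj e.rows) (targets.getD e.target []).length
    (rowAdj (targets.getD e.target [])) e.place &&
  e.bad.all fun b => Nat.blt b.1 obs.length &&
    obstructs e.rows n (obs.getD b.1 []) b.2.1 b.2.2) &&
  forallIndep e.rows (fun S => Nat.beq S 0 ||
    (e.bad.any fun b => obstructsNew (obs.getD b.1 []) b.2.1 b.2.2 S) ||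
    (e.good.any fun b => Nat.beq b.1 S && (Nat.blt b.2.1 next.length &&
      digitsEmbed (n + 1) (rowAdj ((next.map Entry.rows).getD b.2.1 [])) (n + 1)
        (extAdj e.rows n S) b.2.2))) n 0 0

/-! ### Soundness of the exhaustive generation -/

section Soundness

variable {V : Type*} {G : SimpleGraph V}

lemma IsCopy.update {r : List ℕ} {n S : ℕ} {f : ℕ → V} {x : V}
    (hf : IsCopy G n (rowAdj r) f) (hx : ∀ i < n, f i ≠ x)
    (hS : ∀ j, S.testBit j = true ↔ j < n ∧ G.Adj x (f j)) :
    IsCopy G (n + 1) (extAdj r n S) (Function.update f n x) := by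
  have hlt : ∀ i < n, Function.update f n x i = f i := fun i hi =>
    Function.update_of_ne hi.ne _ _
  have hbeq : ∀ a < n, Nat.beq a n = false := fun a ha => by
    rw [Bool.eq_false_iff, ne_eq, Nat.beq_eq]; omega
  have hnn : Nat.beq n n = true := by simp
  constructor
  · intro i hi j hj hij
    rcases Nat.lt_succ_iff_lt_or_eq.1 hi with h1 | rfl <;>
      rcases Nat.lt_succ_iff_lt_or_eq.1 hj with h2 | rfl
    · rw [hlt i h1, hlt j h2] at hij
      exact hf.inj i h1 j h2 hij
    · rw [hlt i h1, Function.update_self] at hij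
      exact absurd hij (hx i h1)
    · rw [hlt j h2, Function.update_self] at hij
      exact absurd hij.symm (hx j h2)
    · rfl
  · intro i hi j hj
    rcases Nat.lt_succ_iff_lt_or_eq.1 hi with h1 | rfl <;>
      rcases Nat.lt_succ_iff_lt_or_eq.1 hj with h2 | rfl
    · rw [hlt i h1, hlt j h2, hf.adj_iff i h1 j h2]
      simp [extAdj, hbeq i h1, hbeq j h2]
    · rw [hlt i h1, Function.update_self, G.adj_comm]
      simp [extAdj, hbeq i h1, hS, h1]
    · rw [hlt j h2, Function.update_self]
      simp [extAdj, hbeq j h2, hS, h2]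
    · simp [extAdj]

/-- The graph has as many vertices as, and a copy of, a graph that embeds in one of the targets. -/
def IsListed [Fintype V] (targets : List (List ℕ)) (G : SimpleGraph V) : Prop :=
  ∃ r n t c, Fintype.card V = n ∧ (∃ f, IsCopy G n (rowAdj r) f) ∧
    digitsEmbed n (rowAdj r) (targets.getD t []).length (rowAdj (targets.getD t [])) c = true

/-- The index `t` is fixed before the graph `T`, so that one can first branch on `t` and then supply
the copy of the corresponding target. -/
theorem IsListed.isIndContained [Fintype V] {targets : List (List ℕ)} {G : SimpleGraph V}
    (h : IsListed targets G) : ∃ t, ∀ {W : Type} {T : SimpleGraph W} {g : ℕ → W},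
      IsCopy T (targets.getD t []).length (rowAdj (targets.getD t [])) g → G.IsIndContained T := by
  obtain ⟨r, n, t, c, hn, ⟨f, hf⟩, hc⟩ := h
  obtain ⟨h1, h2, h3⟩ := digitsEmbed_eq_true hc
  exact ⟨t, fun hg => hf.isIndContained (hg.comp h1 h2 h3) hn⟩

/-- The graph contains a graph of the list as an induced subgraph. -/
def ContainsEntry (G : SimpleGraph V) (n : ℕ) (L : List Entry) : Prop :=
  ∃ e ∈ L, ∃ f, IsCopy G n (rowAdj e.rows) f

/-- A walk from the copy to a vertex outside it has an edge that leaves the copy. -/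
theorem exists_adj_notMem (hconn : G.Connected) {n : ℕ} (hn : 0 < n) {f : ℕ → V}
    (hf : ∃ y, ∀ i < n, f i ≠ y) : ∃ x, (∀ i < n, f i ≠ x) ∧ ∃ i < n, G.Adj x (f i) := by
  obtain ⟨y, hy⟩ := hf
  obtain ⟨p⟩ := hconn.preconnected (f 0) y
  obtain ⟨d, -, hd1, hd2⟩ := p.exists_boundary_dart {x | ∃ i < n, f i = x} ⟨0, hn, rfl⟩
    (by rintro ⟨i, hi, h⟩; exact hy i hi h)
  obtain ⟨i, hi, h⟩ := hd1
  refine ⟨d.snd, fun j hj h' => hd2 ⟨j, hj, h'⟩, i, hi, ?_⟩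
  rw [h]
  exact d.adj.symm

/-- One growth step. If the copy exhausts `G`, the placement stored in the entry shows that `G` is
listed. Otherwise a new vertex adjacent to the copy yields an extension that the check has covered.
-/
theorem ContainsEntry.succ [Fintype V] {obs targets : List (List ℕ)} {n : ℕ} {L next : List Entry}
    (hconn : G.Connected) (htri : G.CliqueFree 3) (hvalid : obs.all rowsValid = true)
    (hobs : ∀ o ∈ obs, ∀ f, ¬ IsCopy G o.length (rowAdj o) f) (hn : 0 < n)
    (hL : (L.all (Entry.check obs targets n next)) = true) (h : ContainsEntry G n L) :
    IsListed targets G ∨ ContainsEntry G (n + 1) next := by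
  obtain ⟨e, he, f, hf⟩ := h
  have hcheck := List.all_eq_true.1 hL e he
  rw [Entry.check, Bool.and_eq_true, Bool.and_eq_true, List.all_eq_true] at hcheck
  obtain ⟨⟨htarget, hbad⟩, hall⟩ := hcheck
  by_cases hcard : ∃ y, ∀ i < n, f i ≠ y
  swap
  · left
    push Not at hcard
    refine ⟨e.rows, n, e.target, e.place, ?_, ⟨f, hf⟩, htarget⟩
    have hbij : Function.Bijective fun i : Fin n => f i :=
      ⟨hf.injective, fun y => by
        obtain ⟨i, hi, h⟩ := hcard y
        exact ⟨⟨i, hi⟩, h⟩⟩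
    rw [← Fintype.card_of_bijective hbij, Fintype.card_fin]
  right
  obtain ⟨x, hx, i₀, hi₀, hxi₀⟩ := exists_adj_notMem hconn hn hcard
  -- The neighbours of `x` in the copy are independent because `G` has no triangle; hence the search
  -- over independent masks has met them.
  obtain ⟨S, hleaf, hS⟩ := exists_leaf_of_forallIndep (s := fun i => i < n ∧ G.Adj x (f i))
    (fun i j hi hj => by
      rw [Bool.eq_false_iff]
      intro hij
      have h1 := (hf.adj_iff i hi.1 j hj.1).2 hij
      classical
      exact htri {x, f i, f j} (SimpleGraph.is3Clique_triple_iff.2 ⟨hi.2, hj.2, h1⟩))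
    n 0 0 hall (by simp)
  have hS' : ∀ j, S.testBit j = true ↔ j < n ∧ G.Adj x (f j) := fun j => by
    rw [hS j]
    constructor
    · exact fun h => h.2
    · exact fun h => ⟨by omega, h⟩
  have hcopy := hf.update hx hS'
  simp only [Bool.or_eq_true, Nat.beq_eq, List.any_eq_true, Bool.and_eq_true, Nat.blt_eq] at hleaf
  -- The empty mask is impossible since `x` has a neighbour in the copy, an obstruction would be
  -- induced in `G`, and what remains is an isomorphism with a graph of the next list.
  rcases hleaf with (h0 | ⟨b, hb, hb2⟩) | ⟨b, hb, rfl, hlt, hb2⟩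
  · have := (hS' i₀).2 ⟨hi₀, hxi₀⟩
    rw [h0] at this
    simp at this
  · exfalso
    have hb1 := hbad b hb
    rw [Bool.and_eq_true, Nat.blt_eq] at hb1
    have hmem : obs.getD b.1 [] ∈ obs := by
      rw [List.getD_eq_getElem _ _ hb1.1]
      exact List.getElem_mem hb1.1
    obtain ⟨h1, h2, h3⟩ := digitsEmbed_eq_true
      (digitsEmbed_of_obstructs (List.all_eq_true.1 hvalid _ hmem) hb1.2 hb2)
    exact hobs _ hmem _ (hcopy.comp h1 h2 h3)
  · obtain ⟨h1, h2, h3⟩ := digitsEmbed_eq_true hb2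
    rw [List.getD_eq_getElem _ _ (by simpa using hlt), List.getElem_map] at h3
    exact ⟨_, List.getElem_mem hlt, _, hcopy.comp h1 h2 h3⟩

end Soundness

/-! ### Obstructions, targets and the lists of graphs -/

/-- The rows of eight graphs with second largest eigenvalue above `1`. -/
def spectralObstructions : List (List ℕ) :=
  [[22, 33, 9, 20, 9, 2],
   [18, 5, 10, 36, 1, 8],
   [50, 5, 10, 4, 1, 1],
   [114, 13, 2, 2, 1, 1, 1],
   [102, 25, 25, 6, 6, 1, 1],
   [234, 21, 234, 21, 10, 5, 5, 5],
   [250, 5, 10, 5, 1, 1, 1, 1],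
   [250, 5, 26, 5, 5, 1, 1, 1]]

/-- The rows of eleven graphs that are not planar. -/
def planarityObstructions : List (List ℕ) :=
  [[22, 41, 41, 22, 41, 22],
   [70, 25, 25, 38, 38, 88, 33],
   [70, 137, 41, 22, 104, 148, 17, 34],
   [22, 41, 73, 134, 161, 82, 164, 88],
   [102, 153, 25, 38, 70, 137, 145, 98],
   [134, 81, 265, 52, 10, 200, 290, 33, 68],
   [106, 277, 170, 277, 202, 5, 17, 20, 10],
   [390, 89, 41, 6, 162, 84, 290, 17, 65],
   [454, 57, 57, 70, 134, 262, 9, 17, 33],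
   [330, 37, 26, 133, 420, 82, 161, 88, 17],
   [106, 773, 154, 5, 356, 657, 17, 36, 18, 34]]

/-- The rows of the star with six leaves. -/
def starRows : List ℕ :=
  [126, 1, 1, 1, 1, 1, 1]

/-- The rows of the graphs that are excluded. -/
def obstructions : List (List ℕ) :=
  -- In the certificates, numbers 0 to 7 are thus spectral obstructions, 8 to 18 are nonplanar
  -- graphs, and 19 is the star.
  spectralObstructions ++ planarityObstructions ++ [starRows]

/-- The rows of `F1 7`, `H1`, …, `H13`. -/
def targets : List (List ℕ) :=
  -- The 16 vertices of `F1 7` are as many as one hexadecimal digit can address. That `s = 7` is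
  -- large enough here is part of what the checks of the lists establish.
  [[2032, 508, 514, 1026, 2051, 4099, 8195, 16387, 32771, 5, 9, 16, 32, 64, 128, 256],
   [50, 69, 10, 148, 9, 129, 130, 104],
   [202, 309, 10, 565, 74, 138, 17, 33, 2, 8],
   [122, 5, 394, 5, 129, 385, 257, 52, 100],
   [122, 133, 266, 5, 385, 257, 1, 18, 52],
   [122, 901, 10, 5, 129, 257, 513, 18, 34, 66],
   [122, 133, 10, 261, 385, 1, 1, 18, 24],
   [58, 69, 394, 5, 129, 449, 34, 52, 36],
   [58, 69, 138, 261, 449, 1, 18, 20, 24],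
   [58, 197, 266, 5, 321, 1, 18, 2, 20],
   [26, 37, 74, 133, 161, 82, 164, 88],
   [234, 277, 42, 533, 74, 5, 17, 1, 2, 8],
   [106, 149, 298, 533, 330, 5, 17, 2, 20, 8],
   [106, 149, 298, 533, 10, 5, 1, 2, 4, 8]]

/-- The graph on one vertex. -/
def level1 : List Entry := [
  -- Digit strings are read from the right, the last digit being the image of vertex 0, and missing
  -- leading digits are zeros. Neighbourhoods in the last list are bit masks: here 1 stands for the
  -- single neighbour 0.
  ⟨[0], 0, 0x0,
    [],
    [(1, 0, 0x10)]⟩]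

/-- The connected triangle-free graphs on 2 vertices without obstructions. -/
def level2 : List Entry := [
  ⟨[2, 1], 0, 0x40,
    [],
    [(1, 0, 0x210), (2, 0, 0x201)]⟩]

/-- The connected triangle-free graphs on 3 vertices without obstructions. -/
def level3 : List Entry := [
  ⟨[6, 1, 1], 0, 0x540,
    [],
    [(1, 0, 0x3210), (2, 1, 0x3210), (4, 1, 0x3120), (6, 2, 0x3210)]⟩]

/-- The connected triangle-free graphs on 4 vertices without obstructions. -/
def level4 : List Entry := [
  ⟨[14, 1, 1, 1], 0, 0x6540,
    [],
    [(1, 0, 0x43210), (2, 1, 0x43210), (4, 1, 0x43120), (6, 2, 0x43210), (8, 1, 0x42130),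
     (10, 2, 0x42310), (12, 2, 0x41320), (14, 3, 0x43210)]⟩,
  ⟨[6, 9, 1, 2], 0, 0xb540,
    [],
    [(1, 1, 0x34210), (2, 1, 0x24301), (4, 4, 0x43210), (6, 2, 0x23401), (8, 4, 0x42301),
     (9, 2, 0x32410), (12, 5, 0x43210)]⟩,
  ⟨[6, 9, 9, 6], 0, 0x1540,
    [],
    [(1, 2, 0x34210), (2, 2, 0x24301), (4, 2, 0x14302), (6, 3, 0x24301), (8, 2, 0x4213),
     (9, 3, 0x34210)]⟩]

/-- The connected triangle-free graphs on 5 vertices without obstructions. -/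
def level5 : List Entry := [
  ⟨[30, 1, 1, 1, 1], 0, 0x76540,
    [],
    [(1, 0, 0x543210), (2, 1, 0x543210), (4, 1, 0x543120), (6, 2, 0x543210), (8, 1, 0x542130),
     (10, 2, 0x542310), (12, 2, 0x541320), (14, 3, 0x543210), (16, 1, 0x532140),
     (18, 2, 0x532410), (20, 2, 0x531420), (22, 3, 0x534210), (24, 2, 0x521430),
     (26, 3, 0x524310), (28, 3, 0x514320), (30, 4, 0x543210)]⟩,
  ⟨[14, 17, 1, 1, 2], 0, 0xb6540,
    [(0, 3, 0x435210), (2, 3, 0x325410)],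
    [(1, 1, 0x453210), (2, 5, 0x543210), (4, 6, 0x543210), (6, 7, 0x543210), (8, 6, 0x542310),
     (10, 7, 0x542310), (14, 8, 0x543210), (17, 2, 0x432510), (20, 9, 0x543210),
     (24, 9, 0x542310), (28, 10, 0x543210)]⟩,
  ⟨[14, 17, 17, 1, 6], 0, 0x19540,
    [(0, 5, 0x524130)],
    [(1, 2, 0x453210), (2, 7, 0x453210), (4, 7, 0x453120), (6, 8, 0x235401), (10, 11, 0x543210),
     (12, 11, 0x543120), (14, 12, 0x543210), (16, 13, 0x543210), (17, 3, 0x435210),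
     (24, 10, 0x452130)]⟩,
  ⟨[14, 17, 17, 17, 14], 0, 0x16540,
    [(8, 0, 0x430215)],
    [(1, 3, 0x453210), (2, 8, 0x453210), (4, 8, 0x453120), (6, 12, 0x453210), (8, 8, 0x452130),
     (10, 12, 0x452310), (12, 12, 0x451320), (16, 3, 0x53214), (17, 4, 0x453210)]⟩,
  ⟨[6, 9, 17, 2, 4], 0, 0xcb540,
    [(0, 2, 0x324510), (0, 2, 0x413520), (1, 4, 0x452013), (1, 4, 0x351024), (2, 4, 0x354201),
     (2, 4, 0x453102)],
    [(1, 6, 0x435210), (6, 13, 0x423501), (12, 9, 0x314502), (18, 9, 0x423501),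
     (24, 14, 0x543210), (25, 11, 0x432150)]⟩,
  ⟨[6, 9, 17, 18, 12], 0, 0x21940,
    [],
    [(1, 9, 0x435210), (2, 9, 0x425301), (4, 9, 0x315402), (6, 10, 0x245031), (8, 9, 0x205413),
     (9, 10, 0x345120), (12, 10, 0x315402), (16, 9, 0x105324), (17, 10, 0x435210),
     (18, 10, 0x425301)]⟩]

/-- The connected triangle-free graphs on 6 vertices without obstructions. -/
def level6 : List Entry := [
  ⟨[62, 1, 1, 1, 1, 1], 0, 0x876540,
    [(19, 1, 0x5432160)],
    [(2, 0, 0x6543210), (4, 0, 0x6543120), (6, 1, 0x6543210), (8, 0, 0x6542130),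
     (10, 1, 0x6542310), (12, 1, 0x6541320), (14, 2, 0x6543210), (16, 0, 0x6532140),
     (18, 1, 0x6532410), (20, 1, 0x6531420), (22, 2, 0x6534210), (24, 1, 0x6521430),
     (26, 2, 0x6524310), (28, 2, 0x6514320), (30, 3, 0x6543210), (32, 0, 0x6432150),
     (34, 1, 0x6432510), (36, 1, 0x6431520), (38, 2, 0x6435210), (40, 1, 0x6421530),
     (42, 2, 0x6425310), (44, 2, 0x6415320), (46, 3, 0x6453210), (48, 1, 0x6321540),
     (50, 2, 0x6325410), (52, 2, 0x6315420), (54, 3, 0x6354210), (56, 2, 0x6215430),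
     (58, 3, 0x6254310), (60, 3, 0x6154320), (62, 4, 0x6543210)]⟩,
  ⟨[30, 33, 1, 1, 1, 2], 0, 0xb76540,
    [(0, 3, 0x536210), (2, 3, 0x326510), (0, 3, 0x546210), (0, 3, 0x546310), (2, 2, 0x435620),
     (2, 2, 0x425630), (3, 2, 0x4325610)],
    [(1, 0, 0x5643210), (4, 5, 0x6543210), (6, 6, 0x6543210), (8, 5, 0x6542310),
     (10, 6, 0x6542310), (14, 7, 0x6543210), (16, 5, 0x6532410), (18, 6, 0x6532410),
     (22, 7, 0x6534210), (26, 7, 0x6524310), (30, 8, 0x6543210), (33, 1, 0x5432610),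
     (44, 9, 0x6543210), (52, 9, 0x6534210), (56, 9, 0x6524310), (60, 10, 0x6543210)]⟩,
  ⟨[30, 33, 33, 1, 1, 6], 0, 0x1a9540,
    [(0, 3, 0x546310), (0, 3, 0x546320), (0, 5, 0x625130), (0, 5, 0x625140), (2, 3, 0x436510),
     (4, 3, 0x4356210)],
    [(1, 1, 0x5643210), (2, 6, 0x5643210), (4, 6, 0x5643120), (10, 11, 0x6543210),
     (12, 11, 0x6543120), (14, 12, 0x6543210), (18, 11, 0x6534210), (20, 11, 0x6534120),
     (22, 12, 0x6534210), (30, 13, 0x6543210), (33, 2, 0x5436210), (40, 9, 0x5642130),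
     (48, 9, 0x5632140), (56, 14, 0x6543210)]⟩,
  ⟨[30, 33, 33, 33, 1, 14], 0, 0x196540,
    [(0, 5, 0x625140), (8, 0, 0x530216), (0, 5, 0x635140), (0, 5, 0x635240)],
    [(1, 2, 0x5643210), (2, 7, 0x5643210), (4, 7, 0x5643120), (6, 12, 0x5643210),
     (8, 7, 0x5642130), (10, 12, 0x5642310), (12, 12, 0x5641320), (22, 15, 0x6543210),
     (26, 15, 0x6542310), (28, 15, 0x6541320), (32, 16, 0x6543210), (33, 3, 0x5463210),
     (48, 10, 0x5632140)]⟩,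
  ⟨[30, 33, 33, 33, 33, 30], 0, 0x176540,
    [(8, 0, 0x530216), (8, 0, 0x540216), (8, 0, 0x540316), (8, 0, 0x540326)],
    [(1, 3, 0x5643210), (2, 8, 0x5643210), (4, 8, 0x5643120), (6, 13, 0x5643210),
     (8, 8, 0x5642130), (10, 13, 0x5642310), (12, 13, 0x5641320), (16, 8, 0x5632140),
     (18, 13, 0x5632410), (20, 13, 0x5631420), (24, 13, 0x5621430), (32, 3, 0x643215),
     (33, 4, 0x5643210)]⟩,
  ⟨[14, 49, 1, 1, 2, 2], 0, 0xb1a940,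
    [(0, 3, 0x436210), (0, 3, 0x256401), (0, 3, 0x536210), (0, 3, 0x356401), (2, 3, 0x326410),
     (2, 3, 0x326510), (2, 3, 0x546201), (2, 3, 0x546301), (3, 4, 0x3265410), (3, 4, 0x5463201),
     (4, 1, 0x3254160), (4, 1, 0x5432061)],
    [(6, 6, 0x2354601), (10, 6, 0x3254601), (17, 6, 0x4532610), (20, 17, 0x6543210),
     (24, 17, 0x6542310), (33, 6, 0x5432610), (36, 17, 0x6453210), (40, 17, 0x6452310),
     (60, 14, 0x1054326)]⟩,
  ⟨[14, 17, 33, 1, 2, 4], 0, 0xcb6540,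
    [(1, 4, 0x562014), (1, 4, 0x461025), (2, 4, 0x465201), (2, 4, 0x564102), (0, 2, 0x425610),
     (0, 2, 0x514620), (1, 0, 0x350146)],
    [(1, 5, 0x5463210), (6, 18, 0x6543210), (8, 19, 0x6543210), (14, 20, 0x6543210),
     (20, 17, 0x4563120), (28, 21, 0x6543210), (34, 17, 0x5463210), (42, 21, 0x6453120),
     (49, 11, 0x5432160), (56, 22, 0x6543210)]⟩,
  ⟨[14, 49, 33, 1, 2, 6], 0, 0x1b9540,
    [(0, 5, 0x625130), (2, 3, 0x326410), (0, 3, 0x436210)],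
    [(1, 6, 0x5463210), (2, 6, 0x2364501), (4, 18, 0x5643210), (6, 7, 0x2346501),
     (10, 11, 0x3246501), (14, 12, 0x2345601), (17, 11, 0x4536210), (20, 21, 0x2365041),
     (28, 23, 0x6543210), (32, 18, 0x2634501), (33, 7, 0x5436210), (40, 21, 0x5462130),
     (49, 12, 0x5432610), (56, 23, 0x6234501)]⟩,
  ⟨[14, 49, 33, 33, 2, 14], 0, 0x1b6540,
    [(0, 5, 0x652041), (0, 1, 0x435260), (0, 1, 0x453062), (0, 1, 0x430265), (0, 3, 0x436210),
     (4, 5, 0x4632501), (8, 0, 0x530216), (9, 0, 0x4150326)],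
    [(1, 7, 0x5463210), (4, 20, 0x5643210), (6, 12, 0x2346501), (8, 20, 0x5642310),
     (10, 12, 0x3246501), (32, 7, 0x463215), (33, 8, 0x5463210), (49, 13, 0x5432610)]⟩,
  ⟨[14, 17, 33, 1, 34, 20], 0, 0x21a940,
    [(0, 2, 0x503641), (1, 4, 0x564103), (2, 4, 0x563014), (2, 4, 0x463025), (2, 4, 0x365410)],
    [(2, 17, 0x5643210), (4, 17, 0x4653120), (6, 21, 0x2356041), (17, 9, 0x4536120),
     (24, 22, 0x4651320), (28, 23, 0x4315602), (33, 9, 0x5436210), (40, 22, 0x5642310),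
     (42, 23, 0x5324601)]⟩,
  ⟨[14, 17, 33, 33, 34, 28], 0, 0x125490,
    [(0, 3, 0x436210), (0, 5, 0x635210), (0, 5, 0x630245), (9, 1, 0x4532061), (9, 1, 0x1032564)],
    [(1, 9, 0x5463210), (4, 21, 0x5643210), (6, 23, 0x5643210), (8, 21, 0x5642310),
     (10, 23, 0x5642310), (17, 14, 0x5432610), (20, 23, 0x4316502), (24, 23, 0x4216503),
     (32, 9, 0x163245), (33, 10, 0x5463210), (34, 14, 0x1064325)]⟩,
  ⟨[14, 49, 17, 33, 6, 10], 2, 0x547610,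
    [(2, 4, 0x465302), (2, 4, 0x564203), (2, 4, 0x263514), (2, 4, 0x362415)],
    [(1, 11, 0x5463210), (2, 11, 0x3265401), (12, 24, 0x6543210), (14, 15, 0x3254601),
     (24, 23, 0x4562130), (36, 23, 0x5463120), (48, 24, 0x6325401), (49, 15, 0x5432610)]⟩,
  ⟨[14, 49, 49, 33, 6, 14], 2, 0x426310,
    [(0, 5, 0x624130), (0, 5, 0x653041), (8, 0, 0x251406), (8, 0, 0x530216), (9, 6, 0x6421503)],
    [(1, 12, 0x5463210), (2, 12, 0x2364501), (4, 12, 0x1364502), (6, 13, 0x2364501),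
     (10, 15, 0x3264501), (12, 15, 0x3164502), (17, 15, 0x4563210), (32, 12, 0x463215),
     (33, 13, 0x5463210), (48, 15, 0x4063215)]⟩,
  ⟨[14, 17, 17, 1, 38, 16], 0, 0x319540,
    [(0, 2, 0x345601), (0, 2, 0x503641), (0, 5, 0x624130), (1, 4, 0x360145), (0, 2, 0x503642),
     (2, 4, 0x365410), (2, 4, 0x563014)],
    [(2, 18, 0x2536401), (4, 18, 0x1536402), (6, 20, 0x2536401), (17, 16, 0x5436210),
     (24, 9, 0x352164), (33, 9, 0x4532160), (42, 24, 0x5326401), (44, 24, 0x5316402),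
     (46, 15, 0x4053216)]⟩,
  ⟨[6, 9, 17, 34, 36, 24], 0, 0x132a90,
    [(2, 4, 0x265310), (2, 4, 0x364201), (2, 4, 0x463102), (2, 4, 0x562013), (0, 2, 0x413620),
     (0, 2, 0x502631), (1, 4, 0x361024), (1, 4, 0x260135)],
    [(12, 22, 0x3516402), (18, 22, 0x4526301), (25, 24, 0x5214306), (33, 22, 0x5436210),
     (38, 24, 0x4305216)]⟩]

/-- The connected triangle-free graphs on 7 vertices without obstructions. -/
def level7 : List Entry := [
  ⟨[62, 65, 1, 1, 1, 1, 2], 0, 0xb876540,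
    [(0, 3, 0x637210), (2, 3, 0x327610), (0, 3, 0x657410), (2, 3, 0x547610), (3, 2, 0x4326710),
     (19, 1, 0x5432170), (0, 3, 0x647210), (0, 3, 0x657210), (0, 3, 0x647310), (0, 3, 0x657310),
     (2, 2, 0x436720), (2, 2, 0x536720), (2, 2, 0x426730), (2, 2, 0x526730), (3, 2, 0x5326710),
     (3, 2, 0x5426710), (3, 2, 0x5436710)],
    [(4, 0, 0x76543210), (8, 0, 0x76542310), (14, 1, 0x76543210), (16, 0, 0x76532410),
     (22, 1, 0x76534210), (26, 1, 0x76524310), (30, 2, 0x76543210), (32, 0, 0x76432510),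
     (38, 1, 0x76435210), (42, 1, 0x76425310), (46, 2, 0x76453210), (50, 1, 0x76325410),
     (54, 2, 0x76354210), (58, 2, 0x76254310), (62, 3, 0x76543210), (92, 4, 0x76543210),
     (108, 4, 0x76453210), (116, 4, 0x76354210), (120, 4, 0x76254310), (124, 5, 0x76543210)]⟩,
  ⟨[62, 65, 65, 1, 1, 1, 6], 2, 0x6852401,
    [(0, 3, 0x647310), (0, 3, 0x657320), (0, 3, 0x657410), (2, 3, 0x437610), (3, 2, 0x5436710),
     (19, 1, 0x5432170), (0, 3, 0x657310), (0, 3, 0x647320), (0, 3, 0x657420), (0, 5, 0x726130),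
     (0, 5, 0x726140), (0, 5, 0x726150), (2, 2, 0x546730), (2, 2, 0x536740), (3, 0, 0x5432167),
     (3, 2, 0x5436720), (4, 3, 0x4367210), (4, 3, 0x5367210), (4, 3, 0x5467210),
     (5, 0, 0x54362017)],
    [(10, 6, 0x76543210), (12, 6, 0x76543120), (18, 6, 0x76534210), (20, 6, 0x76534120),
     (30, 7, 0x76543210), (34, 6, 0x76435210), (36, 6, 0x76435120), (46, 7, 0x76453210),
     (54, 7, 0x76354210), (88, 8, 0x76543210), (104, 8, 0x76453210), (112, 8, 0x76354210)]⟩,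
  ⟨[62, 65, 65, 65, 1, 1, 14], 0, 0x1a96540,
    [(0, 3, 0x657410), (8, 0, 0x630217), (0, 5, 0x736240), (0, 5, 0x726150), (19, 1, 0x5432170),
     (0, 3, 0x657420), (0, 3, 0x657430), (0, 5, 0x726140), (0, 5, 0x736140), (0, 5, 0x736150),
     (0, 5, 0x736250), (2, 3, 0x547610), (3, 1, 0x3215476), (4, 3, 0x5467210), (4, 3, 0x5467310),
     (4, 3, 0x5467320)],
    [(2, 1, 0x67543210), (4, 1, 0x67543120), (8, 1, 0x67542130), (22, 9, 0x76543210),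
     (26, 9, 0x76542310), (28, 9, 0x76541320), (38, 9, 0x76453210), (42, 9, 0x76452310),
     (44, 9, 0x76451320), (80, 4, 0x67532140), (96, 4, 0x67432150)]⟩,
  ⟨[62, 65, 65, 65, 65, 1, 30], 0, 0x1976540,
    [(0, 5, 0x726150), (8, 0, 0x630217), (0, 5, 0x746350), (8, 0, 0x640217), (8, 0, 0x640317),
     (8, 0, 0x640327), (19, 1, 0x5432170), (0, 5, 0x736150), (0, 5, 0x746150), (0, 5, 0x736250),
     (0, 5, 0x746250)],
    [(2, 2, 0x67543210), (4, 2, 0x67543120), (6, 7, 0x67543210), (8, 2, 0x67542130),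
     (10, 7, 0x67542310), (12, 7, 0x67541320), (16, 2, 0x67532140), (18, 7, 0x67532410),
     (20, 7, 0x67531420), (24, 7, 0x67521430), (64, 10, 0x76543210), (96, 5, 0x67432150)]⟩,
  ⟨[62, 65, 65, 65, 65, 65, 62], 0, 0x1876540,
    [(8, 0, 0x630217), (8, 0, 0x650417), (8, 0, 0x640327), (19, 1, 0x5432170),
     (5, 4, 0x54372610), (5, 4, 0x54273610), (5, 4, 0x53274610), (5, 4, 0x43275610),
     (5, 4, 0x54173620), (5, 4, 0x53174620), (5, 4, 0x43175620), (5, 4, 0x52174630),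
     (5, 4, 0x42175630), (5, 4, 0x32175640), (8, 0, 0x640217), (8, 0, 0x650217),
     (8, 0, 0x640317), (8, 0, 0x650317), (8, 0, 0x650327), (8, 0, 0x650427), (8, 0, 0x650437),
     (19, 1, 0x5432176)],
    [(2, 3, 0x67543210), (4, 3, 0x67543120), (8, 3, 0x67542130), (16, 3, 0x67532140),
     (32, 3, 0x67432150)]⟩,
  ⟨[30, 33, 65, 1, 1, 2, 4], 0, 0xcb76540,
    [(1, 4, 0x672015), (1, 4, 0x571026), (2, 4, 0x576201), (2, 4, 0x675102), (1, 0, 0x360157),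
     (0, 2, 0x526710), (0, 2, 0x615720), (0, 3, 0x547310), (1, 0, 0x460157), (2, 2, 0x436710),
     (2, 2, 0x435720)],
    [(1, 0, 0x65743210), (6, 11, 0x76543210), (8, 12, 0x76543210), (14, 13, 0x76543210),
     (16, 12, 0x76534210), (22, 13, 0x76534210), (30, 14, 0x76543210), (44, 15, 0x76543210),
     (52, 15, 0x76534210), (60, 16, 0x76543210), (74, 15, 0x75643120), (82, 15, 0x75634120),
     (90, 16, 0x75643120), (97, 6, 0x65432170), (120, 17, 0x76543210)]⟩,
  ⟨[30, 97, 65, 1, 1, 2, 6], 0, 0x1ba9540,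
    [(0, 3, 0x647310), (2, 3, 0x327510), (0, 5, 0x726130), (2, 3, 0x657401), (3, 4, 0x6574301),
     (4, 1, 0x6543071), (0, 3, 0x537210), (0, 3, 0x547310), (0, 3, 0x467501), (2, 2, 0x435720),
     (2, 3, 0x437610), (3, 4, 0x4376510), (4, 1, 0x4365170)],
    [(4, 11, 0x67543210), (10, 18, 0x76543210), (14, 19, 0x76543210), (18, 18, 0x76534210),
     (22, 19, 0x76534210), (33, 6, 0x56437210), (44, 20, 0x76543210), (52, 20, 0x76534210),
     (65, 1, 0x65437210), (72, 15, 0x65742130), (80, 15, 0x65732140), (120, 21, 0x76543210)]⟩,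
  ⟨[30, 97, 65, 65, 1, 2, 14], 0, 0x1b96540,
    [(0, 5, 0x726140), (0, 5, 0x763051), (0, 1, 0x530276), (0, 3, 0x537210), (4, 5, 0x5732601),
     (8, 0, 0x630217), (9, 0, 0x5160327), (0, 1, 0x536270), (0, 1, 0x562073), (0, 3, 0x547210)],
    [(1, 1, 0x65743210), (4, 13, 0x67543210), (6, 19, 0x67543210), (8, 13, 0x67542310),
     (10, 19, 0x67542310), (22, 22, 0x76543210), (26, 22, 0x76542310), (64, 23, 0x76543210),
     (65, 2, 0x65473210), (80, 16, 0x65732140), (97, 7, 0x65432710)]⟩,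
  ⟨[30, 97, 65, 65, 65, 2, 30], 0, 0x1b76540,
    [(0, 5, 0x762051), (8, 0, 0x640327), (0, 1, 0x563072), (4, 5, 0x5732601), (0, 1, 0x536270),
     (0, 1, 0x564072), (0, 1, 0x530276), (0, 3, 0x537210), (0, 3, 0x547210), (0, 3, 0x547310),
     (4, 5, 0x5742601), (4, 5, 0x5743601), (5, 1, 0x43251670), (8, 0, 0x630217),
     (8, 0, 0x640217), (8, 0, 0x640317)],
    [(1, 2, 0x65743210), (4, 14, 0x67543210), (8, 14, 0x67542310), (16, 14, 0x67532410),
     (64, 2, 0x5743216), (65, 3, 0x65743210)]⟩,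
  ⟨[30, 33, 65, 65, 1, 66, 44], 0, 0x12a5490,
    [(0, 2, 0x604751), (1, 4, 0x675104), (2, 4, 0x674015), (2, 4, 0x574026), (0, 3, 0x537210),
     (0, 5, 0x736210), (0, 5, 0x736240), (2, 4, 0x476510), (9, 1, 0x5632071), (9, 1, 0x1032675)],
    [(4, 15, 0x67543210), (6, 20, 0x67543210), (8, 15, 0x67542310), (10, 20, 0x67542310),
     (33, 8, 0x65432710), (52, 24, 0x76543210), (56, 24, 0x76542310), (65, 4, 0x65473210),
     (80, 17, 0x67532410), (82, 21, 0x67532410)]⟩,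
  ⟨[30, 33, 65, 65, 65, 66, 60], 0, 0x1265490,
    [(8, 0, 0x640327), (0, 5, 0x736210), (0, 5, 0x730256), (0, 3, 0x537210), (0, 3, 0x547210),
     (0, 3, 0x547310), (0, 5, 0x746210), (0, 5, 0x746310), (0, 5, 0x740256), (0, 5, 0x740356),
     (3, 2, 0x4325710), (3, 2, 0x4321756), (9, 1, 0x5632071), (9, 1, 0x5642071),
     (9, 1, 0x5643071), (9, 1, 0x1032675), (9, 1, 0x1042675), (9, 1, 0x1043675)],
    [(1, 4, 0x65743210), (4, 16, 0x67543210), (8, 16, 0x67542310), (16, 16, 0x67532410),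
     (64, 4, 0x1743256), (65, 5, 0x65743210)]⟩,
  ⟨[30, 97, 33, 65, 1, 6, 10], 2, 0x7625401,
    [(2, 3, 0x657401), (2, 4, 0x576302), (2, 4, 0x675203), (2, 4, 0x273615), (2, 4, 0x372516),
     (0, 3, 0x467501)],
    [(1, 6, 0x65743210), (2, 18, 0x65743210), (12, 25, 0x76543210), (14, 22, 0x32465701),
     (18, 26, 0x76543210), (30, 27, 0x76543210), (40, 20, 0x56742130), (56, 28, 0x76543210),
     (68, 20, 0x65743120), (84, 28, 0x75642310), (97, 9, 0x65432710), (112, 24, 0x65732140)]⟩,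
  ⟨[30, 97, 97, 65, 1, 6, 14], 2, 0x4276310,
    [(0, 5, 0x726140), (0, 1, 0x462571), (0, 1, 0x461572), (2, 3, 0x437510), (8, 0, 0x630217),
     (0, 1, 0x425176), (0, 5, 0x725130), (4, 3, 0x4357210), (4, 5, 0x4765210), (8, 0, 0x261507),
     (9, 0, 0x4021657), (9, 6, 0x7521603)],
    [(2, 19, 0x65743210), (4, 19, 0x65743120), (10, 22, 0x32475601), (12, 22, 0x31475602),
     (22, 27, 0x24357601), (33, 9, 0x56473210), (64, 29, 0x76543210), (65, 7, 0x65473210)]⟩,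
  ⟨[30, 97, 97, 65, 65, 6, 30], 2, 0x3652401,
    [(0, 3, 0x547310), (0, 5, 0x763051), (4, 5, 0x5743601), (8, 0, 0x630217), (9, 6, 0x7521603),
     (0, 1, 0x546370), (0, 1, 0x540376), (0, 3, 0x547320), (0, 5, 0x725130), (0, 5, 0x725140),
     (4, 5, 0x5743602), (5, 5, 0x43752610), (8, 0, 0x261507), (8, 0, 0x640217)],
    [(1, 7, 0x65743210), (10, 27, 0x67543210), (12, 27, 0x67543120), (18, 27, 0x67534210),
     (20, 27, 0x67534120), (64, 7, 0x5743216)]⟩,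
  ⟨[30, 33, 33, 65, 65, 70, 56], 3, 0x7254310,
    [(0, 3, 0x547310), (0, 3, 0x627130), (3, 4, 0x2174365), (3, 4, 0x4372156), (9, 1, 0x5643071),
     (0, 3, 0x627140), (0, 5, 0x746310), (0, 5, 0x746320), (0, 5, 0x725130), (0, 5, 0x725140),
     (4, 1, 0x2143675), (4, 1, 0x4321576)],
    [(1, 8, 0x65743210), (10, 28, 0x67543210), (12, 28, 0x67543120), (18, 28, 0x67534210),
     (20, 28, 0x67534120), (40, 21, 0x56721430), (48, 21, 0x56721340), (66, 21, 0x65743210),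
     (68, 21, 0x65743120)]⟩,
  ⟨[30, 97, 97, 33, 65, 14, 22], 2, 0x5476310,
    [(2, 4, 0x576403), (2, 4, 0x675304), (2, 4, 0x374615), (2, 4, 0x473516), (0, 5, 0x726130),
     (8, 0, 0x261507), (8, 0, 0x530217), (9, 6, 0x7621503), (9, 6, 0x7521604),
     (12, 2, 0x26543701), (12, 2, 0x16543702)],
    [(1, 9, 0x65743210), (2, 22, 0x65743210), (4, 22, 0x65743120), (6, 27, 0x24376501),
     (96, 30, 0x76543210)]⟩,
  ⟨[30, 33, 33, 33, 1, 78, 32], 0, 0x3196540,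
    [(0, 2, 0x456701), (0, 2, 0x604751), (0, 5, 0x725140), (1, 4, 0x470156), (0, 2, 0x604752),
     (8, 0, 0x530217), (0, 5, 0x735140), (0, 5, 0x735240), (2, 4, 0x476510), (2, 4, 0x674015)],
    [(2, 23, 0x65743210), (4, 23, 0x65743120), (6, 29, 0x65743210), (8, 23, 0x65742130),
     (10, 29, 0x65742310), (12, 29, 0x65741320), (33, 10, 0x65473210), (48, 4, 0x4632175),
     (65, 4, 0x56432170), (86, 30, 0x67543210), (90, 30, 0x67542310), (92, 30, 0x67541320)]⟩,
  ⟨[14, 49, 65, 1, 66, 2, 20], 0, 0x2b1a940,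
    [(1, 4, 0x674103), (2, 4, 0x673014), (2, 4, 0x473026), (0, 2, 0x615720), (0, 2, 0x603741),
     (1, 4, 0x672015), (2, 4, 0x675102), (2, 4, 0x275146), (2, 4, 0x376410), (2, 4, 0x576201)],
    [(6, 15, 0x23657041), (17, 15, 0x45637120), (24, 31, 0x76543210), (36, 31, 0x76325401),
     (60, 28, 0x16054327), (74, 20, 0x63254701), (97, 20, 0x65432710), (104, 32, 0x76543210)]⟩,
  ⟨[14, 81, 97, 1, 2, 4, 6], 0, 0x1cb9540,
    [(0, 5, 0x726130), (2, 3, 0x327410), (0, 2, 0x425716), (0, 2, 0x514720), (1, 4, 0x471625),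
     (2, 4, 0x475201), (2, 4, 0x574102), (0, 2, 0x514726)],
    [(1, 11, 0x65473210), (6, 23, 0x52347601), (14, 29, 0x52346701), (20, 15, 0x13456072),
     (28, 20, 0x13456072), (34, 15, 0x23546071), (42, 20, 0x23546071), (49, 25, 0x54637210),
     (64, 33, 0x76543210), (65, 13, 0x65437210), (72, 34, 0x76543210), (113, 22, 0x21354607),
     (120, 24, 0x21054637)]⟩,
  ⟨[14, 17, 33, 65, 2, 4, 8], 0, 0xdcb6540,
    [(2, 3, 0x327410), (1, 4, 0x471025), (2, 4, 0x475201), (2, 4, 0x574102), (0, 2, 0x425710),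
     (0, 2, 0x514720), (2, 4, 0x476301), (2, 4, 0x675203), (0, 2, 0x436710), (0, 2, 0x614730),
     (1, 0, 0x643027), (1, 4, 0x471036)],
    [(1, 12, 0x65473210), (14, 35, 0x76543210), (28, 34, 0x47651320), (42, 34, 0x57642310),
     (56, 31, 0x54672130), (70, 34, 0x67543210), (84, 31, 0x64573120), (98, 31, 0x65473210),
     (113, 26, 0x65432170)]⟩,
  ⟨[14, 81, 97, 65, 2, 4, 14], 0, 0x1cb6540,
    [(0, 5, 0x762041), (1, 4, 0x471025), (0, 1, 0x536170), (0, 1, 0x430276), (0, 2, 0x514720),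
     (2, 4, 0x475201), (2, 4, 0x574102), (0, 1, 0x563071), (0, 1, 0x463072), (0, 2, 0x425710),
     (8, 0, 0x630217), (9, 0, 0x5260317), (9, 0, 0x4160327)],
    [(1, 13, 0x65473210), (6, 29, 0x52347601), (8, 35, 0x67543210), (64, 13, 0x5473216),
     (65, 14, 0x65473210), (113, 27, 0x65432170)]⟩,
  ⟨[14, 17, 97, 65, 66, 4, 28], 0, 0x1b25490,
    [(0, 5, 0x763052), (2, 4, 0x475201), (2, 4, 0x175264), (0, 2, 0x425710), (1, 4, 0x471025),
     (2, 4, 0x574102), (9, 1, 0x4632071), (9, 1, 0x1032674), (10, 0, 0x45620317),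
     (10, 0, 0x15026347)],
    [(1, 15, 0x65473210), (6, 20, 0x13457062), (8, 34, 0x46751320), (20, 20, 0x43157602),
     (49, 28, 0x45617320), (64, 15, 0x5173246), (65, 16, 0x65473210), (98, 28, 0x15047326)]⟩,
  ⟨[14, 17, 33, 65, 66, 68, 56], 0, 0x1324a90,
    [(2, 4, 0x75641), (2, 4, 0x672014), (2, 4, 0x574102), (2, 4, 0x271465), (2, 4, 0x176520),
     (2, 4, 0x472036), (10, 2, 0x24563701), (10, 2, 0x15463702)],
    [(8, 31, 0x54762130), (20, 32, 0x64573120), (34, 32, 0x65473210), (49, 24, 0x54621730),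
     (65, 17, 0x65473210), (70, 24, 0x21054736)]⟩,
  ⟨[14, 49, 97, 65, 66, 6, 28], 3, 0x2418705,
    [(2, 4, 0x675103), (2, 4, 0x173625), (2, 4, 0x576301), (2, 4, 0x371526), (0, 5, 0x752041),
     (9, 1, 0x4632071), (9, 1, 0x4150276), (10, 6, 0x47152063), (11, 0, 0x20156347)],
    [(1, 20, 0x65473210), (4, 20, 0x13475062), (10, 24, 0x32675041), (17, 28, 0x65432710),
     (20, 28, 0x43176502), (66, 21, 0x62374501), (96, 24, 0x50173246)]⟩,
  ⟨[14, 49, 81, 97, 6, 10, 12], 3, 0x2648705,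
    [(2, 4, 0x273514), (2, 4, 0x372415), (0, 2, 0x615724), (1, 4, 0x571426), (2, 4, 0x576201),
     (2, 4, 0x675102), (0, 2, 0x342751), (0, 5, 0x724130), (12, 0, 0x36521407)],
    [(1, 25, 0x65473210), (14, 30, 0x63254701), (24, 24, 0x21465073), (36, 24, 0x31564072),
     (66, 24, 0x32654071), (112, 36, 0x76543210)]⟩]

/-- The connected triangle-free graphs on 8 vertices without obstructions. -/
def level8 : List Entry := [
  ⟨[62, 65, 129, 1, 1, 1, 2, 4], 0, 0xcb876540,
    [(1, 4, 0x782016), (1, 4, 0x681027), (2, 4, 0x687201), (2, 4, 0x786102), (1, 0, 0x370168),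
     (19, 1, 0x5432180), (2, 3, 0x548610), (0, 3, 0x648310), (2, 2, 0x437810), (0, 3, 0x658310),
     (0, 3, 0x658410), (1, 0, 0x470168), (1, 0, 0x570168), (2, 2, 0x537810), (2, 2, 0x547810),
     (2, 2, 0x436820), (2, 2, 0x536820), (3, 2, 0x5436810)],
    [(8, 0, 0x876543210), (14, 1, 0x876543210), (16, 0, 0x876534210), (22, 1, 0x876534210),
     (30, 2, 0x876543210), (32, 0, 0x876435210), (38, 1, 0x876435210), (46, 2, 0x876453210),
     (54, 2, 0x876354210), (62, 3, 0x876543210), (92, 4, 0x876543210), (108, 4, 0x876453210),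
     (116, 4, 0x876354210), (124, 5, 0x876543210), (154, 4, 0x867543120), (170, 4, 0x867453120),
     (178, 4, 0x867354120), (186, 5, 0x867543120), (248, 6, 0x876543210)]⟩,
  ⟨[62, 193, 129, 129, 1, 1, 2, 14], 0, 0x1ba96540,
    [(0, 3, 0x758410), (2, 3, 0x328610), (2, 3, 0x768401), (2, 3, 0x768501), (3, 4, 0x7685401),
     (4, 1, 0x7654081), (19, 1, 0x5432180), (0, 1, 0x673082), (0, 1, 0x672083),
     (9, 0, 0x6170328), (4, 5, 0x6832701), (8, 0, 0x730218), (0, 3, 0x638210), (0, 3, 0x658410),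
     (2, 3, 0x548710)],
    [(4, 1, 0x786543210), (8, 1, 0x786542310), (22, 7, 0x876543210), (26, 7, 0x876542310),
     (38, 7, 0x876453210), (42, 7, 0x876452310), (144, 4, 0x768532140), (160, 4, 0x768432150)]⟩,
  ⟨[62, 193, 129, 129, 129, 1, 2, 30], 0, 0x1b976540,
    [(0, 5, 0x827150), (0, 5, 0x873061), (8, 0, 0x740328), (4, 5, 0x6832701), (19, 1, 0x5432180),
     (0, 1, 0x674083), (0, 3, 0x658210), (0, 1, 0x630287), (4, 5, 0x6842701), (4, 5, 0x6843701),
     (8, 0, 0x730218), (8, 0, 0x740218), (8, 0, 0x740318), (0, 1, 0x672083), (0, 3, 0x638210),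
     (0, 3, 0x648210), (0, 3, 0x648310)],
    [(4, 2, 0x786543210), (8, 2, 0x786542310), (16, 2, 0x786532410), (128, 8, 0x876543210),
     (160, 5, 0x768432150)]⟩,
  ⟨[62, 193, 129, 129, 129, 129, 2, 62], 0, 0x1b876540,
    [(0, 5, 0x872061), (8, 0, 0x740328), (0, 1, 0x673082), (4, 5, 0x6832701), (19, 1, 0x5432180),
     (0, 3, 0x658210), (4, 5, 0x6854701), (8, 0, 0x750218), (0, 1, 0x674082), (0, 3, 0x648310),
     (8, 0, 0x740318), (19, 1, 0x5432187), (0, 3, 0x638210), (0, 3, 0x648210), (0, 3, 0x658310),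
     (0, 3, 0x658410), (4, 5, 0x6842701), (4, 5, 0x6853701)],
    [(4, 3, 0x786543210), (8, 3, 0x786542310), (16, 3, 0x786532410), (32, 3, 0x786432510)]⟩,
  ⟨[62, 65, 129, 129, 129, 1, 130, 92], 0, 0x12a65490,
    [(0, 2, 0x705861), (1, 4, 0x786105), (2, 4, 0x785016), (3, 2, 0x4326810), (8, 0, 0x740328),
     (19, 1, 0x5432180), (0, 5, 0x837250), (0, 3, 0x638210), (0, 3, 0x648210), (0, 3, 0x648310),
     (0, 5, 0x837210), (0, 5, 0x847210), (0, 5, 0x847310), (0, 5, 0x847250), (0, 5, 0x847350),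
     (1, 4, 0x580167), (9, 1, 0x6732081), (9, 1, 0x6742081), (9, 1, 0x6743081),
     (9, 1, 0x1032786), (9, 1, 0x1042786), (9, 1, 0x1043786)],
    [(4, 4, 0x786543210), (8, 4, 0x786542310), (16, 4, 0x786532410), (160, 6, 0x786432510)]⟩,
  ⟨[62, 65, 129, 129, 129, 129, 130, 124], 0, 0x12765490,
    [(8, 0, 0x740328), (0, 5, 0x837210), (0, 5, 0x830267), (0, 3, 0x658210), (0, 5, 0x857410),
     (0, 5, 0x850467), (8, 0, 0x750438), (9, 1, 0x6752081), (9, 1, 0x1052786),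
     (19, 1, 0x5432180), (19, 1, 0x6543287), (0, 3, 0x638210), (0, 3, 0x648210),
     (0, 3, 0x648310), (0, 3, 0x658310), (0, 3, 0x658410), (0, 5, 0x847210), (0, 5, 0x857210),
     (0, 5, 0x857310), (0, 5, 0x840267), (0, 5, 0x850267), (0, 5, 0x850367)],
    [(4, 5, 0x786543210), (8, 5, 0x786542310), (16, 5, 0x786532410), (32, 5, 0x786432510)]⟩,
  ⟨[62, 193, 65, 129, 1, 1, 6, 10], 2, 0x76825401,
    [(2, 3, 0x768401), (2, 4, 0x687302), (2, 4, 0x786203), (2, 4, 0x283716), (2, 4, 0x382617),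
     (0, 3, 0x478601), (2, 3, 0x768501), (3, 4, 0x7685401), (4, 1, 0x7654081),
     (19, 1, 0x5432180), (0, 3, 0x658410), (0, 3, 0x758410), (0, 3, 0x578601), (2, 2, 0x547820),
     (2, 2, 0x546830)],
    [(12, 9, 0x876543210), (18, 10, 0x876543210), (30, 11, 0x876543210), (34, 10, 0x876453210),
     (46, 11, 0x876453210), (88, 12, 0x876543210), (104, 12, 0x876453210),
     (148, 12, 0x867542310), (164, 12, 0x867452310), (240, 13, 0x876543210)]⟩,
  ⟨[62, 193, 193, 129, 129, 1, 6, 30], 2, 0x36852401,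
    [(0, 5, 0x827150), (0, 1, 0x572681), (0, 1, 0x571682), (8, 0, 0x730218), (19, 1, 0x5432180),
     (2, 3, 0x438610), (4, 5, 0x6843701), (0, 3, 0x648310), (8, 0, 0x740218), (9, 6, 0x8621703),
     (0, 1, 0x673084), (0, 1, 0x526187), (0, 3, 0x648320), (0, 5, 0x826130), (0, 5, 0x826140),
     (3, 2, 0x5436820)],
    [(10, 11, 0x786543210), (12, 11, 0x786543120), (18, 11, 0x786534210), (20, 11, 0x786534120),
     (128, 14, 0x876543210)]⟩,
  ⟨[62, 65, 65, 129, 129, 1, 134, 88], 3, 0x72654310,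
    [(0, 2, 0x705861), (1, 4, 0x786105), (2, 4, 0x785016), (2, 4, 0x685037), (19, 1, 0x5432180),
     (0, 3, 0x648310), (0, 3, 0x728130), (9, 1, 0x6743081), (0, 3, 0x728140), (0, 5, 0x847310),
     (0, 5, 0x847320), (0, 5, 0x826130), (0, 5, 0x826140), (0, 5, 0x826150), (0, 5, 0x847350),
     (3, 0, 0x5432168), (3, 0, 0x5214378)],
    [(10, 12, 0x786543210), (12, 12, 0x786543120), (18, 12, 0x786534210), (20, 12, 0x786534120),
     (104, 13, 0x687215430), (112, 13, 0x687215340), (162, 13, 0x786435210),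
     (164, 13, 0x786435120)]⟩,
  ⟨[62, 193, 193, 65, 129, 1, 14, 22], 11, 0x42765310,
    [(2, 3, 0x768501), (2, 4, 0x687403), (2, 4, 0x786304), (19, 1, 0x5432180), (0, 1, 0x572681),
     (0, 1, 0x527186), (0, 1, 0x526187), (2, 3, 0x548610), (8, 0, 0x630218), (0, 5, 0x827130),
     (0, 5, 0x863071), (4, 3, 0x5468210), (9, 0, 0x5021768), (9, 6, 0x8721603),
     (9, 6, 0x8621704), (12, 2, 0x27643801), (12, 2, 0x17643802), (16, 3, 0x435768210)],
    [(2, 7, 0x768543210), (4, 7, 0x768543120)]⟩,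
  ⟨[62, 65, 65, 65, 65, 1, 158, 64], 0, 0x31976540,
    [(0, 2, 0x567801), (0, 2, 0x705861), (0, 5, 0x826150), (1, 4, 0x580167), (8, 0, 0x640328),
     (0, 5, 0x836150), (19, 1, 0x5432180), (0, 5, 0x846150), (0, 5, 0x836250), (8, 0, 0x630218),
     (8, 0, 0x640218), (8, 0, 0x640318), (19, 1, 0x7432186), (0, 5, 0x846250), (0, 5, 0x846350)],
    [(2, 8, 0x768543210), (4, 8, 0x768543120), (6, 14, 0x768543210), (8, 8, 0x768542130),
     (10, 14, 0x768542310), (12, 14, 0x768541320), (16, 8, 0x768532140), (18, 14, 0x768532410),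
     (20, 14, 0x768531420), (24, 14, 0x768521430)]⟩,
  ⟨[30, 161, 193, 1, 1, 2, 4, 6], 0, 0x1cba9540,
    [(0, 5, 0x827130), (2, 3, 0x328510), (1, 4, 0x581026), (2, 4, 0x586201), (2, 4, 0x685102),
     (0, 2, 0x615827), (0, 2, 0x526810), (3, 4, 0x4387620), (3, 4, 0x7584301), (4, 1, 0x7543081),
     (0, 3, 0x548310), (0, 3, 0x748310), (0, 3, 0x478501), (0, 5, 0x827140), (2, 2, 0x435820),
     (2, 3, 0x438710), (3, 0, 0x7654308)],
    [(14, 15, 0x876543210), (22, 15, 0x876534210), (44, 16, 0x876543210), (52, 16, 0x876534210),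
     (74, 16, 0x875643120), (82, 16, 0x875634120), (97, 9, 0x657438210), (129, 1, 0x765438210),
     (136, 17, 0x876543210), (144, 17, 0x876534210), (248, 13, 0x21436578)]⟩,
  ⟨[30, 33, 65, 129, 1, 2, 4, 8], 0, 0xdcb76540,
    [(2, 3, 0x328510), (1, 4, 0x581026), (2, 4, 0x586201), (2, 4, 0x685102), (2, 4, 0x587301),
     (2, 4, 0x786203), (0, 2, 0x526810), (0, 2, 0x615820), (1, 0, 0x753028), (1, 4, 0x581037),
     (0, 2, 0x537810), (0, 2, 0x715830), (1, 0, 0x460158), (1, 0, 0x470158), (1, 0, 0x470268)],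
    [(1, 0, 0x765843210), (14, 18, 0x876543210), (16, 19, 0x876543210), (30, 20, 0x876543210),
     (44, 17, 0x587641320), (60, 21, 0x876543210), (74, 17, 0x687542310), (90, 21, 0x875643120),
     (120, 22, 0x876543210), (134, 17, 0x786543210), (150, 21, 0x865742130),
     (180, 22, 0x867542310), (210, 22, 0x857641320), (225, 10, 0x765432180)]⟩,
  ⟨[30, 161, 193, 129, 1, 2, 4, 14], 0, 0x1cb96540,
    [(0, 5, 0x827140), (2, 3, 0x328510), (1, 4, 0x581026), (2, 4, 0x586201), (2, 4, 0x685102),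
     (0, 1, 0x637180), (0, 1, 0x673081), (0, 1, 0x573082), (0, 1, 0x572083), (0, 2, 0x615820),
     (8, 0, 0x730218), (9, 0, 0x6270318), (9, 0, 0x5170328), (0, 2, 0x526810)],
    [(1, 1, 0x765843210), (6, 15, 0x786543210), (8, 18, 0x786543210), (22, 23, 0x876543210),
     (128, 24, 0x876543210), (129, 2, 0x765483210), (144, 21, 0x765832140),
     (225, 11, 0x765432180)]⟩,
  ⟨[30, 161, 193, 129, 129, 2, 4, 30], 0, 0x1cb76540,
    [(0, 5, 0x872051), (1, 4, 0x581026), (2, 4, 0x586201), (2, 4, 0x685102), (2, 3, 0x438510),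
     (2, 3, 0x438627), (0, 2, 0x615820), (5, 1, 0x43162780), (8, 0, 0x730218), (9, 0, 0x6270318),
     (9, 0, 0x5170328), (0, 1, 0x673081), (0, 1, 0x573082), (0, 3, 0x548310), (4, 5, 0x5843701),
     (8, 0, 0x740218)],
    [(1, 2, 0x765843210), (8, 20, 0x786543210), (16, 20, 0x786534210), (128, 2, 0x65843217),
     (129, 3, 0x765843210)]⟩,
  ⟨[30, 33, 193, 129, 1, 130, 4, 44], 0, 0x1b2a5490,
    [(1, 4, 0x587204), (2, 4, 0x784015), (0, 2, 0x504872), (1, 4, 0x581026), (2, 4, 0x586201),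
     (2, 4, 0x186275), (0, 2, 0x526810), (0, 5, 0x873062), (2, 4, 0x685102), (2, 4, 0x584027),
     (2, 4, 0x487510), (9, 1, 0x5732081), (9, 1, 0x1032785), (10, 0, 0x56720318),
     (10, 0, 0x16027358)],
    [(6, 16, 0x786543210), (8, 17, 0x578641320), (52, 25, 0x876543210), (97, 12, 0x567418320),
     (129, 4, 0x765483210), (144, 22, 0x768532410), (210, 26, 0x876543210)]⟩,
  ⟨[30, 33, 193, 129, 129, 130, 4, 60], 0, 0x1b265490,
    [(0, 5, 0x873062), (2, 4, 0x586201), (2, 4, 0x186275), (2, 4, 0x685102), (0, 1, 0x674083),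
     (9, 0, 0x6270438), (0, 1, 0x647380), (0, 1, 0x640387), (4, 5, 0x6843702), (8, 0, 0x740328),
     (0, 2, 0x526810), (0, 3, 0x548310), (9, 1, 0x5732081), (9, 1, 0x5742081), (9, 1, 0x1032785),
     (9, 1, 0x1042785)],
    [(1, 4, 0x765843210), (8, 21, 0x786543210), (16, 21, 0x786534210), (128, 4, 0x61843257),
     (129, 5, 0x765843210)]⟩,
  ⟨[30, 33, 65, 129, 129, 130, 132, 120], 0, 0x13254a90,
    [(2, 4, 0x86751), (2, 4, 0x782015), (2, 4, 0x685102), (2, 4, 0x281576), (2, 4, 0x187620),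
     (2, 4, 0x582037), (10, 2, 0x25673801), (10, 2, 0x16573802), (0, 3, 0x548310),
     (0, 5, 0x847310), (0, 5, 0x847320), (10, 2, 0x25674801), (10, 2, 0x16574802)],
    [(8, 22, 0x786543210), (16, 22, 0x786534210), (97, 13, 0x765432180), (129, 6, 0x765843210),
     (134, 13, 0x21436587)]⟩,
  ⟨[30, 225, 65, 129, 1, 2, 6, 10], 5, 0x72954310,
    [(2, 3, 0x328510), (2, 3, 0x768401), (2, 4, 0x687302), (2, 4, 0x786203), (2, 4, 0x283716),
     (2, 4, 0x382617), (0, 3, 0x538210), (0, 3, 0x548210), (0, 3, 0x548310), (0, 3, 0x468501),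
     (0, 3, 0x478501), (0, 3, 0x478601), (3, 2, 0x4325810), (3, 2, 0x7654801), (4, 1, 0x4365180),
     (4, 1, 0x7542081)],
    [(14, 7, 0x324576801), (18, 10, 0x432587601), (33, 10, 0x576483210), (44, 25, 0x324876051),
     (72, 16, 0x675842130), (120, 26, 0x12745638), (132, 16, 0x765843120), (180, 26, 0x13645728),
     (193, 7, 0x765432810), (208, 25, 0x765832140)]⟩,
  ⟨[30, 225, 193, 129, 1, 2, 6, 14], 2, 0x42876310,
    [(0, 5, 0x827140), (2, 3, 0x328510), (0, 1, 0x471682), (0, 1, 0x537280), (0, 1, 0x472681),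
     (0, 1, 0x572083), (2, 3, 0x438610), (2, 3, 0x658301), (3, 4, 0x4386510), (3, 4, 0x6584301),
     (8, 0, 0x271608), (8, 0, 0x730218), (0, 1, 0x573082), (0, 1, 0x426187), (9, 0, 0x5170328),
     (9, 0, 0x4021768), (9, 6, 0x8621703)],
    [(4, 15, 0x768543210), (10, 7, 0x324586701), (22, 11, 0x243568701), (65, 7, 0x675483210),
     (128, 15, 0x238456701), (161, 11, 0x756438210)]⟩,
  ⟨[30, 97, 193, 129, 1, 130, 6, 44], 4, 0x87265410,
    [(2, 4, 0x786103), (2, 4, 0x183726), (0, 2, 0x704851), (0, 5, 0x826140), (2, 4, 0x784015),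
     (2, 4, 0x584027), (1, 4, 0x785104), (2, 4, 0x687301), (3, 4, 0x4386510), (9, 1, 0x5732081),
     (9, 1, 0x5160287), (10, 0, 0x74201658), (10, 0, 0x54102678), (10, 6, 0x58162073),
     (15, 4, 0x347586120)],
    [(4, 16, 0x768543210), (10, 25, 0x324786051), (33, 12, 0x765432810), (146, 26, 0x14635827)]⟩,
  ⟨[30, 97, 65, 129, 129, 130, 134, 120], 3, 0x27831450,
    [(2, 4, 0x85762), (2, 4, 0x782015), (3, 4, 0x6584301), (3, 4, 0x2184376), (0, 3, 0x548310),
     (3, 4, 0x4386510), (10, 6, 0x38751602), (11, 0, 0x16750238), (0, 3, 0x648320),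
     (0, 5, 0x826130), (0, 5, 0x826140), (0, 5, 0x820176)],
    [(10, 26, 0x12845637), (18, 26, 0x12835647), (33, 13, 0x756438210), (72, 26, 0x678524310),
     (80, 26, 0x678523410), (132, 13, 0x21438567)]⟩,
  ⟨[30, 225, 193, 65, 129, 2, 14, 22], 2, 0x54876310,
    [(0, 5, 0x862051), (2, 4, 0x687403), (2, 4, 0x786304), (2, 4, 0x384716), (2, 4, 0x483617),
     (0, 1, 0x530286), (0, 3, 0x548310), (8, 0, 0x271608), (0, 1, 0x536280), (0, 1, 0x563082),
     (3, 2, 0x4325810), (8, 0, 0x630218), (9, 0, 0x5160328), (9, 6, 0x8721603),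
     (9, 6, 0x8621704), (12, 2, 0x27643801)],
    [(1, 7, 0x765843210), (4, 23, 0x768543210), (6, 11, 0x243587601), (192, 27, 0x876543210)]⟩,
  ⟨[30, 97, 65, 65, 1, 2, 142, 64], 0, 0x31b96540,
    [(0, 5, 0x826140), (1, 4, 0x480167), (0, 2, 0x704862), (0, 2, 0x467801), (0, 5, 0x863051),
     (4, 5, 0x5832601), (0, 1, 0x536280), (0, 1, 0x530286), (0, 3, 0x538210), (8, 0, 0x630218),
     (9, 0, 0x5160328), (0, 1, 0x562083), (0, 2, 0x704861), (0, 3, 0x548210), (2, 4, 0x487610),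
     (2, 4, 0x784016)],
    [(4, 24, 0x768543210), (6, 15, 0x237458601), (8, 24, 0x768542310), (10, 15, 0x327458601),
     (65, 8, 0x765483210), (80, 4, 0x54732186), (97, 14, 0x765432810), (129, 4, 0x657432180),
     (150, 27, 0x786543210), (154, 27, 0x786542310)]⟩,
  ⟨[30, 33, 193, 65, 129, 194, 44, 52], 3, 0x87264510,
    [(2, 4, 0x87563), (2, 4, 0x786304), (2, 4, 0x684015), (2, 4, 0x584026), (2, 4, 0x483627),
     (2, 4, 0x387510), (0, 5, 0x836210), (9, 1, 0x1576280), (9, 1, 0x1032685),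
     (10, 2, 0x46751803), (10, 2, 0x37651804), (10, 6, 0x18572603), (10, 6, 0x18562704),
     (15, 3, 0x437568120), (17, 1, 0x127406385)],
    [(4, 25, 0x768543210), (33, 13, 0x576814320)]⟩,
  ⟨[30, 97, 161, 193, 1, 6, 10, 12], 6, 0x87254310,
    [(2, 4, 0x283615), (2, 4, 0x382516), (2, 3, 0x658401), (2, 4, 0x687201), (0, 2, 0x716825),
     (2, 4, 0x586302), (1, 4, 0x681527), (2, 4, 0x785103), (0, 3, 0x468501), (12, 0, 0x37621508),
     (14, 1, 0x476530281), (15, 2, 0x653724801), (15, 2, 0x753614802), (15, 2, 0x762514803),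
     (17, 0, 0x437206158)],
    [(1, 9, 0x765843210), (14, 27, 0x732465801), (40, 25, 0x214576083), (68, 25, 0x314675082),
     (130, 25, 0x324765081)]⟩,
  ⟨[30, 225, 33, 65, 129, 6, 10, 18], 5, 0x87254310,
    [(2, 4, 0x586302), (2, 4, 0x685203), (2, 4, 0x283615), (2, 4, 0x382516), (2, 4, 0x587402),
     (2, 4, 0x284715), (2, 3, 0x328710), (2, 3, 0x658401), (0, 2, 0x547820), (0, 2, 0x274851),
     (15, 5, 0x437865210), (15, 5, 0x427856310), (15, 5, 0x326857410), (15, 5, 0x764832501),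
     (15, 5, 0x754823601), (15, 5, 0x653824701), (16, 1, 0x432765180), (16, 1, 0x765432081)],
    [(1, 10, 0x765843210), (2, 10, 0x432876501)]⟩,
  ⟨[30, 225, 161, 193, 129, 6, 10, 30], 2, 0x37625401,
    [(2, 4, 0x283615), (2, 4, 0x382516), (2, 3, 0x658401), (2, 4, 0x586302), (2, 4, 0x685203),
     (0, 3, 0x468501), (8, 0, 0x730218), (9, 6, 0x8631702), (9, 6, 0x8521703), (0, 1, 0x647280),
     (0, 1, 0x672084), (4, 3, 0x6548701), (4, 5, 0x6842701), (8, 0, 0x271508),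
     (14, 5, 0x465817302), (16, 6, 0x658324701)],
    [(1, 11, 0x765843210), (128, 11, 0x65843217)]⟩,
  ⟨[30, 97, 33, 193, 129, 134, 10, 56], 4, 0x87254310,
    [(2, 4, 0x586302), (2, 4, 0x786104), (2, 4, 0x382516), (3, 4, 0x2184375), (2, 4, 0x687401),
     (2, 4, 0x685203), (2, 4, 0x481637), (10, 6, 0x78361052), (9, 1, 0x5743081),
     (10, 0, 0x26037458), (10, 0, 0x46015278), (15, 7, 0x683742501), (15, 7, 0x681524703)],
    [(1, 12, 0x765843210), (40, 26, 0x34628715), (130, 26, 0x12648537)]⟩,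
  ⟨[30, 97, 97, 65, 1, 6, 142, 64], 2, 0x93682401,
    [(0, 5, 0x826140), (1, 4, 0x480167), (0, 1, 0x752081), (0, 1, 0x461582), (0, 2, 0x704861),
     (8, 0, 0x630218), (2, 3, 0x438510), (2, 4, 0x487610), (4, 3, 0x4358210), (4, 5, 0x7850216),
     (0, 1, 0x725180), (0, 5, 0x825130), (8, 0, 0x261508), (9, 0, 0x7621508), (9, 0, 0x4021658),
     (9, 6, 0x8521603), (14, 0, 0x537462018)],
    [(2, 15, 0x237485601), (4, 15, 0x137485602), (10, 23, 0x327485601), (12, 23, 0x317485602),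
     (65, 14, 0x765483210)]⟩,
  ⟨[30, 97, 97, 33, 65, 142, 150, 96], 12, 0x84265310,
    [(2, 4, 0x586403), (2, 4, 0x685304), (0, 2, 0x704853), (1, 4, 0x480357), (2, 4, 0x487510),
     (2, 4, 0x784015), (12, 0, 0x67450318), (0, 2, 0x635840), (0, 5, 0x826130), (0, 5, 0x853061),
     (8, 0, 0x261508), (9, 6, 0x8765210), (9, 6, 0x8621503), (9, 6, 0x8521604),
     (12, 0, 0x67450328), (14, 8, 0x874362510)],
    [(2, 27, 0x765843210), (4, 27, 0x765843120)]⟩,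
  ⟨[14, 49, 65, 129, 194, 2, 20, 24], 0, 0x32b1a940,
    [(2, 4, 0x87462), (2, 4, 0x483026), (1, 4, 0x682015), (2, 4, 0x386410), (2, 4, 0x785103),
     (2, 4, 0x586201), (2, 4, 0x683014), (2, 4, 0x385147), (0, 2, 0x715830), (0, 2, 0x526810),
     (10, 2, 0x36741802), (10, 2, 0x27641803), (13, 0, 0x350164728), (13, 0, 0x250174638),
     (15, 1, 0x327465180), (15, 1, 0x763025184)],
    [(17, 22, 0x457681320)]⟩,
  ⟨[14, 49, 65, 129, 66, 130, 148, 104], 1, 0x73625410,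
    [(2, 4, 0x685102), (2, 4, 0x782015), (2, 4, 0x187620), (2, 4, 0x87641), (2, 4, 0x784103),
     (2, 4, 0x683014), (3, 4, 0x4285376), (3, 4, 0x5384267), (10, 2, 0x52764810),
     (10, 2, 0x43675810), (10, 2, 0x34762801), (10, 2, 0x25673801), (10, 2, 0x16573802),
     (13, 4, 0x436785120), (13, 4, 0x527684130)],
    []⟩,
  ⟨[14, 81, 97, 1, 2, 4, 134, 64], 0, 0x31cb9540,
    [(0, 5, 0x826130), (1, 4, 0x380167), (2, 3, 0x328410), (2, 4, 0x387610), (2, 4, 0x485201),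
     (0, 2, 0x703862), (0, 2, 0x425816), (0, 2, 0x514820), (0, 2, 0x367801), (1, 4, 0x481625),
     (2, 4, 0x584102), (0, 2, 0x703861), (0, 2, 0x514826), (2, 4, 0x783016)],
    [(6, 24, 0x527348601), (20, 17, 0x417358602), (34, 17, 0x527348601), (65, 24, 0x765438210),
     (72, 17, 0x305478216), (113, 23, 0x217354608), (120, 25, 0x217054638),
     (129, 17, 0x765438210), (142, 23, 0x605473218), (156, 25, 0x605173248),
     (170, 25, 0x604273158), (177, 25, 0x213654078)]⟩,
  ⟨[14, 81, 97, 129, 2, 4, 134, 72], 0, 0x21cb9540,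
    [(0, 5, 0x862041), (1, 4, 0x481025), (0, 2, 0x714830), (2, 4, 0x785203), (2, 4, 0x384167),
     (1, 4, 0x783014), (2, 4, 0x487301), (0, 2, 0x425810), (2, 4, 0x584102), (2, 4, 0x385267),
     (9, 1, 0x7621083), (9, 1, 0x3021687), (10, 0, 0x75620138), (10, 0, 0x74610238),
     (10, 0, 0x35026178), (10, 0, 0x34016278), (15, 0, 0x542613708), (15, 0, 0x542017368)],
    [(1, 17, 0x765483210), (64, 17, 0x305487216), (65, 21, 0x654782130)]⟩,
  ⟨[14, 145, 161, 193, 2, 4, 8, 14], 0, 0x1dcb6540,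
    [(2, 3, 0x328410), (2, 3, 0x318527), (0, 2, 0x514820), (0, 2, 0x425817), (4, 5, 0x4832701),
     (4, 5, 0x5831702), (4, 5, 0x6821703), (0, 2, 0x436810), (1, 4, 0x481036), (0, 2, 0x614830),
     (0, 3, 0x438210), (0, 3, 0x538120), (0, 3, 0x628130), (8, 0, 0x730218), (9, 0, 0x6370218),
     (9, 0, 0x5270318), (9, 0, 0x4170328), (16, 0, 0x654321708)],
    [(1, 18, 0x765483210), (128, 18, 0x65483217), (129, 20, 0x765483210)]⟩,
  ⟨[14, 49, 81, 97, 134, 138, 140, 112], 10, 0x67524310,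
    [(2, 4, 0x387410), (2, 4, 0x586201), (2, 4, 0x685102), (2, 4, 0x783014), (0, 2, 0x614830),
     (0, 2, 0x702851), (0, 5, 0x824130), (0, 5, 0x842051), (2, 4, 0x281536), (2, 4, 0x480357),
     (12, 0, 0x36521408), (12, 0, 0x57340218), (17, 8, 0x863572410), (17, 8, 0x875364201),
     (17, 8, 0x876354102), (17, 8, 0x876245103)],
    []⟩]

/-- The connected triangle-free graphs on 9 vertices without obstructions. -/
def level9 : List Entry := [
  ⟨[62, 65, 129, 257, 1, 1, 2, 4, 8], 0, 0xdcb876540,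
    [(2, 3, 0x329610), (1, 4, 0x691027), (2, 4, 0x697201), (2, 4, 0x796102), (2, 4, 0x698301),
     (2, 4, 0x897203), (19, 1, 0x5432190), (1, 0, 0x863029), (1, 4, 0x691038), (2, 3, 0x549610),
     (1, 0, 0x480279), (0, 3, 0x659410), (1, 0, 0x470169), (1, 0, 0x570169), (1, 0, 0x480169),
     (1, 0, 0x580169), (1, 0, 0x580279), (2, 2, 0x547910), (2, 2, 0x548910)],
    [(14, 0, 0x9876543210), (16, 1, 0x9876543210), (30, 2, 0x9876543210), (32, 1, 0x9876453210),
     (46, 2, 0x9876453210), (62, 3, 0x9876543210), (92, 4, 0x9876543210), (108, 4, 0x9876453210),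
     (124, 5, 0x9876543210), (154, 4, 0x9867543120), (170, 4, 0x9867453120),
     (186, 5, 0x9867543120), (248, 6, 0x9876543210), (278, 4, 0x9768542130),
     (294, 4, 0x9768452130), (310, 5, 0x9768542130), (372, 6, 0x9786542310),
     (434, 6, 0x9687541320)]⟩,
  ⟨[62, 321, 385, 257, 1, 1, 2, 4, 14], 0, 0x1cba96540,
    [(0, 5, 0x928140), (2, 3, 0x329610), (1, 4, 0x691027), (2, 4, 0x697201), (2, 4, 0x796102),
     (19, 1, 0x5432190), (0, 1, 0x783091), (0, 1, 0x683092), (0, 1, 0x682093), (8, 0, 0x830219),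
     (9, 0, 0x7280319), (9, 0, 0x6180329), (0, 5, 0x928150), (0, 3, 0x659410), (0, 3, 0x859430),
     (2, 3, 0x549810), (3, 2, 0x5436910)],
    [(8, 0, 0x8976543210), (22, 7, 0x9876543210), (38, 7, 0x9876453210), (272, 4, 0x8769532140),
     (288, 4, 0x8769432150)]⟩,
  ⟨[62, 321, 385, 257, 257, 1, 2, 4, 30], 0, 0x1cb976540,
    [(0, 5, 0x928150), (2, 3, 0x529610), (2, 4, 0x697201), (2, 4, 0x796102), (19, 1, 0x5432190),
     (0, 5, 0x983072), (0, 1, 0x683092), (1, 4, 0x691027), (8, 0, 0x830219), (9, 0, 0x7280319),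
     (9, 0, 0x6180329), (0, 1, 0x630298), (4, 5, 0x6943801), (8, 0, 0x840219), (0, 3, 0x649310)],
    [(8, 2, 0x8976543210), (16, 2, 0x8976534210), (256, 8, 0x9876543210), (288, 5, 0x8769432150)]⟩,
  ⟨[62, 321, 385, 257, 257, 257, 2, 4, 62], 0, 0x1cb876540,
    [(0, 5, 0x982061), (1, 4, 0x691027), (2, 4, 0x697201), (2, 4, 0x796102), (19, 1, 0x5432190),
     (0, 1, 0x783091), (0, 1, 0x683092), (8, 0, 0x830219), (9, 0, 0x7280319), (9, 0, 0x6180329),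
     (19, 1, 0x5432198), (0, 3, 0x649310), (4, 5, 0x6943801), (8, 0, 0x840219), (0, 3, 0x659310),
     (0, 3, 0x659410)],
    [(8, 3, 0x8976543210), (16, 3, 0x8976534210), (32, 3, 0x8976435210)]⟩,
  ⟨[62, 65, 385, 257, 257, 1, 258, 4, 92], 0, 0x1b2a65490,
    [(1, 4, 0x698205), (2, 4, 0x895016), (0, 2, 0x605982), (2, 3, 0x439720), (2, 4, 0x697201),
     (19, 1, 0x5432190), (1, 0, 0x762059), (2, 4, 0x796102), (0, 1, 0x784093), (0, 1, 0x783094),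
     (9, 0, 0x7280439), (4, 5, 0x7943802), (8, 0, 0x840329), (0, 3, 0x649310), (1, 4, 0x590168),
     (9, 1, 0x6832091), (9, 1, 0x6842091), (9, 1, 0x1032896), (9, 1, 0x1042896)],
    [(8, 4, 0x8976543210), (16, 4, 0x8976534210), (288, 6, 0x8796432510)]⟩,
  ⟨[62, 65, 385, 257, 257, 257, 258, 4, 124], 0, 0x1b2765490,
    [(0, 5, 0x983072), (2, 4, 0x697201), (2, 4, 0x197286), (2, 4, 0x796102), (0, 1, 0x784093),
     (8, 0, 0x850439), (19, 1, 0x5432190), (4, 5, 0x7943802), (0, 1, 0x785093),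
     (9, 1, 0x6832091), (9, 1, 0x1032896), (19, 1, 0x6543298), (4, 5, 0x7953802),
     (8, 0, 0x850429), (0, 3, 0x649310), (0, 3, 0x659310), (0, 3, 0x659410)],
    [(8, 5, 0x8976543210), (16, 5, 0x8976534210), (32, 5, 0x8976435210)]⟩,
  ⟨[62, 65, 129, 257, 257, 257, 258, 260, 248], 0, 0x132654a90,
    [(2, 4, 0x97861), (2, 4, 0x892016), (2, 4, 0x796102), (2, 4, 0x291687), (10, 2, 0x26783901),
     (10, 2, 0x17683902), (19, 1, 0x5432190), (3, 2, 0x4326910), (0, 3, 0x649310),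
     (0, 5, 0x948320), (7, 5, 0x76954038), (10, 2, 0x26784901), (10, 2, 0x17684902),
     (0, 3, 0x659310), (0, 3, 0x659410)],
    [(8, 6, 0x8976543210), (16, 6, 0x8976534210), (32, 6, 0x8976435210)]⟩,
  ⟨[62, 449, 385, 129, 257, 1, 2, 14, 22], 11, 0x428765310,
    [(2, 3, 0x879501), (2, 3, 0x329610), (2, 4, 0x798403), (19, 1, 0x5432190), (2, 4, 0x897304),
     (9, 6, 0x9821703), (0, 1, 0x582791), (0, 1, 0x528197), (0, 3, 0x649310), (0, 5, 0x973081),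
     (2, 3, 0x549710), (3, 2, 0x5436910), (8, 0, 0x730219), (0, 1, 0x673092), (0, 1, 0x672093),
     (9, 0, 0x6170329), (9, 0, 0x5021879), (9, 6, 0x9721804), (12, 2, 0x28743901),
     (16, 3, 0x435879210)],
    [(4, 7, 0x8796543210)]⟩,
  ⟨[62, 193, 129, 129, 129, 1, 2, 286, 128], 0, 0x31b976540,
    [(0, 5, 0x927150), (1, 4, 0x590178), (0, 2, 0x805972), (0, 2, 0x578901), (0, 5, 0x973061),
     (4, 5, 0x6932701), (8, 0, 0x740329), (19, 1, 0x5432190), (19, 1, 0x8432197),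
     (0, 1, 0x674093), (0, 3, 0x659210), (4, 5, 0x6942701), (8, 0, 0x740319), (4, 5, 0x6943701),
     (8, 0, 0x730219), (8, 0, 0x740219), (0, 1, 0x672093), (0, 3, 0x639210), (0, 3, 0x649210),
     (0, 3, 0x649310)],
    [(4, 8, 0x8796543210), (8, 8, 0x8796542310), (16, 8, 0x8796532410)]⟩,
  ⟨[62, 193, 321, 385, 1, 1, 6, 10, 12], 6, 0x872654310,
    [(0, 5, 0x926140), (2, 4, 0x293716), (2, 3, 0x429710), (2, 4, 0x798201), (2, 4, 0x897102),
     (19, 1, 0x5432190), (0, 2, 0x362971), (0, 5, 0x926150), (3, 4, 0x8795403), (0, 2, 0x817926),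
     (2, 3, 0x519820), (4, 1, 0x7654091), (15, 2, 0x863714902), (15, 2, 0x872614903),
     (2, 2, 0x548910), (2, 2, 0x547920), (14, 1, 0x487630291), (14, 1, 0x587630291),
     (15, 2, 0x763824901), (15, 2, 0x763825901), (15, 2, 0x863715902), (15, 2, 0x872615903),
     (17, 0, 0x438207169)],
    []⟩,
  ⟨[62, 449, 65, 129, 257, 1, 6, 10, 18], 5, 0x872654310,
    [(2, 3, 0x769501), (2, 3, 0x439610), (2, 4, 0x698402), (2, 4, 0x896204), (19, 1, 0x5432190),
     (2, 4, 0x798403), (2, 4, 0x897304), (0, 5, 0x962071), (2, 3, 0x529810), (2, 2, 0x538920),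
     (15, 5, 0x327968410), (15, 5, 0x874932601), (15, 5, 0x864923701), (16, 1, 0x876432091),
     (0, 3, 0x839210), (3, 2, 0x5436910), (15, 5, 0x438976210), (15, 5, 0x428967310),
     (15, 5, 0x763924801)],
    [(34, 9, 0x9876543210)]⟩,
  ⟨[62, 449, 321, 385, 257, 1, 6, 10, 30], 2, 0x376825401,
    [(0, 5, 0x928150), (2, 4, 0x697302), (19, 1, 0x5432190), (2, 3, 0x439610), (2, 4, 0x796203),
     (0, 1, 0x581692), (0, 5, 0x962071), (8, 0, 0x830219), (9, 6, 0x9621804), (0, 1, 0x582691),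
     (2, 3, 0x769401), (9, 6, 0x9731802), (0, 1, 0x684093), (0, 1, 0x526198), (3, 2, 0x5436910),
     (14, 5, 0x476918302), (16, 6, 0x769324801)],
    [(256, 10, 0x9876543210)]⟩,
  ⟨[62, 193, 65, 385, 257, 1, 262, 10, 88], 4, 0x872654310,
    [(1, 4, 0x896105), (2, 4, 0x697302), (2, 4, 0x897104), (0, 2, 0x805961), (2, 4, 0x392617),
     (3, 4, 0x2194386), (3, 4, 0x7695401), (2, 4, 0x491738), (3, 4, 0x8795203), (2, 2, 0x547920),
     (10, 0, 0x27038469), (2, 4, 0x598610), (9, 1, 0x6843091), (10, 0, 0x67830429),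
     (10, 0, 0x47016289), (15, 4, 0x256897310), (15, 4, 0x458697130), (15, 7, 0x793842601),
     (15, 7, 0x791624803)],
    []⟩,
  ⟨[62, 193, 65, 129, 257, 257, 262, 266, 240], 3, 0x287316450,
    [(2, 4, 0x97862), (2, 4, 0x796203), (2, 4, 0x893016), (2, 4, 0x392617), (2, 4, 0x693048),
     (19, 1, 0x5432190), (0, 3, 0x659410), (3, 4, 0x7695401), (10, 2, 0x27684903),
     (10, 6, 0x49871602), (10, 6, 0x49861703), (15, 3, 0x327869410), (0, 5, 0x926140),
     (0, 5, 0x926150), (10, 2, 0x36784902), (15, 3, 0x327869510), (17, 1, 0x417306298)],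
    []⟩,
  ⟨[62, 193, 193, 129, 129, 1, 6, 286, 128], 2, 0x936852401,
    [(0, 5, 0x927150), (1, 4, 0x590178), (0, 1, 0x862091), (0, 1, 0x571692), (0, 2, 0x805971),
     (8, 0, 0x730219), (19, 1, 0x5432190), (4, 3, 0x5369210), (19, 1, 0x8432197),
     (0, 3, 0x649310), (0, 5, 0x973061), (4, 5, 0x6943701), (9, 6, 0x9621703), (0, 3, 0x649320),
     (0, 5, 0x926130), (0, 5, 0x926140), (3, 2, 0x5436920), (8, 0, 0x740219)],
    [(10, 10, 0x8796543210), (12, 10, 0x8796543120), (18, 10, 0x8796534210),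
     (20, 10, 0x8796534120)]⟩,
  ⟨[30, 417, 449, 257, 1, 2, 4, 6, 14], 2, 0x429876310,
    [(0, 5, 0x928140), (2, 3, 0x329510), (1, 4, 0x591026), (0, 1, 0x638190), (0, 1, 0x482791),
     (0, 1, 0x481792), (0, 1, 0x582093), (0, 2, 0x615920), (3, 4, 0x4397510), (3, 4, 0x7594301),
     (8, 0, 0x281709), (2, 3, 0x439710), (2, 3, 0x759301), (3, 2, 0x4316920), (8, 0, 0x830219),
     (0, 1, 0x427198), (0, 3, 0x639120), (9, 0, 0x6280319), (9, 0, 0x5180329), (9, 0, 0x4021879),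
     (9, 6, 0x9721803), (14, 0, 0x376528109)],
    [(22, 10, 0x6243579801), (129, 7, 0x7865493210), (256, 11, 0x9876543210)]⟩,
  ⟨[30, 161, 449, 257, 1, 258, 4, 6, 44], 9, 0x267853140,
    [(1, 4, 0x598204), (2, 3, 0x319620), (2, 4, 0x897103), (2, 4, 0x196285), (3, 4, 0x7594301),
     (0, 2, 0x526910), (3, 4, 0x5397628), (0, 2, 0x504982), (2, 4, 0x193827), (0, 3, 0x479602),
     (3, 2, 0x4316920), (0, 3, 0x639120), (0, 3, 0x489702), (2, 4, 0x498510), (9, 1, 0x5832091),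
     (9, 1, 0x5170298), (10, 0, 0x56820319), (10, 0, 0x16028359), (10, 0, 0x54102789),
     (10, 6, 0x59172083), (15, 4, 0x348597120), (15, 4, 0x761593802), (18, 0, 0x5736824019)],
    []⟩,
  ⟨[30, 161, 193, 257, 1, 2, 4, 262, 136], 0, 0x21cba9540,
    [(0, 5, 0x927140), (2, 3, 0x429510), (2, 4, 0x895103), (2, 4, 0x794038), (0, 2, 0x804971),
     (0, 2, 0x326987), (2, 4, 0x698302), (1, 4, 0x398726), (3, 4, 0x4397620), (0, 2, 0x615927),
     (2, 4, 0x596201), (2, 4, 0x395178), (10, 0, 0x85710239), (1, 4, 0x490387),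
     (9, 1, 0x8721093), (9, 1, 0x3021798), (10, 0, 0x86720139), (10, 0, 0x36027189),
     (10, 0, 0x35017289), (15, 0, 0x652713809), (15, 0, 0x652018379)],
    [(129, 4, 0x7658492130), (144, 12, 0x9876543210)]⟩,
  ⟨[30, 289, 321, 385, 1, 2, 4, 8, 14], 0, 0x1dcb96540,
    [(2, 3, 0x329510), (1, 4, 0x591026), (4, 5, 0x5932801), (4, 5, 0x6931802), (2, 3, 0x219738),
     (2, 4, 0x796203), (0, 2, 0x715930), (0, 2, 0x537918), (0, 1, 0x681093), (0, 2, 0x526910),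
     (0, 3, 0x539210), (0, 3, 0x729130), (8, 0, 0x830219), (9, 0, 0x7380219), (9, 0, 0x6280319),
     (9, 0, 0x5180329), (0, 2, 0x615920), (0, 5, 0x928140), (16, 0, 0x765321809)],
    [(1, 0, 0x8765943210), (256, 13, 0x9876543210), (257, 2, 0x8765493210),
     (272, 14, 0x9876543210)]⟩,
  ⟨[30, 33, 65, 129, 257, 2, 4, 8, 16], 0, 0xedcb76540,
    [(2, 3, 0x329510), (1, 4, 0x591026), (2, 4, 0x596201), (2, 4, 0x695102), (2, 4, 0x597301),
     (2, 4, 0x796203), (2, 4, 0x698402), (0, 2, 0x526910), (0, 2, 0x615920), (2, 3, 0x429730),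
     (2, 3, 0x319840), (0, 2, 0x537910), (0, 2, 0x715930), (1, 0, 0x864039), (2, 4, 0x895104),
     (0, 2, 0x548910), (0, 2, 0x815940), (0, 3, 0x749230), (1, 0, 0x460159)],
    [(1, 1, 0x8765943210), (30, 15, 0x9876543210), (60, 14, 0x5987614320),
     (90, 14, 0x6987524310), (120, 12, 0x6598721430), (150, 14, 0x7986534210),
     (180, 12, 0x7598631420), (210, 12, 0x7698532410), (270, 14, 0x8976543210),
     (300, 12, 0x8597641320), (330, 12, 0x8697542310), (390, 12, 0x8796543210),
     (481, 9, 0x8765432190)]⟩,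
  ⟨[30, 289, 321, 385, 257, 2, 4, 8, 30], 0, 0x1dcb76540,
    [(0, 5, 0x982051), (0, 5, 0x983062), (4, 5, 0x6931802), (1, 4, 0x692037), (2, 4, 0x795103),
     (0, 1, 0x728190), (0, 1, 0x630198), (0, 2, 0x715930), (2, 4, 0x596201), (5, 1, 0x42173890),
     (8, 0, 0x840219), (0, 2, 0x526910), (4, 5, 0x5943801), (9, 0, 0x6280319), (9, 0, 0x5180329),
     (0, 1, 0x530298), (8, 0, 0x830219)],
    [(1, 2, 0x8765943210), (16, 15, 0x8976543210), (256, 2, 0x765943218), (257, 3, 0x8765943210)]⟩,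
  ⟨[30, 33, 321, 385, 257, 258, 4, 8, 60], 0, 0x1cb265490,
    [(0, 5, 0x983062), (1, 4, 0x692037), (2, 4, 0x597301), (2, 4, 0x695102), (2, 4, 0x796203),
     (2, 4, 0x197385), (0, 1, 0x748290), (0, 2, 0x126958), (0, 1, 0x684093), (9, 0, 0x6280439),
     (0, 1, 0x784092), (8, 0, 0x840329), (9, 0, 0x7380429), (0, 1, 0x648390), (0, 1, 0x740298),
     (0, 2, 0x537910), (9, 1, 0x5832091), (9, 1, 0x1032895)],
    [(1, 4, 0x8765943210), (16, 14, 0x5897614320), (256, 4, 0x761943258), (257, 5, 0x8765943210)]⟩,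
  ⟨[30, 33, 65, 385, 257, 258, 260, 8, 120], 0, 0x1b3254a90,
    [(2, 4, 0x96851), (2, 4, 0x892015), (1, 4, 0x591037), (2, 4, 0x697302), (2, 4, 0x795103),
     (2, 4, 0x297386), (2, 4, 0x198620), (2, 4, 0x592038), (0, 2, 0x537910), (0, 5, 0x984073),
     (10, 2, 0x25683901), (10, 2, 0x16583902), (10, 0, 0x57830419), (10, 0, 0x67830429),
     (15, 1, 0x216857390), (15, 1, 0x652017398)],
    [(16, 12, 0x6589721430), (257, 6, 0x8765943210)]⟩,
  ⟨[30, 417, 449, 129, 257, 2, 4, 14, 22], 2, 0x549876310,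
    [(0, 5, 0x972051), (1, 4, 0x591026), (2, 4, 0x394817), (2, 4, 0x798403), (2, 4, 0x897304),
     (2, 4, 0x493718), (0, 1, 0x530297), (8, 0, 0x281709), (0, 1, 0x637190), (0, 3, 0x549310),
     (2, 4, 0x596201), (3, 2, 0x4316920), (0, 1, 0x537290), (0, 1, 0x673091), (8, 0, 0x730219),
     (9, 0, 0x6270319), (9, 0, 0x5170329), (9, 6, 0x9821703), (9, 6, 0x9721804)],
    [(1, 7, 0x8765943210), (6, 10, 0x6243598701), (384, 16, 0x9876543210)]⟩,
  ⟨[30, 161, 193, 129, 1, 2, 4, 270, 128], 0, 0x31cb96540,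
    [(0, 5, 0x927140), (1, 4, 0x490178), (2, 4, 0x596201), (0, 2, 0x804972), (0, 5, 0x973062),
     (2, 3, 0x329510), (0, 1, 0x637190), (2, 4, 0x695102), (9, 0, 0x6270319), (0, 2, 0x615920),
     (0, 2, 0x526917), (8, 0, 0x730219), (0, 1, 0x573092), (0, 1, 0x671093), (9, 0, 0x5170329),
     (0, 1, 0x572093), (0, 2, 0x478901), (2, 4, 0x498710), (2, 4, 0x894017)],
    [(6, 11, 0x8796543210), (8, 13, 0x8796543210), (129, 8, 0x8765493210), (144, 4, 0x654832197),
     (225, 10, 0x8765432190), (257, 4, 0x7658432190), (278, 16, 0x8976543210)]⟩,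
  ⟨[30, 33, 449, 129, 257, 386, 4, 44, 52], 8, 0x315286074,
    [(2, 4, 0x98573), (2, 3, 0x439620), (2, 4, 0x897304), (2, 4, 0x596201), (2, 4, 0x794015),
     (0, 2, 0x526910), (3, 4, 0x4197620), (1, 4, 0x591026), (1, 4, 0x490157),
     (17, 1, 0x128407395), (0, 2, 0x837940), (0, 5, 0x973082), (2, 4, 0x695102),
     (9, 1, 0x1587290), (9, 1, 0x1032795), (10, 0, 0x56720319), (10, 0, 0x56820419),
     (10, 6, 0x19582703), (10, 6, 0x19572804), (15, 2, 0x438576920), (15, 3, 0x438579120)],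
    []⟩,
  ⟨[30, 289, 193, 129, 257, 130, 260, 300, 210], 7, 0x54638712,
    [(2, 4, 0x96873), (2, 4, 0x893026), (2, 4, 0x794015), (2, 4, 0x95784), (3, 4, 0x3298510),
     (2, 4, 0x596201), (2, 4, 0x695102), (2, 4, 0x196275), (3, 2, 0x5324987),
     (10, 6, 0x19862703), (0, 5, 0x940178), (10, 0, 0x36781509), (10, 0, 0x56720319),
     (10, 0, 0x65810429), (15, 7, 0x591046287), (15, 7, 0x692035178), (18, 3, 0x4365879201)],
    []⟩,
  ⟨[30, 225, 193, 65, 129, 2, 270, 278, 192], 12, 0x842765310,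
    [(2, 4, 0x697403), (2, 4, 0x796304), (2, 3, 0x439510), (0, 2, 0x804963), (1, 4, 0x490368),
     (2, 4, 0x498610), (2, 4, 0x394716), (12, 0, 0x78460329), (0, 1, 0x562093), (2, 4, 0x893017),
     (8, 0, 0x271609), (9, 6, 0x9876210), (9, 6, 0x9621704), (0, 3, 0x549310), (3, 2, 0x4325910),
     (9, 6, 0x9721603), (12, 0, 0x78460319), (14, 8, 0x984372610)],
    [(4, 16, 0x8769543210)]⟩]

/-- The connected triangle-free graphs on 10 vertices without obstructions. -/
def level10 : List Entry := [
  ⟨[62, 577, 641, 769, 1, 1, 2, 4, 8, 14], 0, 0x1dcba96540,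
    [(2, 3, 0x32a610), (1, 4, 0x6a1027), (4, 5, 0x6a32901), (4, 5, 0x7a31902),
     (19, 1, 0x54321a0), (2, 4, 0x8a7203), (1, 4, 0x6a1038), (3, 4, 0x97a5402),
     (4, 1, 0x97540a2), (0, 1, 0x7910a3), (9, 0, 0x729031a), (2, 3, 0x96a401), (0, 3, 0x82a130),
     (2, 3, 0x96a501), (8, 0, 0x93021a), (9, 0, 0x839021a), (9, 0, 0x619032a), (0, 3, 0x65a410),
     (2, 3, 0x54a910)],
    [(528, 0, 0xa9876543210), (544, 0, 0xa9876453210)]⟩,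
  ⟨[62, 65, 129, 257, 513, 1, 2, 4, 8, 16], 0, 0xedcb876540,
    [(2, 3, 0x32a610), (1, 4, 0x6a1027), (2, 4, 0x6a7201), (2, 4, 0x7a6102), (19, 1, 0x54321a0),
     (2, 4, 0x6a8301), (2, 4, 0x8a7203), (2, 4, 0x7a9402), (2, 3, 0x42a830), (2, 3, 0x31a940),
     (1, 0, 0x97403a), (2, 4, 0x9a6104), (0, 3, 0x84a230), (1, 0, 0x47016a), (1, 0, 0x57016a),
     (1, 0, 0x58016a), (1, 0, 0x59016a), (1, 0, 0x58027a), (1, 0, 0x59027a), (1, 0, 0x59038a)],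
    [(30, 1, 0xa9876543210), (32, 2, 0xa9876543210), (62, 3, 0xa9876543210),
     (92, 0, 0x6a987514320), (124, 4, 0xa9876543210), (154, 0, 0x7a986524310),
     (186, 4, 0xa9867543120), (248, 5, 0xa9876543210), (278, 0, 0x8a976534210),
     (310, 4, 0xa9768542130), (372, 5, 0xa9786542310), (434, 5, 0xa9687541320),
     (526, 0, 0x9a876543210), (558, 4, 0xa8769532140), (620, 5, 0xa8796532410),
     (682, 5, 0xa8697531420), (806, 5, 0xa7698521430)]⟩,
  ⟨[62, 577, 641, 769, 513, 1, 2, 4, 8, 30], 0, 0x1dcb976540,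
    [(0, 5, 0xa29150), (0, 5, 0xa93061), (4, 5, 0x6a32901), (19, 1, 0x54321a0), (1, 4, 0x6a1038),
     (2, 3, 0x42a610), (2, 4, 0x7a6102), (2, 4, 0x8a7203), (1, 4, 0x6a1027), (8, 0, 0x94021a),
     (4, 5, 0x6a43901), (9, 0, 0x729031a), (9, 0, 0x619032a), (8, 0, 0x93021a), (0, 1, 0x7910a3)],
    [(16, 1, 0x9a876543210), (512, 6, 0xa9876543210), (544, 4, 0x9876a432150)]⟩,
  ⟨[62, 577, 641, 769, 513, 513, 2, 4, 8, 62], 0, 0x1dcb876540,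
    [(0, 5, 0xa92061), (0, 5, 0xa93072), (4, 5, 0x7a31902), (19, 1, 0x54321a0), (2, 4, 0x6a7201),
     (2, 4, 0x8a6103), (2, 3, 0x21a830), (8, 0, 0x94021a), (4, 5, 0x6a43901), (9, 0, 0x729031a),
     (9, 0, 0x619032a), (19, 1, 0x54321a9), (8, 0, 0x93021a), (0, 3, 0x65a410)],
    [(16, 3, 0x9a876543210), (32, 3, 0x9a876453210)]⟩,
  ⟨[62, 65, 641, 769, 513, 1, 514, 4, 8, 92], 0, 0x1cb2a65490,
    [(0, 5, 0xa39250), (2, 4, 0x9a5016), (0, 2, 0x605a92), (1, 4, 0x6a1027), (2, 4, 0x6a7201),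
     (19, 1, 0x54321a0), (1, 4, 0x6a1038), (2, 2, 0x437a10), (2, 4, 0x7a8302), (2, 4, 0x8a6103),
     (4, 5, 0x8a42903), (10, 0, 0x6792041a), (9, 1, 0x10439a6), (0, 1, 0x8940a2),
     (9, 0, 0x839042a), (9, 1, 0x69320a1), (1, 4, 0x5a0169), (9, 1, 0x10329a6)],
    [(16, 0, 0x69a87514320), (544, 5, 0x987a6432510)]⟩,
  ⟨[62, 65, 641, 769, 513, 513, 514, 4, 8, 124], 0, 0x1cb2765490,
    [(0, 5, 0xa93072), (1, 4, 0x7a2038), (2, 4, 0x7a6102), (2, 4, 0x8a7203), (19, 1, 0x54321a0),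
     (2, 4, 0x6a8301), (1, 4, 0x8a3016), (0, 1, 0x7940a3), (9, 0, 0x729043a), (0, 1, 0x8940a2),
     (8, 0, 0x94032a), (9, 0, 0x839042a), (19, 1, 0x65432a9), (4, 5, 0x7a54902),
     (8, 0, 0x95032a), (0, 3, 0x65a410)],
    [(16, 4, 0x9a876543210), (32, 4, 0x9a876453210)]⟩,
  ⟨[62, 65, 129, 769, 513, 513, 514, 516, 8, 248], 0, 0x1b32654a90,
    [(2, 4, 0xa7961), (2, 4, 0x9a2016), (1, 4, 0x6a1038), (2, 4, 0x8a6103), (2, 4, 0x7a8302),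
     (2, 4, 0x2a8397), (19, 1, 0x54321a0), (0, 5, 0xa94083), (7, 5, 0x76a54039),
     (10, 2, 0x26793a01), (10, 2, 0x17693a02), (0, 1, 0x8950a4), (9, 0, 0x839054a),
     (0, 3, 0x65a410)],
    [(16, 5, 0x9a876543210), (32, 5, 0x9a876453210)]⟩,
  ⟨[62, 833, 897, 257, 513, 1, 2, 4, 14, 22], 11, 0x4298765310,
    [(0, 5, 0xa28150), (2, 3, 0x32a610), (19, 1, 0x54321a0), (2, 4, 0x8a9403), (2, 4, 0x9a8304),
     (1, 4, 0x6a1027), (0, 1, 0x5928a1), (0, 1, 0x5918a2), (0, 1, 0x6820a3), (3, 2, 0x5436a10),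
     (0, 1, 0x5291a8), (0, 3, 0x64a310), (2, 3, 0x54a810), (3, 2, 0x4317a20), (8, 0, 0x83021a),
     (12, 2, 0x29843a01), (0, 5, 0xa83091), (9, 0, 0x618032a), (9, 0, 0x502198a),
     (9, 6, 0xa921803), (9, 6, 0xa821904), (16, 3, 0x43598a210)],
    []⟩,
  ⟨[62, 321, 385, 257, 257, 1, 2, 4, 542, 256], 0, 0x31cb976540,
    [(0, 5, 0xa28150), (1, 4, 0x5a0189), (2, 4, 0x6a7201), (0, 2, 0x905a82), (0, 5, 0xa83072),
     (19, 1, 0x54321a0), (2, 3, 0x52a610), (2, 4, 0x7a6102), (9, 0, 0x728031a), (8, 0, 0x83021a),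
     (19, 1, 0x94321a8), (4, 5, 0x7a43802), (9, 0, 0x618032a), (8, 0, 0x84021a),
     (0, 1, 0x6830a2), (0, 1, 0x7810a3), (0, 3, 0x64a310)],
    [(8, 6, 0x98a76543210), (16, 6, 0x98a76534210)]⟩,
  ⟨[62, 961, 65, 129, 257, 513, 6, 10, 18, 34], 5, 0x9872654310,
    [(19, 1, 0x54321a0), (19, 1, 0x98760a1), (2, 3, 0x43a610), (2, 3, 0x87a201),
     (0, 5, 0xa26130), (0, 5, 0xa62071), (0, 5, 0xa37140), (0, 5, 0xa73081), (0, 5, 0xa59120),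
     (0, 5, 0xa95061), (0, 5, 0xa48150), (0, 5, 0xa84091), (15, 5, 0x438a76210),
     (15, 5, 0x428a67310), (15, 5, 0x327a68410), (15, 5, 0x874a32601), (15, 5, 0x864a23701),
     (15, 5, 0x763a24801)],
    []⟩,
  ⟨[62, 449, 321, 385, 257, 1, 6, 10, 542, 256], 2, 0x9376825401,
    [(0, 5, 0xa28150), (1, 4, 0x5a0189), (2, 4, 0x6a7302), (19, 1, 0x54321a0), (2, 4, 0x7a6203),
     (0, 1, 0x5816a2), (8, 0, 0x83021a), (19, 1, 0x94321a8), (0, 1, 0x9620a1), (0, 5, 0xa83061),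
     (0, 1, 0x5826a1), (0, 5, 0xa26140), (0, 5, 0xa84071), (9, 6, 0xa621803), (0, 3, 0x74a210),
     (3, 2, 0x5436a10), (9, 0, 0x718042a), (14, 5, 0x476a18302), (16, 6, 0x76a324801)],
    []⟩,
  ⟨[30, 417, 449, 257, 1, 2, 4, 6, 526, 256], 13, 0x8249765310,
    [(0, 5, 0xa28140), (1, 4, 0x4a0189), (2, 3, 0x32a510), (2, 3, 0x31a628), (0, 1, 0x9720a1),
     (0, 1, 0x4817a2), (0, 2, 0x615a20), (0, 2, 0x904a81), (0, 2, 0x526a18), (0, 1, 0x6810a3),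
     (3, 4, 0x75a4301), (2, 3, 0x76a302), (3, 4, 0x43a7510), (8, 0, 0x83021a), (2, 3, 0x43a710),
     (2, 4, 0x6a5102), (3, 2, 0x7509a81), (8, 0, 0x28170a), (9, 6, 0xa721803), (0, 1, 0x5830a2),
     (0, 3, 0x97a081), (9, 0, 0x982170a), (9, 0, 0x628031a), (9, 0, 0x518032a),
     (9, 0, 0x402187a), (14, 0, 0x37652810a), (14, 0, 0x73948201a)],
    []⟩,
  ⟨[30, 161, 193, 257, 513, 2, 4, 774, 136, 144], 0, 0x321cba9540,
    [(0, 5, 0xa72051), (2, 4, 0xa9783), (2, 4, 0x7a4038), (2, 4, 0x9a8304), (2, 4, 0x4a3879),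
     (2, 4, 0x3a9710), (2, 4, 0x8a4017), (2, 4, 0x8a5103), (2, 4, 0x3a5178), (2, 4, 0x5a6201),
     (2, 4, 0x6a8302), (0, 2, 0x615a20), (0, 2, 0x826a30), (1, 4, 0x8a3026), (10, 2, 0x48971a03),
     (10, 2, 0x39871a04), (15, 1, 0x9840351a7), (10, 0, 0x8571023a), (10, 0, 0x9571024a),
     (15, 0, 0x65271380a)],
    [(129, 5, 0x76598a21430)]⟩,
  ⟨[30, 289, 321, 385, 1, 2, 4, 8, 526, 256], 0, 0x31dcb96540,
    [(0, 5, 0xa28140), (1, 4, 0x4a0189), (4, 5, 0x5a32801), (2, 3, 0x32a510), (4, 5, 0x6a31802),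
     (2, 3, 0x31a628), (0, 2, 0x615a20), (0, 2, 0x526a18), (2, 4, 0x7a6203), (0, 2, 0x904a82),
     (0, 2, 0x489a01), (0, 2, 0x537a10), (1, 4, 0x5a1037), (2, 4, 0x7a5103), (9, 0, 0x628031a),
     (0, 3, 0x72a130), (8, 0, 0x83021a), (9, 0, 0x738021a), (9, 0, 0x518032a), (0, 1, 0x6810a3),
     (0, 2, 0x715a30), (2, 4, 0x4a9810), (2, 4, 0x9a4018), (16, 0, 0x76532180a)],
    [(257, 6, 0x987654a3210), (272, 0, 0x407659a3218), (513, 0, 0x987654a3210)]⟩,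
  ⟨[30, 289, 321, 385, 513, 2, 4, 8, 526, 272], 0, 0x21dcb96540,
    [(2, 3, 0x32a510), (2, 3, 0x31a628), (4, 5, 0x5a32801), (4, 5, 0x6a31802), (4, 5, 0x7a21803),
     (1, 4, 0x5a1037), (0, 2, 0x615a20), (0, 2, 0x426a98), (2, 4, 0x5a9401), (2, 4, 0x9a5104),
     (2, 4, 0x4a5189), (9, 0, 0x518032a), (9, 1, 0x98210a4), (9, 1, 0x40218a9), (0, 2, 0x537a10),
     (0, 3, 0x63a120), (9, 0, 0x628031a), (0, 3, 0x53a210)],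
    [(1, 0, 0x98765a43210), (256, 0, 0x40765a93218), (257, 4, 0x87659a32140)]⟩,
  ⟨[30, 545, 577, 641, 769, 2, 4, 8, 16, 30], 0, 0x1edcb76540,
    [(2, 3, 0x32a510), (2, 3, 0x41a629), (0, 5, 0xa94073), (1, 4, 0x6a2948), (2, 4, 0x6a7302),
     (0, 2, 0x526a19), (2, 4, 0x8a5104), (5, 1, 0x432519a0), (2, 4, 0x7a8403), (4, 5, 0x5a32901),
     (0, 2, 0x637a20), (0, 2, 0x548a19), (8, 0, 0x94031a), (9, 0, 0x849032a), (9, 0, 0x519043a),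
     (9, 0, 0x739042a), (0, 1, 0x5392a0), (0, 1, 0x8920a1), (0, 1, 0x7201a9)],
    [(1, 1, 0x98765a43210), (512, 1, 0x8765a43219), (513, 3, 0x98765a43210)]⟩,
  ⟨[30, 417, 449, 129, 257, 2, 4, 526, 534, 384], 12, 0x8429765310,
    [(0, 5, 0xa72051), (2, 4, 0x7a8403), (2, 4, 0x8a7304), (2, 3, 0x41a628), (0, 2, 0x904a73),
     (1, 4, 0x4a0379), (2, 4, 0x4a9710), (2, 4, 0x9a4017), (1, 4, 0x5a1026), (8, 0, 0x28170a),
     (0, 1, 0x5982a7), (12, 0, 0x8947031a), (0, 3, 0x54a310), (3, 2, 0x4325a10),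
     (3, 2, 0x4316a20), (9, 6, 0xa987210), (0, 2, 0x837a40), (0, 5, 0xa73081), (9, 0, 0x517032a),
     (9, 6, 0xa821703), (9, 6, 0xa721804), (14, 8, 0xa94382710)],
    []⟩]

/-- The connected triangle-free graphs on 11 vertices without obstructions. -/
def level11 : List Entry := [
  ⟨[62, 577, 641, 769, 1025, 1, 2, 4, 8, 1038, 528], 0, 0x21dcba96540,
    [(2, 3, 0x32b610), (1, 4, 0xab9105), (4, 5, 0x6b32901), (19, 1, 0x54321b0), (1, 4, 0x6b1027),
     (3, 4, 0x97b5402), (2, 4, 0x8b7203), (1, 4, 0x6b1038), (0, 2, 0xa05b91), (2, 4, 0x7b8302),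
     (0, 1, 0x7910b3), (2, 4, 0xab6104), (9, 0, 0x729031b), (0, 5, 0xb301a9), (9, 1, 0x40329ba),
     (9, 0, 0x839021b), (9, 1, 0xa9320b4), (0, 1, 0x8910b2), (1, 4, 0x5b04a9)],
    [(544, 0, 0xba9876543210)]⟩,
  ⟨[62, 1089, 1153, 1281, 1537, 1, 2, 4, 8, 16, 30], 0, 0x1edcb976540,
    [(2, 3, 0x32b610), (19, 1, 0x54321b0), (0, 5, 0xb4a150), (4, 5, 0x6b32a01), (1, 4, 0x6b1027),
     (4, 5, 0x7b31a02), (2, 4, 0x8b7203), (1, 4, 0x6b1038), (2, 4, 0x6b9401), (3, 2, 0x5418b30),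
     (8, 0, 0xa4021b), (9, 0, 0x94a021b), (2, 4, 0x9b6104), (9, 0, 0x72a031b), (9, 0, 0x61a043b),
     (1, 4, 0x6b1049)],
    [(1024, 1, 0xba9876543210), (1056, 2, 0xba9876543210)]⟩,
  ⟨[62, 65, 129, 257, 513, 1025, 2, 4, 8, 16, 32], 0, 0xfedcb876540,
    [(2, 3, 0x32b610), (19, 1, 0x54321b0), (2, 3, 0x54b720), (2, 4, 0x6b7201), (2, 4, 0x7b6102),
     (2, 4, 0x7b8302), (2, 4, 0x8b7203), (1, 4, 0x6b1027), (2, 3, 0x41b830), (2, 4, 0x7ba502),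
     (2, 4, 0xab9405), (3, 2, 0x5329b40), (2, 3, 0x32b940), (1, 4, 0x9b405a), (0, 3, 0x65b410),
     (0, 3, 0xa4b350), (0, 3, 0x84b130), (1, 0, 0x47016b), (1, 0, 0x57016b), (1, 0, 0x58016b),
     (1, 0, 0x59016b), (1, 0, 0x59038b)],
    [(62, 3, 0xba9876543210), (124, 2, 0x6ba987154320), (186, 2, 0x7ba986254310),
     (248, 0, 0x76ba98215430), (310, 2, 0x8ba976354210), (372, 0, 0x86ba97315420),
     (434, 0, 0x87ba96325410), (558, 2, 0x9ba876453210), (620, 0, 0x96ba87415320),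
     (682, 0, 0x97ba86425310), (806, 0, 0x98ba76435210), (1054, 2, 0xab9876543210),
     (1116, 0, 0xa6b987514320), (1178, 0, 0xa7b986524310), (1302, 0, 0xa8b976534210),
     (1550, 0, 0xa9b876543210)]⟩,
  ⟨[62, 1089, 1153, 1281, 1537, 1025, 2, 4, 8, 16, 62], 0, 0x1edcb876540,
    [(0, 5, 0xba2061), (19, 1, 0x54321b0), (0, 5, 0xba4083), (1, 4, 0x6b1027), (2, 4, 0x6b8301),
     (4, 5, 0x7b31a02), (2, 4, 0x8b6103), (19, 1, 0x54321ba), (8, 0, 0xa5031b),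
     (4, 5, 0x6b52a01), (4, 5, 0x9b32a04), (9, 0, 0x61a032b), (8, 0, 0xa3021b), (0, 5, 0xba1094),
     (8, 0, 0xa4021b)],
    [(32, 3, 0xab9876543210)]⟩,
  ⟨[62, 65, 1153, 1281, 1537, 1025, 1026, 4, 8, 16, 124], 0, 0x1dcb2765490,
    [(0, 5, 0xba3072), (0, 5, 0xba4083), (4, 5, 0x8b42a03), (19, 1, 0x54321b0), (2, 4, 0x7b8302),
     (2, 4, 0x9b7204), (19, 1, 0x65432ba), (8, 0, 0xa5032b), (0, 5, 0xba2094), (4, 5, 0x7b54a02),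
     (9, 0, 0x83a042b), (9, 0, 0x72a043b), (8, 0, 0xa4032b), (0, 5, 0xb3a210), (0, 5, 0xb3026a)],
    [(32, 2, 0x6ab987154320)]⟩,
  ⟨[62, 65, 129, 1281, 1537, 1025, 1026, 1028, 8, 16, 248], 0, 0x1cb32654a90,
    [(0, 5, 0xba4083), (2, 4, 0xb7a61), (2, 4, 0xab2016), (19, 1, 0x54321b0), (2, 4, 0x7b6102),
     (1, 4, 0x6b1027), (7, 5, 0x76b5403a), (10, 2, 0x267a5b01), (10, 2, 0x176a5b02),
     (0, 5, 0xba5094), (2, 4, 0x9b6104), (2, 4, 0x8b9403), (4, 5, 0x9b53a04), (1, 0, 0x69105b),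
     (0, 5, 0xb4a310), (0, 5, 0xb4a320), (9, 1, 0x6a430b1), (9, 1, 0x7a430b2)],
    [(32, 0, 0x76ab98215430)]⟩,
  ⟨[62, 577, 641, 769, 513, 1, 2, 4, 8, 1054, 512], 0, 0x31dcb976540,
    [(0, 5, 0xb29150), (1, 4, 0x5b019a), (4, 5, 0x6b32901), (4, 5, 0x7b31902),
     (19, 1, 0x54321b0), (2, 3, 0x32b610), (2, 4, 0x8b7203), (8, 0, 0x94021b), (1, 4, 0x6b1027),
     (4, 5, 0x6b43901), (9, 0, 0x729031b), (4, 5, 0x8b41903), (8, 0, 0x94032b), (1, 4, 0x6b1038),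
     (8, 0, 0x93021b), (19, 1, 0xa4321b9), (0, 1, 0x7910b3)],
    [(16, 1, 0xa9b876543210)]⟩]

/-- The connected triangle-free graphs on 12 vertices without obstructions. -/
def level12 : List Entry := [
  ⟨[62, 577, 641, 769, 1025, 2049, 2, 4, 8, 3086, 528, 544], 0, 0x321dcba96540,
    [(0, 5, 0xc92061), (2, 4, 0xcb9a4), (2, 4, 0x9c504a), (19, 1, 0x54321c0), (7, 5, 0xbac32019),
     (2, 4, 0x6ca401), (0, 5, 0xc91083), (2, 4, 0x8c6103), (2, 4, 0x7c8302), (0, 5, 0xc93072),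
     (2, 4, 0x6c7201), (9, 0, 0x619032c), (10, 2, 0x5ab91c04), (10, 2, 0x4ba91c05),
     (0, 5, 0xc29150), (0, 5, 0xc201b9)],
    []⟩,
  ⟨[62, 1089, 1153, 1281, 1537, 1, 2, 4, 8, 16, 2078, 1024], 0, 0x31edcb976540,
    [(0, 5, 0xc2a150), (0, 5, 0xca4083), (19, 1, 0x54321c0), (1, 4, 0x5c01ab), (2, 4, 0x6c8301),
     (19, 1, 0xb4321ca), (4, 5, 0x7c31a02), (4, 5, 0x8c42a03), (4, 5, 0x9c32a04),
     (4, 5, 0x7c41a02), (8, 0, 0xa3021c), (8, 0, 0xa4031c), (0, 5, 0xca2061), (8, 0, 0xa4032c),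
     (8, 0, 0xa4021c), (0, 5, 0xca1072), (0, 3, 0x64c310), (0, 5, 0xca1094)],
    []⟩,
  ⟨[62, 1089, 1153, 1281, 1537, 2049, 2, 4, 8, 16, 2078, 1056], 0, 0x21edcb976540,
    [(0, 5, 0xca2061), (19, 1, 0x54321c0), (0, 5, 0xca4083), (19, 1, 0xb4321ca),
     (2, 4, 0x6c8301), (2, 4, 0x8c6103), (4, 5, 0x7c31a02), (4, 5, 0x9c32a04), (0, 5, 0xca4072),
     (2, 4, 0x8cb503), (9, 1, 0xba310c5), (9, 1, 0x5031acb), (9, 0, 0x61a032c), (0, 5, 0xca1094),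
     (8, 0, 0xa4021c), (0, 5, 0xc2a150), (0, 5, 0xc201ba)],
    []⟩,
  ⟨[62, 2113, 2177, 2305, 2561, 3073, 2, 4, 8, 16, 32, 62], 0, 0x1fedcb876540,
    [(19, 1, 0x54321c0), (0, 5, 0xcb2061), (2, 3, 0x54c830), (1, 4, 0x8c3049), (4, 5, 0x8c54b03),
     (4, 5, 0x9c53b04), (2, 4, 0xac6105), (2, 4, 0x6c9401), (1, 4, 0x9c4016), (8, 0, 0xb4031c),
     (1, 4, 0x6c105a), (4, 5, 0x6c32b01), (4, 5, 0x8c51b03), (8, 0, 0xb5042c), (9, 0, 0x94b051c),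
     (4, 5, 0x7c41b02), (1, 4, 0x6c1027), (19, 1, 0x54321cb)],
    []⟩]

/-- This check and the eleven after it are finite computations: the stored placements and
obstructions are correct, and every nonempty independent neighbourhood of a new vertex is obstructed
or leads to a graph of the next list. -/
lemma level1_check : level1.all (Entry.check obstructions targets 1 level2) = true := by
  decide +kernel

lemma level2_check : level2.all (Entry.check obstructions targets 2 level3) = true := by
  decide +kernel

lemma level3_check : level3.all (Entry.check obstructions targets 3 level4) = true := by
  decide +kernel

lemma level4_check : level4.all (Entry.check obstructions targets 4 level5) = true := by
  decide +kernel

lemma level5_check : level5.all (Entry.check obstructions targets 5 level6) = true := by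
  decide +kernel

lemma level6_check : level6.all (Entry.check obstructions targets 6 level7) = true := by
  decide +kernel

lemma level7_check : level7.all (Entry.check obstructions targets 7 level8) = true := by
  decide +kernel

lemma level8_check : level8.all (Entry.check obstructions targets 8 level9) = true := by
  decide +kernel

lemma level9_check : level9.all (Entry.check obstructions targets 9 level10) = true := by
  decide +kernel

lemma level10_check : level10.all (Entry.check obstructions targets 10 level11) = true := by
  decide +kernel

lemma level11_check : level11.all (Entry.check obstructions targets 11 level12) = true := by
  decide +kernel

/-- Against the empty list the check says that every connected triangle-free extension of these
graphs contains an obstruction, so the generation stops at twelve vertices. -/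
lemma level12_check : level12.all (Entry.check obstructions targets 12 []) = true := by
  decide +kernel

lemma obstructions_valid : obstructions.all rowsValid = true := by
  decide +kernel

/-! ### The obstructions do not occur in the class -/

section Obstructions

variable {V : Type*} {G : SimpleGraph V}

theorem not_isCopy_of_mem_spectralObstructions [Fintype V] [DecidableRel G.Adj]
    (hG : HasSmallLambda2 G) {o : List ℕ} (ho : o ∈ spectralObstructions) (f : ℕ → V) :
    ¬ IsCopy G o.length (rowAdj o) f := by
  intro h
  simp only [spectralObstructions, List.mem_cons, List.not_mem_nil, or_false] at ho
  rcases ho with rfl | rfl | rfl | rfl | rfl | rfl | rfl | rfl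
  -- Each pair spans a plane on which `A - 1` is positive definite. The graphs are, in order: a
  -- four-cycle with a pendant path of length two; the path on six vertices; the spider with legs 1,
  -- 1, 3; the double star with three and two leaves; `K₂,₃` with two pendant edges at a vertex of
  -- degree two; `K₂,₅` with a further vertex joined to two of the five; a four-cycle with four
  -- pendant edges at one vertex; `K₂,₃` with three pendant edges at a vertex of degree three.
  · exact h.not_hasSmallLambda2 ![1, 1, 1, 0, 0, 1] ![0, -1, 1, 1, 1, -1] (by decide +kernel) hG
  · exact h.not_hasSmallLambda2 ![0, 0, 1, 1, 0, 1] ![1, 1, 1, 0, 1, 0] (by decide +kernel) hG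
  · exact h.not_hasSmallLambda2 ![0, 1, 1, 1, 0, 0] ![1, 1, 0, 0, 1, 1] (by decide +kernel) hG
  · exact h.not_hasSmallLambda2 ![0, 1, 1, 1, 0, 0, 0] ![-1, 0, 0, 0, -1, -1, -1]
      (by decide +kernel) hG
  · exact h.not_hasSmallLambda2 ![1, 1, 0, 0, 0, 1, 1] ![-1, 1, 1, 1, 1, -1, -1]
      (by decide +kernel) hG
  · exact h.not_hasSmallLambda2 ![5, 2, 1, 1, 1, 0, 2, 3] ![-3, 1, -2, 3, 4, -2, -3, -3]
      (by decide +kernel) hG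
  · exact h.not_hasSmallLambda2 ![2, 0, 2, 2, 0, 1, 0, 1] ![2, -2, -2, 0, 1, 2, 1, 1]
      (by decide +kernel) hG
  · exact h.not_hasSmallLambda2 ![1, 1, 0, 1, 1, 1, 1, 1] ![1, 0, -1, 0, 0, 1, 1, 1]
      (by decide +kernel) hG

instance : DecidableRel (completeBipartiteGraph (Fin 3) (Fin 3)).Adj := fun a b =>
  inferInstanceAs (Decidable (a.isLeft ∧ b.isRight ∨ a.isRight ∧ b.isLeft))

theorem not_isCopy_of_mem_planarityObstructions (hG : IsPlanar G) {o : List ℕ}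
    (ho : o ∈ planarityObstructions) (f : ℕ → V) : ¬ IsCopy G o.length (rowAdj o) f := by
  intro h
  simp only [planarityObstructions, List.mem_cons, List.not_mem_nil, or_false] at ho
  rcases ho with rfl | rfl | rfl | rfl | rfl | rfl | rfl | rfl | rfl | rfl | rfl
  -- The first graph is `K₃,₃` itself. The others contract to `K₃,₃` or, in two cases, to `K₅`; each
  -- branch set is listed so that every entry but the last has a later neighbour.
  · exact hG.2 (h.isMinor (Sum.elim ![[0], [3], [5]] ![[1], [2], [4]]) (by decide +kernel))
  · exact hG.2 (h.isMinor (Sum.elim ![[0], [3], [4]] ![[1], [2], [6, 5]]) (by decide +kernel))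
  · exact hG.2 (h.isMinor (Sum.elim ![[0], [3], [5]] ![[2], [6, 4], [7, 1]]) (by decide +kernel))
  · exact hG.2 (h.isMinor (Sum.elim ![[0], [3], [5]] ![[1], [6, 2], [7, 4]]) (by decide +kernel))
  · exact hG.2 (h.isMinor (Sum.elim ![[0], [3], [4]] ![[1], [2], [6, 7, 5]]) (by decide +kernel))
  · exact hG.2 (h.isMinor (Sum.elim ![[0], [3], [6]] ![[4, 1], [7, 5], [8, 2]]) (by decide +kernel))
  · exact hG.1 (h.isMinor ![[0], [1], [5, 2], [8, 3], [7, 6, 4]] (by decide +kernel))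
  · exact hG.2 (h.isMinor (Sum.elim ![[0], [1], [5]] ![[3, 2], [7, 4], [8, 6]]) (by decide +kernel))
  · exact hG.2 (h.isMinor (Sum.elim ![[0], [1], [2]] ![[6, 3], [7, 4], [8, 5]]) (by decide +kernel))
  · exact hG.2 (h.isMinor (Sum.elim ![[0], [2], [5]] ![[1], [8, 4], [6, 7, 3]]) (by decide +kernel))
  · exact hG.1 (h.isMinor ![[0], [1], [3, 2], [8, 6, 4], [9, 7, 5]] (by decide +kernel))

theorem not_isCopy_of_mem_obstructions [Fintype V] [DecidableRel G.Adj]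
    (hG : HasSmallLambda2 G) (hplanar : IsPlanar G) (hdeg : ∀ v, G.degree v < 6) :
    ∀ o ∈ obstructions, ∀ f, ¬ IsCopy G o.length (rowAdj o) f := by
  intro o ho f h
  rw [obstructions, List.mem_append, List.mem_append, List.mem_singleton] at ho
  rcases ho with (ho | ho) | rfl
  · exact not_isCopy_of_mem_spectralObstructions hG ho f h
  · exact not_isCopy_of_mem_planarityObstructions hplanar ho f h
  · have h1 : ∀ i : Fin 6, i.val + 1 < starRows.length ∧ rowAdj starRows 0 (i.val + 1) = true := by
      decide
    -- The six leaves of the star are distinct neighbours of its centre, against the degree bound.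
    have h2 : (Finset.univ : Finset (Fin 6)).card ≤ (G.neighborFinset (f 0)).card := by
      refine Finset.card_le_card_of_injOn (fun i => f (i.val + 1)) (fun i _ => ?_)
        (fun i _ j _ hij => ?_)
      · rw [Finset.mem_coe, SimpleGraph.mem_neighborFinset]
        exact (h.adj_iff 0 (by decide) _ (h1 i).1).2 (h1 i).2
      · have := h.inj _ (h1 i).1 _ (h1 j).1 hij
        exact Fin.ext (by omega)
    have := hdeg (f 0)
    rw [SimpleGraph.card_neighborFinset_eq_degree, Finset.card_univ, Fintype.card_fin] at h2
    omega

end Obstructions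

/-! ### Sums of squares for the thirteen sporadic graphs -/

section Targets

instance {n : ℕ} (l : List (Fin n × Fin n)) : DecidableRel (ofEdges n l).Adj := fun a b =>
  decidable_of_iff _ (SimpleGraph.fromRel_adj _ a b).symm

theorem isCopy_ofFin {n : ℕ} [NeZero n] {T : SimpleGraph (Fin n)} {r : List ℕ}
    (h : ∀ i j : Fin n, T.Adj i j ↔ rowAdj r i j = true) :
    IsCopy T n (rowAdj r) (Fin.ofNat n) where
  inj i hi j hj hij := by
    have := congrArg Fin.val hij
    simpa [Fin.ofNat, Nat.mod_eq_of_lt hi, Nat.mod_eq_of_lt hj] using this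
  adj_iff i hi j hj := by
    rw [h]
    simp [Fin.ofNat, Nat.mod_eq_of_lt hi, Nat.mod_eq_of_lt hj]

/-- A sum of squares representation of a multiple of `1 - A`, up to the square of a linear form,
bounds the second largest eigenvalue. -/
theorem hasSmallLambda2_of_sum_sq {n : ℕ} {T : SimpleGraph (Fin n)} [DecidableRel T.Adj]
    (c e : ℕ) (l : Fin n → ℤ) (D : List (ℕ × (Fin n → ℤ)))
    (h : 0 < c ∧ ∀ i j, c * ((if i = j then 1 else 0) - if T.Adj i j then 1 else 0) +
      e * (l i * l j) = (D.map fun d => (d.1 : ℤ) * (d.2 i * d.2 j)).sum) :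
    HasSmallLambda2 T := by
  refine ⟨fun i => l i, fun v hv => ?_⟩
  obtain ⟨hc, h⟩ := h
  have hsq : ∀ a : Fin n → ℤ, ((fun i => (a i : ℝ)) ⬝ᵥ v) ^ 2 =
      ∑ i, ∑ j, v i * ((a i * a j : ℤ) : ℝ) * v j := by
    intro a
    rw [sq, dotProduct, Finset.sum_mul_sum]
    refine Finset.sum_congr rfl fun i _ => Finset.sum_congr rfl fun j _ => ?_
    push_cast
    ring
  have hD : (0 : ℝ) ≤ ∑ i, ∑ j, v i *
      (((D.map fun d => (d.1 : ℤ) * (d.2 i * d.2 j)).sum : ℤ) : ℝ) * v j := by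
    clear h
    induction D with
    | nil => simp
    | cons d D ih =>
      have : ∑ i, ∑ j, v i *
          ((((d :: D).map fun d => (d.1 : ℤ) * (d.2 i * d.2 j)).sum : ℤ) : ℝ) * v j =
          d.1 * ((fun i => (d.2 i : ℝ)) ⬝ᵥ v) ^ 2 + ∑ i, ∑ j, v i *
          (((D.map fun d => (d.1 : ℤ) * (d.2 i * d.2 j)).sum : ℤ) : ℝ) * v j := by
        rw [hsq, Finset.mul_sum, ← Finset.sum_add_distrib]
        refine Finset.sum_congr rfl fun i _ => ?_
        rw [Finset.mul_sum, ← Finset.sum_add_distrib]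
        refine Finset.sum_congr rfl fun j _ => ?_
        rw [List.map_cons, List.sum_cons]
        push_cast
        ring
      rw [this]
      positivity
  have hT : ∑ i, ∑ j, v i *
      (((c : ℤ) * ((if i = j then 1 else 0) - if T.Adj i j then 1 else 0) +
        e * (l i * l j) : ℤ) : ℝ) * v j =
      c * (v ⬝ᵥ v - v ⬝ᵥ T.adjMatrix ℝ *ᵥ v) + e * ((fun i => (l i : ℝ)) ⬝ᵥ v) ^ 2 := by
    rw [hsq]
    simp only [dotProduct, mulVec, Finset.mul_sum, ← Finset.sum_sub_distrib,
      ← Finset.sum_add_distrib]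
    refine Finset.sum_congr rfl fun i _ => ?_
    have h1 : v i * v i = ∑ j, v i * (if i = j then 1 else 0) * v j := by simp
    rw [h1, ← Finset.sum_sub_distrib, Finset.mul_sum, ← Finset.sum_add_distrib]
    refine Finset.sum_congr rfl fun j _ => ?_
    rw [SimpleGraph.adjMatrix_apply]
    push_cast
    ring
  -- The identity of matrices turns the sum of squares into `c` times the form of `1 - A` plus `e`
  -- times the square of `l`; the latter vanishes on the hyperplane.
  simp only [← h] at hD
  rw [hT, hv] at hD
  have hc' : (0 : ℝ) < c := Nat.cast_pos.2 hc
  have : 0 ≤ (c : ℝ) * (v ⬝ᵥ v - v ⬝ᵥ T.adjMatrix ℝ *ᵥ v) := by linarith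
  linarith [nonneg_of_mul_nonneg_right this hc']

instance : DecidableRel H1.Adj := inferInstanceAs (DecidableRel (ofEdges _ _).Adj)

instance : DecidableRel H2.Adj := inferInstanceAs (DecidableRel (ofEdges _ _).Adj)

instance : DecidableRel H3.Adj := inferInstanceAs (DecidableRel (ofEdges _ _).Adj)

instance : DecidableRel H4.Adj := inferInstanceAs (DecidableRel (ofEdges _ _).Adj)

instance : DecidableRel H5.Adj := inferInstanceAs (DecidableRel (ofEdges _ _).Adj)

instance : DecidableRel H6.Adj := inferInstanceAs (DecidableRel (ofEdges _ _).Adj)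

instance : DecidableRel H7.Adj := inferInstanceAs (DecidableRel (ofEdges _ _).Adj)

instance : DecidableRel H8.Adj := inferInstanceAs (DecidableRel (ofEdges _ _).Adj)

instance : DecidableRel H9.Adj := inferInstanceAs (DecidableRel (ofEdges _ _).Adj)

instance : DecidableRel H10.Adj := inferInstanceAs (DecidableRel (ofEdges _ _).Adj)

instance : DecidableRel H11.Adj := inferInstanceAs (DecidableRel (ofEdges _ _).Adj)

instance : DecidableRel H12.Adj := inferInstanceAs (DecidableRel (ofEdges _ _).Adj)

instance : DecidableRel H13.Adj := inferInstanceAs (DecidableRel (ofEdges _ _).Adj)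

/-- Adding a suitable multiple of the square of one linear form to a multiple of `1 - A` leaves a
positive semidefinite matrix, and the pairs diagonalise it over the integers. The same pattern
serves the other twelve graphs. Few squares are needed because 1 is an eigenvalue of multiplicity at
least three in each of them. -/
lemma hasSmallLambda2_H1 : HasSmallLambda2 H1 :=
  hasSmallLambda2_of_sum_sq 1 1 ![1, 0, 1, 1, 0, 1, 1, 0]
    [(1, ![-1, 0, 0, -1, 1, 0, 0, 0]),
     (1, ![1, -1, 1, 0, 0, 0, 1, 0]),
     (1, ![0, 0, 1, 0, 0, 1, 0, 0]),
     (1, ![0, 0, 0, 1, 0, 1, 1, -1])] (by decide +kernel)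

lemma isCopy_H1 : IsCopy H1 8 (rowAdj (targets.getD 1 [])) (Fin.ofNat 8) :=
  isCopy_ofFin (by decide +kernel)

lemma hasSmallLambda2_H2 : HasSmallLambda2 H2 :=
  hasSmallLambda2_of_sum_sq 1 1 ![1, 1, 1, 1, 0, 1, 1, 0, 0, 0]
    [(1, ![0, -1, 0, 0, 0, 0, 0, 0, 1, 0]),
     (1, ![0, 0, 0, -1, 0, 0, 0, 0, 0, 1]),
     (1, ![-1, 0, 0, 0, 0, -1, 0, 1, 0, 0]),
     (1, ![1, 0, 1, 0, 0, 0, 0, 0, 0, 0]),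
     (1, ![0, 0, 1, 0, 0, 1, 1, 0, 0, 0]),
     (1, ![0, 1, 0, 1, -1, 0, 1, 0, 0, 0])] (by decide +kernel)

lemma isCopy_H2 : IsCopy H2 10 (rowAdj (targets.getD 2 [])) (Fin.ofNat 10) :=
  isCopy_ofFin (by decide +kernel)

lemma hasSmallLambda2_H3 : HasSmallLambda2 H3 :=
  hasSmallLambda2_of_sum_sq 1 1 ![1, 1, 1, 0, 1, 1, 0, 0, 1]
    [(1, ![-1, 0, -1, 1, 0, 0, 0, 0, 0]),
     (1, ![1, 0, 0, 0, 0, 0, -1, 0, 1]),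
     (1, ![0, 1, 0, 0, 1, 0, 0, 0, 1]),
     (1, ![0, 1, 0, 0, 0, 1, 0, 0, 0]),
     (1, ![0, 0, 1, 0, 1, 1, 0, -1, 0])] (by decide +kernel)

lemma isCopy_H3 : IsCopy H3 9 (rowAdj (targets.getD 3 [])) (Fin.ofNat 9) :=
  isCopy_ofFin (by decide +kernel)

lemma hasSmallLambda2_H4 : HasSmallLambda2 H4 :=
  hasSmallLambda2_of_sum_sq 2 1 ![2, 1, 0, 1, 0, 0, 0, 1, 2]
    [(2, ![-1, 0, 0, 0, 0, 0, 1, 0, 0]),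
     (2, ![-1, 0, 0, 0, 0, 1, 0, 0, -1]),
     (2, ![1, 0, 0, 0, -1, 0, 0, 1, 1]),
     (1, ![0, -1, 0, 1, 0, 0, 0, 1, 0]),
     (2, ![0, 1, -1, 1, 0, 0, 0, 0, 1])] (by decide +kernel)

lemma isCopy_H4 : IsCopy H4 9 (rowAdj (targets.getD 4 [])) (Fin.ofNat 9) :=
  isCopy_ofFin (by decide +kernel)

lemma hasSmallLambda2_H5 : HasSmallLambda2 H5 :=
  hasSmallLambda2_of_sum_sq 1 1 ![1, 1, 1, 0, 0, 1, 1, 1, 0, 0]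
    [(1, ![-1, 0, -1, 1, 0, 0, 0, 0, 0, 0]),
     (1, ![1, 0, 0, 0, -1, 0, 0, 1, 0, 0]),
     (1, ![0, -1, 0, 0, 0, -1, 0, 0, 1, 0]),
     (1, ![0, 1, 0, 0, 0, 0, 1, 0, 0, -1]),
     (1, ![0, 0, 1, 0, 0, 1, 1, 1, 0, 0])] (by decide +kernel)

lemma isCopy_H5 : IsCopy H5 10 (rowAdj (targets.getD 5 [])) (Fin.ofNat 10) :=
  isCopy_ofFin (by decide +kernel)

lemma hasSmallLambda2_H6 : HasSmallLambda2 H6 :=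
  hasSmallLambda2_of_sum_sq 1 1 ![1, 1, 1, 0, 1, 0, 1, 0, 1]
    [(1, ![-1, 0, 0, 0, 0, 1, 0, 0, 0]),
     (1, ![0, -1, 0, 0, -1, 0, 0, 1, 0]),
     (1, ![0, 1, 0, 0, 0, 0, 1, 0, 1]),
     (1, ![0, 0, 1, 0, 1, 0, 1, 0, 0]),
     (1, ![1, 0, 1, -1, 0, 0, 0, 0, 1])] (by decide +kernel)

lemma isCopy_H6 : IsCopy H6 9 (rowAdj (targets.getD 6 [])) (Fin.ofNat 9) :=
  isCopy_ofFin (by decide +kernel)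

lemma hasSmallLambda2_H7 : HasSmallLambda2 H7 :=
  hasSmallLambda2_of_sum_sq 1 1 ![1, 1, 1, 0, 1, 1, 0, 0, 1]
    [(1, ![-1, 0, -1, 1, 0, 0, 0, 0, 0]),
     (1, ![1, 0, 0, 0, 0, 0, 0, 0, 1]),
     (1, ![0, -1, 0, 0, 0, -1, 1, 0, 0]),
     (1, ![0, 1, 0, 0, 1, 0, 0, 0, 1]),
     (1, ![0, 0, 1, 0, 1, 1, 0, -1, 0])] (by decide +kernel)

lemma isCopy_H7 : IsCopy H7 9 (rowAdj (targets.getD 7 [])) (Fin.ofNat 9) :=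
  isCopy_ofFin (by decide +kernel)

lemma hasSmallLambda2_H8 : HasSmallLambda2 H8 :=
  hasSmallLambda2_of_sum_sq 1 1 ![1, 1, 0, 1, 1, 0, 0, 1, 0]
    [(1, ![-1, 0, 0, 0, 0, 1, 0, 0, 0]),
     (1, ![1, 0, 0, 0, 0, 0, 0, 1, 0]),
     (1, ![0, -1, 0, 0, -1, 0, 1, 0, 0]),
     (1, ![0, 0, 0, 1, 1, 0, 0, 0, -1]),
     (1, ![0, 1, -1, 1, 0, 0, 0, 1, 0])] (by decide +kernel)

lemma isCopy_H8 : IsCopy H8 9 (rowAdj (targets.getD 8 [])) (Fin.ofNat 9) :=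
  isCopy_ofFin (by decide +kernel)

lemma hasSmallLambda2_H9 : HasSmallLambda2 H9 :=
  hasSmallLambda2_of_sum_sq 1 1 ![1, 1, 0, 1, 0, 0, 1, 0, 1]
    [(1, ![-1, 0, 0, 0, 0, 1, 0, 0, 0]),
     (1, ![0, -1, 0, 0, 0, 0, 0, 1, 0]),
     (1, ![1, 0, 0, 0, -1, 0, 1, 0, 1]),
     (1, ![0, 0, 0, 1, 0, 0, 1, 0, 0]),
     (1, ![0, 1, -1, 1, 0, 0, 0, 0, 1])] (by decide +kernel)

lemma isCopy_H9 : IsCopy H9 9 (rowAdj (targets.getD 9 [])) (Fin.ofNat 9) :=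
  isCopy_ofFin (by decide +kernel)

lemma hasSmallLambda2_H10 : HasSmallLambda2 H10 :=
  hasSmallLambda2_of_sum_sq 1 1 ![1, 0, 1, 1, 0, 2, 0, 1]
    [(2, ![0, 0, 0, 1, 0, 1, 0, 0]),
     (1, ![-1, 1, -1, 0, 0, -1, 0, 0]),
     (1, ![1, 0, 0, 0, -1, 1, 0, 1]),
     (1, ![0, 0, 1, 0, 0, 1, -1, 1])] (by decide +kernel)

lemma isCopy_H10 : IsCopy H10 8 (rowAdj (targets.getD 10 [])) (Fin.ofNat 8) :=
  isCopy_ofFin (by decide +kernel)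

lemma hasSmallLambda2_H11 : HasSmallLambda2 H11 :=
  hasSmallLambda2_of_sum_sq 3 1 ![2, 3, -1, 3, 2, 3, 0, 0, 0, 0]
    [(3, ![-1, 0, 0, 0, 0, 0, 0, 1, 0, 0]),
     (3, ![0, -1, 0, 0, 0, 0, 0, 0, 1, 0]),
     (3, ![0, 0, 0, -1, 0, 0, 0, 0, 0, 1]),
     (3, ![-1, 0, 0, 0, -1, 0, 1, 0, 0, 0]),
     (1, ![1, 3, -2, 3, 1, 3, 0, 0, 0, 0]),
     (3, ![0, 0, 0, 0, 1, 1, 0, 0, 0, 0])] (by decide +kernel)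

lemma isCopy_H11 : IsCopy H11 10 (rowAdj (targets.getD 11 [])) (Fin.ofNat 10) :=
  isCopy_ofFin (by decide +kernel)

lemma hasSmallLambda2_H12 : HasSmallLambda2 H12 :=
  hasSmallLambda2_of_sum_sq 6 2 ![1, 3, 7, 4, 3, 0, 4, 1, -2, 0]
    [(6, ![0, 0, 0, -1, 0, 0, 0, 0, 0, 1]),
     (6, ![-1, 0, -1, 0, 0, 1, 0, 0, 0, 0]),
     (6, ![0, 2, 3, 2, 1, 0, 2, 0, -1, 0]),
     (2, ![1, 0, 4, 1, 3, 0, 1, 1, -2, 0]),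
     (3, ![0, 0, 2, 1, 0, 0, 2, 1, 0, 0]),
     (3, ![0, 0, 0, 1, 0, 0, 0, 1, 0, 0])] (by decide +kernel)

lemma isCopy_H12 : IsCopy H12 10 (rowAdj (targets.getD 12 [])) (Fin.ofNat 10) :=
  isCopy_ofFin (by decide +kernel)

lemma hasSmallLambda2_H13 : HasSmallLambda2 H13 :=
  hasSmallLambda2_of_sum_sq 5 1 ![5, 3, 5, 3, 0, -2, 0, 0, 0, 0]
    [(5, ![-1, 0, 0, 0, 0, 0, 1, 0, 0, 0]),
     (5, ![0, -1, 0, 0, 0, 0, 0, 1, 0, 0]),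
     (5, ![0, 0, -1, 0, 0, 0, 0, 0, 1, 0]),
     (5, ![0, 0, 0, -1, 0, 0, 0, 0, 0, 1]),
     (5, ![0, -1, 0, -1, 1, 0, 0, 0, 0, 0]),
     (1, ![5, 2, 5, 2, 0, -3, 0, 0, 0, 0])] (by decide +kernel)

lemma isCopy_H13 : IsCopy H13 10 (rowAdj (targets.getD 13 [])) (Fin.ofNat 10) :=
  isCopy_ofFin (by decide +kernel)

end Targets

/-! ### The infinite family satisfies the spectral condition -/

section F1

variable {s : ℕ}

/-- The vertices of `F1 s` as a sum type. -/
def F1Vertex.equivSum (s : ℕ) : F1Vertex s ≃ (Unit ⊕ Unit) ⊕ (Fin s ⊕ Fin s) where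
  toFun
    | .v1 => .inl (.inl ())
    | .v2 => .inl (.inr ())
    | .u i => .inr (.inl i)
    | .w i => .inr (.inr i)
  invFun
    | .inl (.inl ()) => .v1
    | .inl (.inr ()) => .v2
    | .inr (.inl i) => .u i
    | .inr (.inr i) => .w i
  left_inv x := by cases x <;> rfl
  right_inv x := by rcases x with (x | x) | (x | x) <;> rfl

instance : Fintype (F1Vertex s) := Fintype.ofEquiv _ (F1Vertex.equivSum s).symm

lemma F1Vertex.sum_eq (g : F1Vertex s → ℝ) :
    ∑ x, g x = g .v1 + g .v2 + ∑ i, (g (.u i) + g (.w i)) := by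
  rw [← (F1Vertex.equivSum s).symm.sum_comp g, Fintype.sum_sum_type, Fintype.sum_sum_type,
    Fintype.sum_sum_type, Finset.sum_add_distrib]
  simp [F1Vertex.equivSum]

lemma F1_adj_v1_v2 : ¬ (F1 s).Adj .v1 .v2 := by simp [F1, F1Edge]

lemma F1_adj_v1_u (i : Fin s) : (F1 s).Adj .v1 (.u i) ↔ 2 ≤ i.val := by simp [F1, F1Edge]

lemma F1_adj_v1_w (i : Fin s) : (F1 s).Adj .v1 (.w i) ↔ i.val < 2 := by simp [F1, F1Edge]

lemma F1_adj_v2_u (i : Fin s) : (F1 s).Adj .v2 (.u i) := by simp [F1, F1Edge]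

lemma F1_adj_v2_w (i : Fin s) : ¬ (F1 s).Adj .v2 (.w i) := by simp [F1, F1Edge]

lemma F1_adj_u_u (i j : Fin s) : ¬ (F1 s).Adj (.u i) (.u j) := by simp [F1, F1Edge]

lemma F1_adj_u_w (i j : Fin s) : (F1 s).Adj (.u i) (.w j) ↔ i = j := by simp [F1, F1Edge]

lemma F1_adj_w_w (i j : Fin s) : ¬ (F1 s).Adj (.w i) (.w j) := by simp [F1, F1Edge]

/-- Write `a`, `b` for the values at `v1`, `v2`. The linear form is chosen so that `a + b` times it
turns the part of `1 - A` that belongs to an index `i` into a perfect square: `(w - u)²` for a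
pendant index, and `(w - u - (a - b) / 2)²`, up to the constant `(a - b)² / 4`, for a subdivided
one. -/
theorem hasSmallLambda2_F1 [DecidableRel (F1 s).Adj] : HasSmallLambda2 (F1 s) := by
  refine ⟨fun x => match x with
    | .v1 => 0
    | .v2 => 0
    | .u i => if i.val < 2 then 1 else 2
    | .w i => if i.val < 2 then 1 else 0, fun v hv => ?_⟩
  rw [dotProduct, F1Vertex.sum_eq] at hv
  simp only [zero_mul, zero_add] at hv
  have hAu : ∀ i, ((F1 s).adjMatrix ℝ *ᵥ v) (.u i) =
      v .v2 + v (.w i) + if i.val < 2 then 0 else v .v1 := by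
    intro i
    rw [mulVec, dotProduct, F1Vertex.sum_eq]
    simp only [SimpleGraph.adjMatrix_apply, F1_adj_u_u, F1_adj_u_w,
      (F1 s).adj_comm (.u i) .v1, (F1 s).adj_comm (.u i) .v2, F1_adj_v1_u, F1_adj_v2_u]
    simp only [if_true, if_false, ite_mul, one_mul, zero_mul, zero_add, Finset.sum_ite_eq,
      Finset.mem_univ]
    split_ifs <;> first | omega | ring
  have hAw : ∀ i, ((F1 s).adjMatrix ℝ *ᵥ v) (.w i) =
      v (.u i) + if i.val < 2 then v .v1 else 0 := by
    intro i
    rw [mulVec, dotProduct, F1Vertex.sum_eq]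
    simp only [SimpleGraph.adjMatrix_apply, F1_adj_w_w, (F1 s).adj_comm (.w i) (.u _), F1_adj_u_w,
      (F1 s).adj_comm (.w i) .v1, (F1 s).adj_comm (.w i) .v2, F1_adj_v1_w, F1_adj_v2_w]
    simp only [if_true, if_false, ite_mul, one_mul, zero_mul, add_zero, Finset.sum_ite_eq',
      Finset.mem_univ]
    ring
  have hA1 : ((F1 s).adjMatrix ℝ *ᵥ v) .v1 =
      ∑ i : Fin s, if i.val < 2 then v (.w i) else v (.u i) := by
    rw [mulVec, dotProduct, F1Vertex.sum_eq]
    simp only [SimpleGraph.adjMatrix_apply, F1_adj_v1_v2, F1_adj_v1_u, F1_adj_v1_w,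
      SimpleGraph.irrefl, if_false, zero_mul, zero_add]
    refine Finset.sum_congr rfl fun i _ => ?_
    split_ifs <;> first | omega | ring
  have hA2 : ((F1 s).adjMatrix ℝ *ᵥ v) .v2 = ∑ i : Fin s, v (.u i) := by
    rw [mulVec, dotProduct, F1Vertex.sum_eq]
    simp only [SimpleGraph.adjMatrix_apply, (F1 s).adj_comm .v2 .v1, F1_adj_v1_v2, F1_adj_v2_u,
      F1_adj_v2_w, SimpleGraph.irrefl, if_false, if_true, zero_mul, zero_add, add_zero, one_mul]
  -- Only the number of subdivided indices enters the estimate, which is why it is uniform in `s`.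
  have hcard : ∑ i : Fin s, (if i.val < 2 then (1 : ℝ) else 0) ≤ 2 := by
    rw [Finset.sum_boole]
    have : (Finset.univ.filter fun i : Fin s => i.val < 2).card ≤ (Finset.range 2).card :=
      Finset.card_le_card_of_injOn (fun i => i.val)
        (fun i hi => by simpa using hi) (fun i _ j _ h => Fin.ext h)
    rw [Finset.card_range] at this
    exact_mod_cast this
  rw [dotProduct, dotProduct, F1Vertex.sum_eq, F1Vertex.sum_eq, hA1, hA2]
  simp only [hAu, hAw]
  set a := v .v1
  set b := v .v2
  have key : ∀ i : Fin s, 0 ≤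
      (v (.u i) * v (.u i) + v (.w i) * v (.w i)) -
      (v (.u i) * (b + v (.w i) + if i.val < 2 then 0 else a) +
        v (.w i) * (v (.u i) + if i.val < 2 then a else 0)) -
      (a * (if i.val < 2 then v (.w i) else v (.u i)) + b * v (.u i)) +
      ((a + b) * ((if i.val < 2 then 1 else 2) * v (.u i) +
        (if i.val < 2 then 1 else 0) * v (.w i)) +
        (a - b) ^ 2 / 4 * if i.val < 2 then 1 else 0) := by
    intro i
    split_ifs
    · nlinarith [sq_nonneg (v (.w i) - v (.u i) - (a - b) / 2)]
    · nlinarith [sq_nonneg (v (.w i) - v (.u i))]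
  have hsum := Finset.sum_nonneg fun i (_ : i ∈ Finset.univ) => key i
  rw [Finset.sum_add_distrib, Finset.sum_sub_distrib, Finset.sum_sub_distrib,
    Finset.sum_add_distrib (f := fun i : Fin s => a * (if i.val < 2 then v (.w i) else v (.u i))),
    Finset.sum_add_distrib (f := fun i : Fin s => (a + b) * _), ← Finset.mul_sum, ← Finset.mul_sum,
    ← Finset.mul_sum, ← Finset.mul_sum, hv] at hsum
  -- The at most two constants add up to at most `(a - b)² / 2`, which `a² + b²` exceeds by `(a +
  -- b)² / 2`.
  nlinarith [sq_nonneg (a + b), mul_le_mul_of_nonneg_left hcard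
    (by positivity : (0 : ℝ) ≤ (a - b) ^ 2 / 4)]

end F1

/-! ### Recognising induced subgraphs of the infinite family -/

section Embedding

variable {V : Type*} [Fintype V] [DecidableEq V]

/-- An injective numbering in which a given set of at most two elements comes first. -/
lemma exists_numbering (T : Finset V) (hT : T.card ≤ 2) :
    ∃ e : V → Fin (Fintype.card V + 2), Function.Injective e ∧ ∀ v, (e v).val < 2 ↔ v ∈ T := by
  refine ⟨fun v => if h : v ∈ T then ⟨T.equivFin ⟨v, h⟩, by have := (T.equivFin ⟨v, h⟩).2; omega⟩
    else ⟨Fintype.equivFin V v + 2, by have := (Fintype.equivFin V v).2; omega⟩, ?_, ?_⟩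
  · intro v w hvw
    by_cases hv : v ∈ T <;> by_cases hw : w ∈ T <;>
      simp only [hv, hw, dif_pos, dif_neg, not_false_eq_true, Fin.mk.injEq] at hvw
    · simpa using T.equivFin.injective (Fin.ext hvw)
    · have := (T.equivFin ⟨v, hv⟩).2
      omega
    · have := (T.equivFin ⟨w, hw⟩).2
      omega
    · exact (Fintype.equivFin V).injective (Fin.ext (by omega))
  · intro v
    by_cases hv : v ∈ T
    · have := (T.equivFin ⟨v, hv⟩).2
      simp only [hv, dif_pos, iff_true]
      omega
    · simp [hv]

/-- A graph whose vertices split into a centre `c`, its neighbours `A`, at most one vertex in `Z`,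
further neighbours `O` of the latter, and pendant paths `Root x a` at vertices `a` of `A`, is an
induced subgraph of some `F1 s`. The set `T` consists of the vertices of `A` and `O` that are
placed next to the subdivided edges. -/
theorem isIndContained_F1_of_structure (G : SimpleGraph V) (c : V) (A Z O : V → Prop)
    (Root : V → V → Prop) (T : Finset V) (hT : T.card ≤ 2)
    (hcover : ∀ v, v = c ∨ A v ∨ Z v ∨ O v ∨ ∃ a, Root v a)
    (hc : ∀ v, G.Adj c v ↔ A v) (hAA : ∀ a b, A a → A b → ¬ G.Adj a b)
    (hZ : ∀ z z', Z z → Z z' → z = z') (hAZ : ∀ a z, A a → Z z → (G.Adj a z ↔ a ∉ T))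
    (hZA : ∀ z, Z z → ¬ A z) (hOA : ∀ y, O y → ¬ A y) (hRA : ∀ x a, Root x a → ¬ A x)
    (hAO : ∀ a y, A a → O y → ¬ G.Adj a y) (hR : ∀ x a, Root x a → A a)
    (hAR : ∀ b x a, A b → Root x a → (G.Adj b x ↔ b = a)) (hZO : ∀ z y, Z z → O y → G.Adj z y)
    (hZR : ∀ z x a, Z z → Root x a → (G.Adj z x ↔ a ∈ T)) (hOO : ∀ y y', O y → O y' → ¬ G.Adj y y')
    (hOR : ∀ y x a, O y → Root x a → ¬ G.Adj y x)
    (hRR : ∀ x a y b, Root x a → Root y b → ¬ G.Adj x y)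
    (hRinj : ∀ x y a, Root x a → Root y a → x = y) (hOT : ∀ y, O y → y ∈ T) :
    G.IsIndContained (F1 (Fintype.card V + 2)) := by
  obtain ⟨e, he, heT⟩ := exists_numbering T hT
  -- A neighbour of `c` in `T` becomes a subdividing vertex, and the vertex hanging on it becomes
  -- the `u` beyond, adjacent to `v2`. A neighbour outside `T` becomes a `u`, with its hanging
  -- vertex as the pendant `w`. A vertex of `O` becomes a `u` whose subdividing vertex is left
  -- unused. As a relation, the placement needs no prior proof that these classes are disjoint.
  let R : V → F1Vertex (Fintype.card V + 2) → Prop := fun v x =>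
    (v = c ∧ x = .v1) ∨ (A v ∧ v ∈ T ∧ x = .w (e v)) ∨ (A v ∧ v ∉ T ∧ x = .u (e v)) ∨
      (Z v ∧ x = .v2) ∨ (O v ∧ x = .u (e v)) ∨
      (∃ a, Root v a ∧ a ∈ T ∧ x = .u (e a)) ∨ ∃ a, Root v a ∧ a ∉ T ∧ x = .w (e a)
  have hex : ∀ v, ∃ x, R v x := by
    intro v
    simp only [R]
    rcases hcover v with h | h | h | h | ⟨a, h⟩
    · exact ⟨_, Or.inl ⟨h, rfl⟩⟩
    · by_cases hv : v ∈ T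
      · exact ⟨_, Or.inr (Or.inl ⟨h, hv, rfl⟩)⟩
      · exact ⟨_, Or.inr (Or.inr (Or.inl ⟨h, hv, rfl⟩))⟩
    · exact ⟨_, Or.inr (Or.inr (Or.inr (Or.inl ⟨h, rfl⟩)))⟩
    · exact ⟨_, Or.inr (Or.inr (Or.inr (Or.inr (Or.inl ⟨h, rfl⟩))))⟩
    · by_cases ha : a ∈ T
      · exact ⟨_, Or.inr (Or.inr (Or.inr (Or.inr (Or.inr (Or.inl ⟨a, h, ha, rfl⟩)))))⟩
      · exact ⟨_, Or.inr (Or.inr (Or.inr (Or.inr (Or.inr (Or.inr ⟨a, h, ha, rfl⟩)))))⟩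
  have heT' : ∀ v, 2 ≤ (e v).val ↔ v ∉ T := fun v => by rw [← heT v]; omega
  have hes : ∀ v w, e v = e w ↔ v = w := fun v w => he.eq_iff
  have hAirr : ¬ A c := fun h => G.irrefl ((hc c).2 h)
  -- Injectivity and preservation of adjacency hold for any values that `R` allows, so an arbitrary
  -- choice of values is an embedding.
  have key : ∀ v w x y, R v x → R w y → (x = y → v = w) ∧ ((F1 _).Adj x y ↔ G.Adj v w) := by
    intro v w x y hx hy
    rcases hx with ⟨h1, rfl⟩ | ⟨h1, h2, rfl⟩ | ⟨h1, h2, rfl⟩ | ⟨h1, rfl⟩ | ⟨h1, rfl⟩ |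
        ⟨a, h1, h2, rfl⟩ | ⟨a, h1, h2, rfl⟩ <;>
      rcases hy with ⟨h3, rfl⟩ | ⟨h3, h4, rfl⟩ | ⟨h3, h4, rfl⟩ | ⟨h3, rfl⟩ | ⟨h3, rfl⟩ |
        ⟨b, h3, h4, rfl⟩ | ⟨b, h3, h4, rfl⟩ <;>
      simp only [F1, F1Edge, SimpleGraph.fromRel_adj, reduceCtorEq, ne_eq, not_true_eq_false,
        not_false_eq_true, F1Vertex.u.injEq, F1Vertex.w.injEq, heT, heT', hes, false_imp_iff,
        true_and, and_true, and_false, or_false, false_or, or_self, true_iff, false_iff] <;>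
      grind [SimpleGraph.adj_comm, SimpleGraph.irrefl]
  choose φ hφ using hex
  exact ⟨⟨⟨φ, fun v w h => (key v w _ _ (hφ v) (hφ w)).1 h⟩,
    fun {v w} => (key v w _ _ (hφ v) (hφ w)).2⟩⟩

end Embedding

/-! ### Obstructions in terms of named vertices -/

section ExplicitObstructions

variable {V : Type*} {G : SimpleGraph V}

lemma not_adj_of_cliqueFree (htri : G.CliqueFree 3) {a b c : V} (hab : G.Adj a b)
    (hac : G.Adj a c) : ¬ G.Adj b c := fun hbc => by
  classical
  exact htri {a, b, c} (SimpleGraph.is3Clique_triple_iff.2 ⟨hab, hac, hbc⟩)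

/-- Three vertices of a planar triangle-free graph do not have three common neighbours. -/
lemma false_of_three_common (hG : IsPlanar G) (htri : G.CliqueFree 3) {x y z a b d : V}
    (hxa : G.Adj x a) (hxb : G.Adj x b) (hxd : G.Adj x d) (hya : G.Adj y a) (hyb : G.Adj y b)
    (hyd : G.Adj y d) (hza : G.Adj z a) (hzb : G.Adj z b) (hzd : G.Adj z d) (hxy : x ≠ y)
    (hxz : x ≠ z) (hyz : y ≠ z) (hab : a ≠ b) (had : a ≠ d) (hbd : b ≠ d) : False := by
  have h1 := not_adj_of_cliqueFree htri hxa hxb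
  have h2 := not_adj_of_cliqueFree htri hxa hxd
  have h3 := not_adj_of_cliqueFree htri hxb hxd
  have h4 := not_adj_of_cliqueFree htri hxa.symm hya.symm
  have h5 := not_adj_of_cliqueFree htri hxa.symm hza.symm
  have h6 := not_adj_of_cliqueFree htri hya.symm hza.symm
  refine not_isCopy_of_mem_planarityObstructions hG (o := [22, 41, 41, 22, 41, 22]) (by decide)
    (fun i => [x, a, b, y, d, z].getD i x)
    (IsCopy.of_lt (by decide) (by decide) fun j hj i hi => ?_)
  change j < 6 at hj
  interval_cases j <;> interval_cases i <;> simp [rowAdj, Nat.testBit] <;>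
    grind [SimpleGraph.adj_comm, SimpleGraph.irrefl]

variable [Fintype V] [DecidableRel G.Adj]

/-- There is no four-cycle with a path of length two attached to one of its vertices. -/
lemma false_of_cycle_path (hG : HasSmallLambda2 G) (htri : G.CliqueFree 3) {c p x a z b : V}
    (hcp : G.Adj c p) (hpx : G.Adj p x) (hca : G.Adj c a) (hcb : G.Adj c b) (hza : G.Adj z a)
    (hzb : G.Adj z b) (hab : a ≠ b) (hpz : ¬ G.Adj p z) (hxa : ¬ G.Adj x a) (hxb : ¬ G.Adj x b)
    (hxz : ¬ G.Adj x z) : False := by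
  have h1 := not_adj_of_cliqueFree htri hca.symm hza.symm
  have h2 := not_adj_of_cliqueFree htri hcp hca
  have h3 := not_adj_of_cliqueFree htri hcp hcb
  have h4 := not_adj_of_cliqueFree htri hca hcb
  have h5 := not_adj_of_cliqueFree htri hcp.symm hpx
  -- The vertices are listed in the order of the rows. The nonadjacencies not assumed come from the
  -- absence of triangles, and distinctness follows from the different adjacencies.
  refine not_isCopy_of_mem_spectralObstructions hG (o := [22, 33, 9, 20, 9, 2]) (by decide)
    (fun i => [c, p, a, z, b, x].getD i c)
    (IsCopy.of_lt (by decide) (by decide) fun j hj i hi => ?_)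
  change j < 6 at hj
  interval_cases j <;> interval_cases i <;> simp [rowAdj, Nat.testBit] <;>
    grind [SimpleGraph.adj_comm, SimpleGraph.irrefl]

/-- There is no vertex `c` with two leaves and a path of length three attached. -/
lemma false_of_spider (hG : HasSmallLambda2 G) (htri : G.CliqueFree 3) {c a x y p q : V}
    (hca : G.Adj c a) (hax : G.Adj a x) (hxy : G.Adj x y) (hcp : G.Adj c p) (hcq : G.Adj c q)
    (hpq : p ≠ q) (hcy : ¬ G.Adj c y) (hxp : ¬ G.Adj x p) (hxq : ¬ G.Adj x q) (hyp : ¬ G.Adj y p)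
    (hyq : ¬ G.Adj y q) : False := by
  have h1 := not_adj_of_cliqueFree htri hca.symm hax
  have h2 := not_adj_of_cliqueFree htri hax.symm hxy
  have h3 := not_adj_of_cliqueFree htri hca hcp
  have h4 := not_adj_of_cliqueFree htri hca hcq
  have h5 := not_adj_of_cliqueFree htri hcp hcq
  refine not_isCopy_of_mem_spectralObstructions hG (o := [50, 5, 10, 4, 1, 1]) (by decide)
    (fun i => [c, a, x, y, p, q].getD i c)
    (IsCopy.of_lt (by decide) (by decide) fun j hj i hi => ?_)
  change j < 6 at hj
  interval_cases j <;> interval_cases i <;> simp [rowAdj, Nat.testBit] <;>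
    grind [SimpleGraph.adj_comm, SimpleGraph.irrefl]

/-- There is no edge `ca` with three further leaves at `c` and two at `a`. -/
lemma false_of_double_star (hG : HasSmallLambda2 G) (htri : G.CliqueFree 3) {c a x y p q r : V}
    (hca : G.Adj c a) (hax : G.Adj a x) (hay : G.Adj a y) (hcp : G.Adj c p) (hcq : G.Adj c q)
    (hcr : G.Adj c r) (hxy : x ≠ y) (hpq : p ≠ q) (hpr : p ≠ r) (hqr : q ≠ r)
    (hxp : ¬ G.Adj x p) (hxq : ¬ G.Adj x q) (hxr : ¬ G.Adj x r) (hyp : ¬ G.Adj y p)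
    (hyq : ¬ G.Adj y q) (hyr : ¬ G.Adj y r) : False := by
  have h1 := not_adj_of_cliqueFree htri hca.symm hax
  have h2 := not_adj_of_cliqueFree htri hca.symm hay
  have h3 := not_adj_of_cliqueFree htri hax hay
  have h4 := not_adj_of_cliqueFree htri hca hcp
  have h5 := not_adj_of_cliqueFree htri hca hcq
  have h6 := not_adj_of_cliqueFree htri hca hcr
  have h7 := not_adj_of_cliqueFree htri hcp hcq
  have h8 := not_adj_of_cliqueFree htri hcp hcr
  have h9 := not_adj_of_cliqueFree htri hcq hcr
  refine not_isCopy_of_mem_spectralObstructions hG (o := [114, 13, 2, 2, 1, 1, 1]) (by decide)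
    (fun i => [c, a, x, y, p, q, r].getD i c)
    (IsCopy.of_lt (by decide) (by decide) fun j hj i hi => ?_)
  change j < 7 at hj
  interval_cases j <;> interval_cases i <;> simp [rowAdj, Nat.testBit] <;>
    grind [SimpleGraph.adj_comm, SimpleGraph.irrefl]

/-- There are no nonadjacent vertices `c` and `x` with two common neighbours and four further
neighbours of `c`. -/
lemma false_of_four_pendants (hG : HasSmallLambda2 G) (htri : G.CliqueFree 3)
    {c x a b p q r s : V} (hca : G.Adj c a) (hcb : G.Adj c b) (hxa : G.Adj x a) (hxb : G.Adj x b)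
    (hcp : G.Adj c p) (hcq : G.Adj c q) (hcr : G.Adj c r) (hcs : G.Adj c s) (hab : a ≠ b)
    (hpq : p ≠ q) (hpr : p ≠ r) (hps : p ≠ s) (hqr : q ≠ r) (hqs : q ≠ s) (hrs : r ≠ s)
    (hxp : ¬ G.Adj x p) (hxq : ¬ G.Adj x q) (hxr : ¬ G.Adj x r) (hxs : ¬ G.Adj x s) : False := by
  have hA : ∀ u v, G.Adj c u → G.Adj c v → ¬ G.Adj u v := fun u v hu hv =>
    not_adj_of_cliqueFree htri hu hv
  have h1 := not_adj_of_cliqueFree htri hca.symm hxa.symm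
  refine not_isCopy_of_mem_spectralObstructions hG (o := [250, 5, 10, 5, 1, 1, 1, 1]) (by decide)
    (fun i => [c, a, x, b, p, q, r, s].getD i c)
    (IsCopy.of_lt (by decide) (by decide) fun j hj i hi => ?_)
  change j < 8 at hj
  interval_cases j <;> interval_cases i <;> simp [rowAdj, Nat.testBit] <;>
    grind [SimpleGraph.adj_comm, SimpleGraph.irrefl]

/-- There are no nonadjacent vertices `c` and `x` with three common neighbours and three further
neighbours of `c`. -/
lemma false_of_three_pendants (hG : HasSmallLambda2 G) (htri : G.CliqueFree 3)
    {c x a b d p q r : V} (hca : G.Adj c a) (hcb : G.Adj c b) (hcd : G.Adj c d) (hxa : G.Adj x a)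
    (hxb : G.Adj x b) (hxd : G.Adj x d) (hcp : G.Adj c p) (hcq : G.Adj c q) (hcr : G.Adj c r)
    (hab : a ≠ b) (had : a ≠ d) (hbd : b ≠ d) (hpq : p ≠ q) (hpr : p ≠ r) (hqr : q ≠ r)
    (hxp : ¬ G.Adj x p) (hxq : ¬ G.Adj x q) (hxr : ¬ G.Adj x r) : False := by
  have hA : ∀ u v, G.Adj c u → G.Adj c v → ¬ G.Adj u v := fun u v hu hv =>
    not_adj_of_cliqueFree htri hu hv
  have h1 := not_adj_of_cliqueFree htri hca.symm hxa.symm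
  refine not_isCopy_of_mem_spectralObstructions hG (o := [250, 5, 26, 5, 5, 1, 1, 1]) (by decide)
    (fun i => [c, a, x, b, d, p, q, r].getD i c)
    (IsCopy.of_lt (by decide) (by decide) fun j hj i hi => ?_)
  change j < 8 at hj
  interval_cases j <;> interval_cases i <;> simp [rowAdj, Nat.testBit] <;>
    grind [SimpleGraph.adj_comm, SimpleGraph.irrefl]

end ExplicitObstructions

/-! ### Structure around a vertex of degree at least six -/

section LargeDegree

variable {V : Type*} [Fintype V] [DecidableEq V] {G : SimpleGraph V} [DecidableRel G.Adj]

/-- The neighbours of `c` that are not adjacent to `x`. -/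
def missed (G : SimpleGraph V) [DecidableRel G.Adj] (c x : V) : Finset V :=
  G.neighborFinset c \ G.neighborFinset x

/-- The common neighbours of `c` and `x`. -/
def common (G : SimpleGraph V) [DecidableRel G.Adj] (c x : V) : Finset V :=
  G.neighborFinset c ∩ G.neighborFinset x

lemma mem_missed {c x a : V} : a ∈ missed G c x ↔ G.Adj c a ∧ ¬ G.Adj x a := by
  simp [missed]

lemma mem_common {c x a : V} : a ∈ common G c x ↔ G.Adj c a ∧ G.Adj x a := by
  simp [common]

lemma card_missed_add_card_common (c x : V) :
    (missed G c x).card + (common G c x).card = G.degree c :=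
  Finset.card_sdiff_add_card_inter _ _

/-- Suppose there are two common and three missed neighbours. With a fourth missed one, there is a
four-cycle with four pendant edges; otherwise exactly three are missed, so at least three are
common, and `K₂,₃` with three pendant edges appears. -/
lemma card_common_le_one_or_card_missed_le_two (hG : HasSmallLambda2 G) (htri : G.CliqueFree 3)
    {c : V} (hc : 6 ≤ G.degree c) (x : V) :
    (common G c x).card ≤ 1 ∨ (missed G c x).card ≤ 2 := by
  by_contra! h
  have hsum := card_missed_add_card_common (G := G) c x
  by_cases h4 : 3 < (missed G c x).card
  · obtain ⟨a, ha, b, hb, hab⟩ := Finset.one_lt_card.1 h.1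
    obtain ⟨p, hp, q, hq, r, hr, s, hs, hpq, hpr, hps, hqr, hqs, hrs⟩ := Finset.three_lt_card.1 h4
    rw [mem_common] at ha hb
    rw [mem_missed] at hp hq hr hs
    exact false_of_four_pendants hG htri ha.1 hb.1 ha.2 hb.2 hp.1 hq.1 hr.1 hs.1 hab hpq hpr hps
      hqr hqs hrs hp.2 hq.2 hr.2 hs.2
  · obtain ⟨a, ha, b, hb, d, hd, hab, had, hbd⟩ :=
      Finset.two_lt_card.1 (show 2 < (common G c x).card by omega)
    obtain ⟨p, hp, q, hq, r, hr, hpq, hpr, hqr⟩ := Finset.two_lt_card.1 h.2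
    rw [mem_common] at ha hb hd
    rw [mem_missed] at hp hq hr
    exact false_of_three_pendants hG htri ha.1 hb.1 hd.1 ha.2 hb.2 hd.2 hp.1 hq.1 hr.1 hab had hbd
      hpq hpr hqr hp.2 hq.2 hr.2

/-- The vertex `z` plays the role of the second vertex of large degree of `F1 s`. -/
def IsOpposite (G : SimpleGraph V) [DecidableRel G.Adj] (c z : V) : Prop :=
  z ≠ c ∧ ¬ G.Adj c z ∧ (missed G c z).card ≤ 2

/-- The vertex `x` is not `c` and has at most one neighbour among those of `c`. -/
def IsOuter (G : SimpleGraph V) [DecidableRel G.Adj] (c x : V) : Prop :=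
  x ≠ c ∧ ¬ G.Adj c x ∧ (common G c x).card ≤ 1

lemma eq_or_adj_or_isOpposite_or_isOuter (hG : HasSmallLambda2 G) (htri : G.CliqueFree 3)
    {c : V} (hc : 6 ≤ G.degree c) (x : V) :
    x = c ∨ G.Adj c x ∨ IsOpposite G c x ∨ IsOuter G c x := by
  have := card_common_le_one_or_card_missed_le_two hG htri hc x
  unfold IsOpposite IsOuter
  tauto

/-- Many neighbours of `c` avoid the neighbourhoods of two outer vertices. -/
lemma three_lt_card_missed_inter_missed {c x y : V} (hc : 6 ≤ G.degree c) (hx : IsOuter G c x)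
    (hy : IsOuter G c y) : 3 < (missed G c x ∩ missed G c y).card := by
  have h1 := card_missed_add_card_common (G := G) c x
  have h2 := card_missed_add_card_common (G := G) c y
  have h3 := Finset.card_union_add_card_inter (missed G c x) (missed G c y)
  have h4 : (missed G c x ∪ missed G c y).card ≤ G.degree c := by
    rw [← SimpleGraph.card_neighborFinset_eq_degree]
    exact Finset.card_le_card (Finset.union_subset Finset.sdiff_subset Finset.sdiff_subset)
  have h5 := hx.2.2
  have h6 := hy.2.2
  omega

/-- Many common neighbours of `c` and an opposite vertex avoid the neighbourhood of an outer
vertex. -/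
lemma two_lt_card_common_inter_missed {c z x : V} (hc : 6 ≤ G.degree c) (hz : IsOpposite G c z)
    (hx : IsOuter G c x) : 2 < (common G c z ∩ missed G c x).card := by
  have h1 := card_missed_add_card_common (G := G) c x
  have h2 := card_missed_add_card_common (G := G) c z
  have h3 := Finset.card_union_add_card_inter (common G c z) (missed G c x)
  have h4 : (common G c z ∪ missed G c x).card ≤ G.degree c := by
    rw [← SimpleGraph.card_neighborFinset_eq_degree]
    exact Finset.card_le_card (Finset.union_subset Finset.inter_subset_left Finset.sdiff_subset)
  have h5 := hz.2.2
  have h6 := hx.2.2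
  omega

/-- The path `c`, `a`, `x`, `y` and two neighbours of `c` missed by both outer vertices would form
the spider. Only `x` is required to hang on a neighbour of `c`. -/
lemma not_adj_of_isOuter (hG : HasSmallLambda2 G) (htri : G.CliqueFree 3) {c a x y : V}
    (hc : 6 ≤ G.degree c) (hx : IsOuter G c x) (hy : IsOuter G c y) (hca : G.Adj c a)
    (hax : G.Adj a x) : ¬ G.Adj x y := by
  intro hxy
  obtain ⟨p, hp, q, hq, r, hr, hpq, -⟩ := Finset.two_lt_card.1
    (lt_trans (by norm_num) (three_lt_card_missed_inter_missed hc hx hy))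
  rw [Finset.mem_inter, mem_missed, mem_missed] at hp hq
  exact false_of_spider hG htri hca hax hxy hp.1.1 hq.1.1 hpq hy.2.1 hp.1.2 hq.1.2 hp.2.2 hq.2.2

/-- Two outer vertices at the same `a`, together with three neighbours of `c` that both miss, would
form the double star. Hence each neighbour of `c` carries at most one outer vertex. -/
lemma eq_of_isOuter (hG : HasSmallLambda2 G) (htri : G.CliqueFree 3) {c a x y : V}
    (hc : 6 ≤ G.degree c) (hx : IsOuter G c x) (hy : IsOuter G c y) (hca : G.Adj c a)
    (hax : G.Adj a x) (hay : G.Adj a y) : x = y := by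
  by_contra hxy
  obtain ⟨p, hp, q, hq, r, hr, hpq, hpr, hqr⟩ := Finset.two_lt_card.1
    (lt_trans (by norm_num) (three_lt_card_missed_inter_missed hc hx hy))
  rw [Finset.mem_inter, mem_missed, mem_missed] at hp hq hr
  exact false_of_double_star hG htri hca hax hay hp.1.1 hq.1.1 hr.1.1 hxy hpq hpr hqr hp.1.2 hq.1.2
    hr.1.2 hp.2.2 hq.2.2 hr.2.2

/-- If `z` is adjacent to both, there is a triangle. If it is adjacent to neither, two common
neighbours of `c` and `z` missed by `x` close a four-cycle on which the path `c`, `a`, `x` hangs. -/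
lemma adj_iff_of_isOpposite (hG : HasSmallLambda2 G) (htri : G.CliqueFree 3) {c z a x : V}
    (hc : 6 ≤ G.degree c) (hz : IsOpposite G c z) (hx : IsOuter G c x) (hca : G.Adj c a)
    (hax : G.Adj a x) : G.Adj z x ↔ ¬ G.Adj z a := by
  constructor
  · intro hzx hza
    exact not_adj_of_cliqueFree htri hza hzx hax
  · intro hza
    by_contra hzx
    obtain ⟨p, hp, q, hq, r, hr, hpq, -⟩ :=
      Finset.two_lt_card.1 (two_lt_card_common_inter_missed hc hz hx)
    rw [Finset.mem_inter, mem_common, mem_missed] at hp hq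
    exact false_of_cycle_path hG htri hca hax hp.1.1 hq.1.1 hp.1.2 hq.1.2 hpq
      (fun h => hza h.symm) hp.2.2 hq.2.2 (fun h => hzx h.symm)

/-- The same obstruction with the roles of `c` and `z` exchanged: otherwise the path `z`, `y'`, `y`
hangs on a four-cycle through `z` and `c`. -/
lemma adj_of_isOpposite_of_adj (hG : HasSmallLambda2 G) (htri : G.CliqueFree 3) {c z y y' : V}
    (hc : 6 ≤ G.degree c) (hz : IsOpposite G c z) (hy : IsOuter G c y) (hy' : ¬ G.Adj c y')
    (hzy' : G.Adj z y') (hyy' : G.Adj y' y) : G.Adj z y := by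
  by_contra hzy
  obtain ⟨p, hp, q, hq, r, hr, hpq, -⟩ :=
      Finset.two_lt_card.1 (two_lt_card_common_inter_missed hc hz hy)
  rw [Finset.mem_inter, mem_common, mem_missed] at hp hq
  exact false_of_cycle_path hG htri hzy' hyy' hp.1.2 hq.1.2 hp.1.1 hq.1.1 hpq
    (fun h => hy' h.symm) hp.2.2 hq.2.2 (fun h => hy.2.1 h.symm)

lemma eq_of_isOpposite (hG : HasSmallLambda2 G) (hplanar : IsPlanar G) (htri : G.CliqueFree 3)
    {c z z' : V} (hc : 6 ≤ G.degree c) (hz : IsOpposite G c z) (hz' : IsOpposite G c z') :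
    z = z' := by
  by_contra hne
  have h1 := card_missed_add_card_common (G := G) c z
  have h2 := card_missed_add_card_common (G := G) c z'
  have h3 := Finset.card_union_add_card_inter (common G c z) (common G c z')
  have h4 : (common G c z ∪ common G c z').card ≤ G.degree c := by
    rw [← SimpleGraph.card_neighborFinset_eq_degree]
    exact Finset.card_le_card (Finset.union_subset Finset.inter_subset_left
      Finset.inter_subset_left)
  have h5 := hz.2.2
  have h6 := hz'.2.2
  -- Three common neighbours of `c`, `z` and `z'` would form `K₃,₃`.
  by_cases h7 : 2 < (common G c z ∩ common G c z').card
  · obtain ⟨a, ha, b, hb, d, hd, hab, had, hbd⟩ := Finset.two_lt_card.1 h7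
    rw [Finset.mem_inter, mem_common, mem_common] at ha hb hd
    exact false_of_three_common hplanar htri ha.1.1 hb.1.1 hd.1.1 ha.1.2 hb.1.2 hd.1.2 ha.2.2
      hb.2.2 hd.2.2 hz.1.symm hz'.1.symm hne hab had hbd
  -- Otherwise at least four of the six or more neighbours of `c` are missed by `z` or `z'`. Since
  -- each misses at most two, each misses exactly two and the two pairs are disjoint.
  · have h8 : (missed G c z ∪ missed G c z').card ≥ 4 := by
      have h9 : missed G c z ∪ missed G c z' =
          G.neighborFinset c \ (common G c z ∩ common G c z') := by
        ext a
        simp only [Finset.mem_union, mem_missed, Finset.mem_sdiff, Finset.mem_inter, mem_common,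
          SimpleGraph.mem_neighborFinset]
        tauto
      have h10 : common G c z ∩ common G c z' ⊆ G.neighborFinset c :=
        Finset.inter_subset_left.trans Finset.inter_subset_left
      rw [h9, Finset.card_sdiff_of_subset h10, SimpleGraph.card_neighborFinset_eq_degree]
      omega
    have h11 := Finset.card_union_add_card_inter (missed G c z) (missed G c z')
    have h12 : missed G c z ∩ missed G c z' = ∅ := Finset.card_eq_zero.1 (by omega)
    have hdisj : ∀ a, a ∈ missed G c z → a ∈ missed G c z' → False := fun a ha ha' => by
      have : a ∈ missed G c z ∩ missed G c z' := Finset.mem_inter.2 ⟨ha, ha'⟩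
      rw [h12] at this
      simp at this
    obtain ⟨a, ha, b, hb, hab⟩ := Finset.one_lt_card.1 (show 1 < (missed G c z').card by omega)
    obtain ⟨p, hp⟩ := Finset.card_pos.1 (show 0 < (missed G c z).card by omega)
    obtain ⟨q, hq⟩ := Finset.card_pos.1
      (show 0 < (common G c z ∩ common G c z').card by omega)
    have hza : G.Adj z a := by
      by_contra h
      exact hdisj a (mem_missed.2 ⟨(mem_missed.1 ha).1, h⟩) ha
    have hzb : G.Adj z b := by
      by_contra h
      exact hdisj b (mem_missed.2 ⟨(mem_missed.1 hb).1, h⟩) hb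
    have hzp : G.Adj z' p := by
      by_contra h
      exact hdisj p hp (mem_missed.2 ⟨(mem_missed.1 hp).1, h⟩)
    rw [mem_missed] at ha hb hp
    rw [Finset.mem_inter, mem_common, mem_common] at hq
    -- The two vertices missed by `z'` close a four-cycle with `c` and `z`, and `c`, `p`, `z'` hangs
    -- on it. A common neighbour `q` rules out an edge between `z` and `z'`.
    exact false_of_cycle_path hG htri hp.1 hzp.symm ha.1 hb.1 hza hzb hab (fun h => hp.2 h.symm)
      ha.2 hb.2 (fun h => not_adj_of_cliqueFree htri hq.1.2.symm hq.2.2.symm h.symm)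

/-- The vertices that are placed next to the subdivided edges of `F1 s`. -/
def specialVertices (G : SimpleGraph V) [DecidableRel G.Adj] (c z : V) : Finset V :=
  missed G c z ∪ (G.neighborFinset z).filter fun y => ¬ G.Adj c y ∧ common G c y = ∅

lemma card_specialVertices_le_two (hG : HasSmallLambda2 G) (htri : G.CliqueFree 3) {c z : V}
    (hc : 6 ≤ G.degree c) (hz : IsOpposite G c z) : (specialVertices G c z).card ≤ 2 := by
  by_contra! h
  have h1 := card_missed_add_card_common (G := G) c z
  have h2 := hz.2.2
  set Y := (G.neighborFinset z).filter fun y => ¬ G.Adj c y ∧ common G c y = ∅ with hYdef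
  have hY : ∀ {y}, y ∈ Y → G.Adj z y ∧ ¬ G.Adj c y ∧ ∀ a, G.Adj c a → ¬ G.Adj y a := by
    intro y hy
    rw [hYdef, Finset.mem_filter, SimpleGraph.mem_neighborFinset] at hy
    refine ⟨hy.1, hy.2.1, fun a ha hya => ?_⟩
    have := mem_common.2 ⟨ha, hya⟩
    rw [hy.2.2] at this
    simp at this
  have h3 : 2 < (missed G c z).card + Y.card := lt_of_lt_of_le h (Finset.card_union_le _ _)
  obtain ⟨q, hq, r, hr, s, hs, hqr, hqs, hrs⟩ :=
    Finset.two_lt_card.1 (show 2 < (common G c z).card by omega)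
  rw [mem_common] at hq hr hs
  -- Three cases exceed the bound: two missed vertices and one in `Y` give a spider centred at `c`;
  -- three in `Y` give `K₂,₃` with three pendant edges at `z`; one missed and two in `Y` give a
  -- spider centred at `z`.
  rcases Nat.lt_or_ge 1 (missed G c z).card with h4 | h4
  · obtain ⟨p, hp, p', hp', hpp⟩ := Finset.one_lt_card.1 h4
    obtain ⟨y, hy⟩ := Finset.card_pos.1 (show 0 < Y.card by omega)
    rw [mem_missed] at hp hp'
    have hy := hY hy
    exact false_of_spider hG htri hq.1 hq.2.symm hy.1 hp.1 hp'.1 hpp hy.2.1 hp.2 hp'.2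
      (hy.2.2 p hp.1) (hy.2.2 p' hp'.1)
  · rcases Nat.lt_or_ge 2 Y.card with h5 | h5
    · obtain ⟨y₁, hy₁, y₂, hy₂, y₃, hy₃, h12, h13, h23⟩ := Finset.two_lt_card.1 h5
      have hy₁ := hY hy₁
      have hy₂ := hY hy₂
      have hy₃ := hY hy₃
      exact false_of_three_pendants hG htri hq.2 hr.2 hs.2 hq.1 hr.1 hs.1 hy₁.1 hy₂.1 hy₃.1
        hqr hqs hrs h12 h13 h23 hy₁.2.1 hy₂.2.1 hy₃.2.1
    · obtain ⟨p, hp⟩ := Finset.card_pos.1 (show 0 < (missed G c z).card by omega)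
      obtain ⟨y₁, hy₁, y₂, hy₂, h12⟩ := Finset.one_lt_card.1 (show 1 < Y.card by omega)
      rw [mem_missed] at hp
      have hy₁ := hY hy₁
      have hy₂ := hY hy₂
      exact false_of_spider hG htri hq.2 hq.1.symm hp.1 hy₁.1 hy₂.1 h12 hp.2 hy₁.2.1 hy₂.2.1
        (fun h => hy₁.2.2 p hp.1 h.symm) (fun h => hy₂.2.2 p hp.1 h.symm)

/-- An outer vertex without common neighbours with `c` is adjacent to a vertex opposite to `c`. -/
lemma exists_isOpposite_adj (hG : HasSmallLambda2 G) (htri : G.CliqueFree 3)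
    (hconn : G.Connected) {c y : V} (hc : 6 ≤ G.degree c) (hy : IsOuter G c y)
    (hy0 : common G c y = ∅) : ∃ z, IsOpposite G c z ∧ G.Adj z y := by
  by_contra! hno
  obtain ⟨p⟩ := hconn.preconnected y c
  -- The set of counterexamples is closed under adjacency and does not contain `c`, which
  -- contradicts a walk from `y` to `c`. The crucial case is an outer neighbour: it cannot hang on a
  -- neighbour of `c`, and an opposite vertex adjacent to it would also be adjacent to the vertex
  -- before it.
  obtain ⟨d, -, ⟨h1, h2, h3⟩, hd2⟩ := p.exists_boundary_dart
    {y | IsOuter G c y ∧ common G c y = ∅ ∧ ∀ z, IsOpposite G c z → ¬ G.Adj z y} ⟨hy, hy0, hno⟩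
    (fun h => h.1.1 rfl)
  refine hd2 ?_
  have hadj := d.adj
  rcases eq_or_adj_or_isOpposite_or_isOuter hG htri hc d.snd with h | h | h | h
  · rw [h] at hadj
    exact absurd hadj.symm h1.2.1
  · have := mem_common.2 ⟨h, hadj⟩
    rw [h2] at this
    simp at this
  · exact absurd hadj.symm (h3 _ h)
  · refine ⟨h, ?_, fun z hz hzd => h3 z hz ?_⟩
    · rw [Finset.eq_empty_iff_forall_notMem]
      intro a ha
      rw [mem_common] at ha
      exact not_adj_of_isOuter hG htri hc h h1 ha.1 ha.2.symm hadj.symm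
    · exact adj_of_isOpposite_of_adj hG htri hc hz h1 h.2.1 hzd hadj.symm

/-- A graph of the class with a vertex of degree at least six is an induced subgraph of some
`F1 s`. -/
theorem isIndContained_F1_of_six_le_degree (hG : HasSmallLambda2 G) (hplanar : IsPlanar G)
    (htri : G.CliqueFree 3) (hconn : G.Connected) {c : V} (hc : 6 ≤ G.degree c) :
    G.IsIndContained (F1 (Fintype.card V + 2)) := by
  -- Quantifying over opposite vertices treats uniformly the case where there is none, in which `T`
  -- is empty. There is never more than one.
  obtain ⟨T, hT, hT'⟩ : ∃ T : Finset V, T.card ≤ 2 ∧ ∀ v, v ∈ T ↔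
      ∃ z, IsOpposite G c z ∧ v ∈ specialVertices G c z := by
    by_cases h : ∃ z, IsOpposite G c z
    · obtain ⟨z, hz⟩ := h
      refine ⟨specialVertices G c z, card_specialVertices_le_two hG htri hc hz, fun v => ?_⟩
      refine ⟨fun h => ⟨z, hz, h⟩, ?_⟩
      rintro ⟨z', hz', h⟩
      rwa [eq_of_isOpposite hG hplanar htri hc hz hz']
    · refine ⟨∅, by simp, fun v => ?_⟩
      simp only [Finset.notMem_empty, false_iff]
      rintro ⟨z, hz, -⟩
      exact h ⟨z, hz⟩
  have hTA : ∀ a z, G.Adj c a → IsOpposite G c z → (a ∈ T ↔ ¬ G.Adj z a) := by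
    intro a z ha hz
    rw [hT']
    constructor
    · rintro ⟨z', hz', h⟩
      rw [eq_of_isOpposite hG hplanar htri hc hz hz']
      rw [specialVertices, Finset.mem_union, mem_missed, Finset.mem_filter] at h
      rcases h with h | h
      · exact h.2
      · exact absurd ha h.2.1
    · intro h
      exact ⟨z, hz, Finset.mem_union_left _ (mem_missed.2 ⟨ha, h⟩)⟩
  have hempty : ∀ y a, common G c y = ∅ → G.Adj c a → ¬ G.Adj a y := fun y a hy ha h => by
    have := mem_common.2 ⟨ha, h.symm⟩
    rw [hy] at this
    simp at this
  have hO : ∀ y z, IsOuter G c y → common G c y = ∅ → IsOpposite G c z → G.Adj z y := by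
    intro y z hy hy0 hz
    obtain ⟨z', hz', h⟩ := exists_isOpposite_adj hG htri hconn hc hy hy0
    rwa [eq_of_isOpposite hG hplanar htri hc hz hz']
  refine isIndContained_F1_of_structure G c (G.Adj c) (IsOpposite G c)
    (fun y => IsOuter G c y ∧ common G c y = ∅)
    (fun x a => IsOuter G c x ∧ G.Adj c a ∧ G.Adj a x) T hT ?_ (fun _ => Iff.rfl)
    (fun a b ha hb => not_adj_of_cliqueFree htri ha hb)
    (fun z z' hz hz' => eq_of_isOpposite hG hplanar htri hc hz hz')
    (fun a z ha hz => by rw [hTA a z ha hz, not_not, G.adj_comm]) (fun z hz => hz.2.1)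
    (fun y hy => hy.1.2.1) (fun x a h => h.1.2.1) (fun a y ha hy => hempty y a hy.2 ha)
    (fun x a h => h.2.1) ?_ (fun z y hz hy => hO y z hy.1 hy.2 hz) ?_ ?_ ?_ ?_ ?_ ?_
  · intro v
    rcases eq_or_adj_or_isOpposite_or_isOuter hG htri hc v with h | h | h | h
    · exact Or.inl h
    · exact Or.inr (Or.inl h)
    · exact Or.inr (Or.inr (Or.inl h))
    · rcases (common G c v).eq_empty_or_nonempty with h0 | ⟨a, ha⟩
      · exact Or.inr (Or.inr (Or.inr (Or.inl ⟨h, h0⟩)))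
      · rw [mem_common] at ha
        exact Or.inr (Or.inr (Or.inr (Or.inr ⟨a, h, ha.1, ha.2.symm⟩)))
  · rintro b x a hb ⟨hx, hca, hax⟩
    constructor
    · intro hbx
      exact Finset.card_le_one.1 hx.2.2 b (mem_common.2 ⟨hb, hbx.symm⟩) a
        (mem_common.2 ⟨hca, hax.symm⟩)
    · rintro rfl
      exact hax
  · rintro z x a hz ⟨hx, hca, hax⟩
    rw [hTA a z hca hz]
    exact adj_iff_of_isOpposite hG htri hc hz hx hca hax
  · rintro y y' ⟨hy, hy0⟩ ⟨hy', hy0'⟩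
    obtain ⟨z, hz, hzy⟩ := exists_isOpposite_adj hG htri hconn hc hy hy0
    -- Both vertices are adjacent to the opposite vertex, so an edge between them would close a
    -- triangle.
    exact not_adj_of_cliqueFree htri hzy (hO y' z hy' hy0' hz)
  · rintro y x a ⟨hy, -⟩ ⟨hx, hca, hax⟩ h
    exact not_adj_of_isOuter hG htri hc hx hy hca hax h.symm
  · rintro x a y b ⟨hx, hca, hax⟩ ⟨hy, -, -⟩
    exact not_adj_of_isOuter hG htri hc hx hy hca hax
  · rintro x y a ⟨hx, hca, hax⟩ ⟨hy, -, hay⟩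
    exact eq_of_isOuter hG htri hc hx hy hca hax hay
  · rintro y ⟨hy, hy0⟩
    obtain ⟨z, hz, hzy⟩ := exists_isOpposite_adj hG htri hconn hc hy hy0
    rw [hT']
    refine ⟨z, hz, Finset.mem_union_right _ ?_⟩
    rw [Finset.mem_filter, SimpleGraph.mem_neighborFinset]
    exact ⟨hzy, hy.2.1, hy0⟩

end LargeDegree

/-! ### The member of the infinite family used as a target -/

section SmallTarget

instance {s : ℕ} : DecidableEq (F1Vertex s) := (F1Vertex.equivSum s).decidableEq

instance {s : ℕ} : DecidableRel (F1Edge s) := fun a b =>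
  match a, b with
  | .v2, .u _ => isTrue trivial
  | .v1, .u i => inferInstanceAs (Decidable (2 ≤ i.val))
  | .v1, .w i => inferInstanceAs (Decidable (i.val < 2))
  | .u i, .w j => inferInstanceAs (Decidable (i = j))
  | .v1, .v1 => isFalse id
  | .v1, .v2 => isFalse id
  | .v2, .v1 => isFalse id
  | .v2, .v2 => isFalse id
  | .v2, .w _ => isFalse id
  | .u _, .v1 => isFalse id
  | .u _, .v2 => isFalse id
  | .u _, .u _ => isFalse id
  | .w _, .v1 => isFalse id
  | .w _, .v2 => isFalse id
  | .w _, .u _ => isFalse id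
  | .w _, .w _ => isFalse id

instance {s : ℕ} : DecidableRel (F1 s).Adj := fun a b =>
  decidable_of_iff _ (SimpleGraph.fromRel_adj _ a b).symm

/-- The numbering of the vertices of `F1 7` that is used in `targets`. -/
def F1Vertex.ofNat (i : ℕ) : F1Vertex 7 :=
  if i = 0 then .v1 else if i = 1 then .v2
  else if i < 9 then .u (Fin.ofNat 7 (i - 2)) else .w (Fin.ofNat 7 (i - 9))

lemma isCopy_F1 : IsCopy (F1 7) 16 (rowAdj (targets.getD 0 [])) F1Vertex.ofNat where
  inj := by decide +kernel
  adj_iff := by decide +kernel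

end SmallTarget

/-! ### Graphs with all degrees below six -/

section SmallDegree

variable {V : Type*} [Fintype V] {G : SimpleGraph V} [DecidableRel G.Adj]

/-- An unlisted graph would keep growing its copy through all the lists, and the list after the
twelfth is empty. The degree bound serves to exclude the star, without which the generation would
not end. -/
theorem isListed_of_degree_lt_six (hG : HasSmallLambda2 G) (hplanar : IsPlanar G)
    (htri : G.CliqueFree 3) (hconn : G.Connected) (hdeg : ∀ v, G.degree v < 6) :
    IsListed targets G := by
  have hobs := not_isCopy_of_mem_obstructions hG hplanar hdeg
  have step := fun n L next => ContainsEntry.succ (targets := targets) (n := n) (L := L)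
    (next := next) hconn htri obstructions_valid hobs
  obtain ⟨v⟩ := hconn.nonempty
  have h1 : ContainsEntry G 1 level1 := by
    refine ⟨_, List.mem_cons_self, fun _ => v, fun i hi j hj _ => by omega, fun i hi j hj => ?_⟩
    obtain rfl : i = 0 := by omega
    obtain rfl : j = 0 := by omega
    simp [rowAdj]
  by_contra hno
  have h2 := (step 1 _ _ (by norm_num) level1_check h1).resolve_left hno
  have h3 := (step 2 _ _ (by norm_num) level2_check h2).resolve_left hno
  have h4 := (step 3 _ _ (by norm_num) level3_check h3).resolve_left hno
  have h5 := (step 4 _ _ (by norm_num) level4_check h4).resolve_left hno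
  have h6 := (step 5 _ _ (by norm_num) level5_check h5).resolve_left hno
  have h7 := (step 6 _ _ (by norm_num) level6_check h6).resolve_left hno
  have h8 := (step 7 _ _ (by norm_num) level7_check h7).resolve_left hno
  have h9 := (step 8 _ _ (by norm_num) level8_check h8).resolve_left hno
  have h10 := (step 9 _ _ (by norm_num) level9_check h9).resolve_left hno
  have h11 := (step 10 _ _ (by norm_num) level10_check h10).resolve_left hno
  have h12 := (step 11 _ _ (by norm_num) level11_check h11).resolve_left hno
  obtain ⟨e, he, -⟩ := (step 12 _ _ (by norm_num) level12_check h12).resolve_left hno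
  simp at he

end SmallDegree

end TriangleFreePlanar

theorem theorem3p1 {V : Type*} [Fintype V] [DecidableEq V] (G : SimpleGraph V)
    [DecidableRel G.Adj] (hV : 1 < Fintype.card V) (hconn : G.Connected)
    (htri : G.CliqueFree 3) (hplanar : TriangleFreePlanar.IsPlanar G) :
    TriangleFreePlanar.lambda2 G hV ≤ 1 ↔
      (∃ s : ℕ, 3 ≤ s ∧ G.IsIndContained (TriangleFreePlanar.F1 s)) ∨
      G.IsIndContained TriangleFreePlanar.H1 ∨
      G.IsIndContained TriangleFreePlanar.H2 ∨
      G.IsIndContained TriangleFreePlanar.H3 ∨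
      G.IsIndContained TriangleFreePlanar.H4 ∨
      G.IsIndContained TriangleFreePlanar.H5 ∨
      G.IsIndContained TriangleFreePlanar.H6 ∨
      G.IsIndContained TriangleFreePlanar.H7 ∨
      G.IsIndContained TriangleFreePlanar.H8 ∨
      G.IsIndContained TriangleFreePlanar.H9 ∨
      G.IsIndContained TriangleFreePlanar.H10 ∨
      G.IsIndContained TriangleFreePlanar.H11 ∨
      G.IsIndContained TriangleFreePlanar.H12 ∨
      G.IsIndContained TriangleFreePlanar.H13 := by
  classical
  open TriangleFreePlanar in
  rw [lambda2_le_one_iff]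
  constructor
  · intro hG
    -- The threshold six matches the excluded star: below it the generation applies, from it onwards
    -- the structure around one large vertex.
    by_cases hdeg : ∀ v, G.degree v < 6
    · obtain ⟨t, ht⟩ := (isListed_of_degree_lt_six hG hplanar htri hconn hdeg).isIndContained
      rcases Nat.lt_or_ge t 14 with h | h
      · interval_cases t
        · exact Or.inl ⟨7, by norm_num, ht isCopy_F1⟩
        · have := ht isCopy_H1; tauto
        · have := ht isCopy_H2; tauto
        · have := ht isCopy_H3; tauto
        · have := ht isCopy_H4; tauto
        · have := ht isCopy_H5; tauto
        · have := ht isCopy_H6; tauto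
        · have := ht isCopy_H7; tauto
        · have := ht isCopy_H8; tauto
        · have := ht isCopy_H9; tauto
        · have := ht isCopy_H10; tauto
        · have := ht isCopy_H11; tauto
        · have := ht isCopy_H12; tauto
        · have := ht isCopy_H13; tauto
      -- An index out of range denotes the empty graph, of which `H1` has a copy vacuously; so no
      -- separate argument is needed that this does not happen.
      · rw [List.getD_eq_default _ _ (show targets.length ≤ t from h)] at ht
        have := ht (T := H1) (g := fun _ => 0) ⟨fun i hi => absurd hi (Nat.not_lt_zero i),
          fun i hi => absurd hi (Nat.not_lt_zero i)⟩
        tauto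
    · push Not at hdeg
      obtain ⟨c, hc⟩ := hdeg
      exact Or.inl ⟨_, by omega, isIndContained_F1_of_six_le_degree hG hplanar htri hconn hc⟩
  · rintro (⟨s, -, ⟨f⟩⟩ | ⟨⟨f⟩⟩ | ⟨⟨f⟩⟩ | ⟨⟨f⟩⟩ | ⟨⟨f⟩⟩ | ⟨⟨f⟩⟩ | ⟨⟨f⟩⟩ | ⟨⟨f⟩⟩ | ⟨⟨f⟩⟩ | ⟨⟨f⟩⟩ |
      ⟨⟨f⟩⟩ | ⟨⟨f⟩⟩ | ⟨⟨f⟩⟩ | ⟨⟨f⟩⟩)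
    · exact hasSmallLambda2_F1.of_embedding f
    · exact hasSmallLambda2_H1.of_embedding f
    · exact hasSmallLambda2_H2.of_embedding f
    · exact hasSmallLambda2_H3.of_embedding f
    · exact hasSmallLambda2_H4.of_embedding f
    · exact hasSmallLambda2_H5.of_embedding f
    · exact hasSmallLambda2_H6.of_embedding f
    · exact hasSmallLambda2_H7.of_embedding f
    · exact hasSmallLambda2_H8.of_embedding f
    · exact hasSmallLambda2_H9.of_embedding f
    · exact hasSmallLambda2_H10.of_embedding f
    · exact hasSmallLambda2_H11.of_embedding f
    · exact hasSmallLambda2_H12.of_embedding f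
    · exact hasSmallLambda2_H13.of_embedding f
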